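/- **Setting.** Let $\Sigma$ be a simply connected smooth surface. Let $\mathbb S^3$ be the group of unit quaternions with its standard metric and the left invariant orthonormal frame $E_1,E_2,E_3$ given at the identity by $i,j,k$ (so $[E_1,E_2]=2E_3$, $[E_2,E_3]=2E_1$, $[E_3,E_1]=2E_2$), oriented by this frame; in $\mathbb R^3$ take the standard frame and orientation. For an immersion $\varphi$ of $\Sigma$ in $M=\mathbb S^3$ or $M=\mathbb R^3$ ($\Sigma$ carrying the induced metric) and a smooth unit normal field $N=\sum_k N_kE_k(\varphi)$, the *Gauss map* is $g=\dfrac{N_1+iN_2}{1-N_3}:\Sigma\to\mathbb C\cup\{\infty\}$, the second fundamental form is $II=\langle-\nabla N,d\varphi\rangle$, and the extrinsic curvature is the determinant of the shape operator. Local coordinates $(u,v)$ are *null* for $II$ if $II=2f\,du\,dv$; $g$ is *compatible* with them if $f>0$; their *orientation sign* is the sign of $\det(\varphi_u,\varphi_v,N)$. Below, $(u,v)$ ranges over a fixed family of local coordinate systems (possibly a single one) whose domains cover $\Sigma$; all conditions are understood in each of them. **From $\mathbb S^3$ to $\mathbb R^3$.** Let $\psi:\Sigma\to\mathbb S^3$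 be an immersion with Gauss map $g$ and extrinsic curvature $K<0$, $K\ne-1$ everywhere. Let $(u,v)$ be null coordinates for $II$ with orientation sign $+$ (proper null coordinates) with which $g$ is compatible. Assume $$\left(\frac{-4K_u}{\sqrt{-K}\,(1+K)}\right)_v=0 .$$ Then there is an immersion $\psi^*:\Sigma\to\mathbb R^3$ with the same Gauss map $g$ and with extrinsic curvature a smooth function $K^*<0$ such that $$\left(\log\frac{(1+\sqrt{-K})^4}{-K}\right)_u=\bigl(\log(-K^*)\bigr)_u,\qquad \left(\log\frac{(-1+\sqrt{-K})^4}{-K}\right)_v=\bigl(\log(-K^*)\bigr)_v .\tag{1}$$ Moreover $(u,v)$ are null coordinates for the second fundamental form of $\psi^*$, $g$ is compatible with them, and their orientation sign for $\psi^*$ is $+$ if $K<-1$ and $-$ if $-1<K<0$. **Conversely**, let $\psi^*:\Sigma\to\mathbb R^3$ be an immersion with Gauss map $g$ and extrinsic curvature $K^*<0$, and let $(u,v)$ be null coordinates for its second fundamental form with which $g$ is compatible, all of the same orientation sign $\varepsilon\in\{1,-1\}$. Let $K:\Sigma\to\mathbb R\setminus\{-1\}$ be a smooth negative function satisfying (1).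 Then there is an immersion $\psi:\Sigma\to\mathbb S^3$ with the same Gauss map $g$ and extrinsic curvature $K$. Moreover $(u,v)$ are null coordinates for the second fundamental form $2f\,du\,dv$ of $\psi$, and both $f$ and $\det(\psi_u,\psi_v,N)$ have the sign of $-\varepsilon(1+K)$. Thus, if $\varepsilon=1$ and $K<-1$, or if $\varepsilon=-1$ and $-1<K<0$, then $(u,v)$ are proper null coordinates for $\psi$ and $g$ is compatible with them; in the two remaining cases this holds for $(-u,v)$ in place of $(u,v)$. -/

import Mathlib

open scoped Manifold ContDiff Quaternion RealInnerProductSpace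

noncomputable section

namespace NegCurv

/-- The coordinate plane, with coordinates `(u, v) = (x 0, x 1)`. -/
abbrev E2 : Type := EuclideanSpace ℝ (Fin 2)

/-- Euclidean 3-space. It is also the Lie algebra of the 3-sphere, the vector `(w₁, w₂, w₃)`
standing for `w₁ E₁ + w₂ E₂ + w₃ E₃`. -/
abbrev E3 : Type := EuclideanSpace ℝ (Fin 3)

/-! ### Gauss maps with values in the extended plane -/

/-- Stereographic projection from the north pole, `n ↦ (n₁ + i n₂) / (1 - n₃)`. -/
def stereo (n : E3) : OnePoint ℂ :=
  open Classical in
  if n 2 = 1 then OnePoint.infty else (((⟨n 0, n 1⟩ : ℂ) / ((1 - n 2 : ℝ) : ℂ) : ℂ) : OnePoint ℂ)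

/-- The inverse of stereographic projection,
`g ↦ (g + ḡ, -i (g - ḡ), |g|² - 1) / (1 + |g|²)` and `∞ ↦ (0, 0, 1)`. -/
def invStereo : OnePoint ℂ → E3
  | OnePoint.infty => !₂[0, 0, 1]
  | OnePoint.some g =>
      !₂[2 * g.re / (1 + ‖g‖ ^ 2), 2 * g.im / (1 + ‖g‖ ^ 2), (‖g‖ ^ 2 - 1) / (1 + ‖g‖ ^ 2)]

theorem norm_invStereo (w : OnePoint ℂ) : ‖invStereo w‖ = 1 := by
  have key : ‖invStereo w‖ ^ 2 = 1 := by
    rw [EuclideanSpace.norm_sq_eq, Fin.sum_univ_three]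
    cases w with
    | infty => simp [invStereo]
    | coe g =>
      have h1 : ‖g‖ ^ 2 = g.re ^ 2 + g.im ^ 2 := by
        rw [← Complex.normSq_eq_norm_sq, Complex.normSq_apply]; ring
      have h2 : 1 + (g.re ^ 2 + g.im ^ 2) ≠ 0 := by positivity
      have h3 : ∀ a b c : ℝ, ‖a‖ ^ 2 + ‖b‖ ^ 2 + ‖c‖ ^ 2 = a ^ 2 + b ^ 2 + c ^ 2 := by
        intro a b c; simp
      rw [h3]
      simp only [invStereo, h1]
      simp
      field_simp
      ring
  nlinarith [norm_nonneg (invStereo w)]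

/-- `invStereo` inverts stereographic projection on the unit sphere. -/
theorem invStereo_stereo (n : E3) (hn : ‖n‖ = 1) : invStereo (stereo n) = n := by
  have h : n 0 ^ 2 + n 1 ^ 2 + n 2 ^ 2 = 1 := by
    have := EuclideanSpace.norm_sq_eq n
    rw [hn, Fin.sum_univ_three] at this
    simpa using this.symm
  unfold stereo
  split_ifs with h2
  · have h0 : n 0 = 0 := by rw [h2] at h; nlinarith [sq_nonneg (n 0), sq_nonneg (n 1)]
    have h1 : n 1 = 0 := by rw [h2] at h; nlinarith [sq_nonneg (n 0), sq_nonneg (n 1)]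
    ext i
    fin_cases i <;> simp [invStereo, h0, h1, h2]
  · have h3 : (1 - n 2) ≠ 0 := fun hh => h2 (by linarith)
    have hre : ((⟨n 0, n 1⟩ : ℂ) / ((1 - n 2 : ℝ) : ℂ)).re = n 0 / (1 - n 2) :=
      Complex.div_ofReal_re _ _
    have him : ((⟨n 0, n 1⟩ : ℂ) / ((1 - n 2 : ℝ) : ℂ)).im = n 1 / (1 - n 2) :=
      Complex.div_ofReal_im _ _
    have hsq : ‖((⟨n 0, n 1⟩ : ℂ) / ((1 - n 2 : ℝ) : ℂ))‖ ^ 2 = (1 + n 2) / (1 - n 2) := by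
      rw [← Complex.normSq_eq_norm_sq, Complex.normSq_apply, hre, him]
      field_simp
      nlinarith
    have hden : 1 + (1 + n 2) / (1 - n 2) = 2 / (1 - n 2) := by field_simp; ring
    ext i
    fin_cases i
    · simp only [invStereo, hsq, hre, him, hden]
      simp
      field_simp
    · simp only [invStereo, hsq, hre, him, hden]
      simp
      field_simp
    · simp only [invStereo, hsq, hre, him, hden]
      simp
      field_simp
      ring

/-! ### Calculus in charts -/

section Surface

variable {S : Type*} [TopologicalSpace S] [ChartedSpace E2 S]
variable {V : Type*} [NormedAddCommGroup V] [InnerProductSpace ℝ V]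

/-- The partial derivative of a vector-valued function `h` on the surface with respect to the
`i`-th coordinate of the chart `e`: `pd e 0 h` is `h_u` and `pd e 1 h` is `h_v`.
It is meaningful at the points of `e.source`. -/
def pd (e : OpenPartialHomeomorph S E2) (i : Fin 2) (h : S → V) (p : S) : V :=
  fderiv ℝ (h ∘ e.symm) (e p) (EuclideanSpace.single i 1)

/-- `ψ` is a smooth immersion of the surface into the vector space `V`. -/
def IsSmoothImmersion (ψ : S → V) : Prop :=
  ContMDiff (𝓡 2) 𝓘(ℝ, V) ∞ ψ ∧
    ∀ e ∈ IsManifold.maximalAtlas (𝓡 2) ∞ S, ∀ p ∈ e.source,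
      LinearIndependent ℝ ![pd e 0 ψ p, pd e 1 ψ p]

/-- `n` is a smooth unit vector field along `ψ`, orthogonal to the surface. -/
def IsUnitNormal (ψ n : S → V) : Prop :=
  ContMDiff (𝓡 2) 𝓘(ℝ, V) ∞ n ∧ (∀ p, ‖n p‖ = 1) ∧
    ∀ e ∈ IsManifold.maximalAtlas (𝓡 2) ∞ S, ∀ p ∈ e.source, ∀ i, ⟪n p, pd e i ψ p⟫ = 0

/-- Coefficients of the first fundamental form `I = ⟨dψ, dψ⟩` in the chart `e`. -/
def firstFF (e : OpenPartialHomeomorph S E2) (ψ : S → V) (i j : Fin 2) (p : S) : ℝ :=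
  ⟪pd e i ψ p, pd e j ψ p⟫

/-- Coefficients of the second fundamental form `II = ⟨-∇n, dψ⟩` in the chart `e`. For a surface
in the unit sphere of `V` the covariant derivative of `n` is the tangential part of its
derivative in `V`, so the same formula applies. -/
def secondFF (e : OpenPartialHomeomorph S E2) (ψ n : S → V) (i j : Fin 2) (p : S) : ℝ :=
  -⟪pd e i n p, pd e j ψ p⟫

/-- `K` is the extrinsic curvature of `ψ`, i.e. the determinant of the shape operator:
`det II = K · det I`. -/
def HasExtrinsicCurvature (ψ n : S → V) (K : S → ℝ) : Prop :=
  ∀ e ∈ IsManifold.maximalAtlas (𝓡 2) ∞ S, ∀ p ∈ e.source,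
    secondFF e ψ n 0 0 p * secondFF e ψ n 1 1 p - secondFF e ψ n 0 1 p * secondFF e ψ n 1 0 p =
      K p * (firstFF e ψ 0 0 p * firstFF e ψ 1 1 p - firstFF e ψ 0 1 p * firstFF e ψ 1 0 p)

/-- The coordinates `(u, v)` of `e` are null for the second fundamental form:
`II = 2 f du dv`, where `f = secondFF e ψ n 0 1`. -/
def IsNull (e : OpenPartialHomeomorph S E2) (ψ n : S → V) : Prop :=
  ∀ p ∈ e.source, secondFF e ψ n 0 0 p = 0 ∧ secondFF e ψ n 1 1 p = 0

/-- A family of smooth charts whose domains cover the surface. -/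
def IsCovering (𝒜 : Set (OpenPartialHomeomorph S E2)) : Prop :=
  𝒜 ⊆ IsManifold.maximalAtlas (𝓡 2) ∞ S ∧ ∀ p, ∃ e ∈ 𝒜, p ∈ e.source

/-- The determinant of three vectors of `E3`. -/
def triple (x y z : E3) : ℝ :=
  Matrix.det !![x 0, x 1, x 2; y 0, y 1, y 2; z 0, z 1, z 2]

/-! ### Surfaces in Euclidean 3-space -/

/-- The unit normal field with Gauss map `g`. -/
def normalR3 (g : S → OnePoint ℂ) (p : S) : E3 := invStereo (g p)

/-- `g` is a Gauss map of the immersion `ψ` in Euclidean 3-space. -/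
def IsGaussMapR3 (ψ : S → E3) (g : S → OnePoint ℂ) : Prop := IsUnitNormal ψ (normalR3 g)

/-- `det (ψ_u, ψ_v, N)`; its sign says whether `(ψ_u, ψ_v, N)` is positively oriented. -/
def orientR3 (e : OpenPartialHomeomorph S E2) (ψ : S → E3) (g : S → OnePoint ℂ) (p : S) : ℝ :=
  triple (pd e 0 ψ p) (pd e 1 ψ p) (invStereo (g p))

/-! ### Surfaces in the 3-sphere

The 3-sphere is the group of unit quaternions with its standard metric. The left invariant
orthonormal frame is `E_k(q) = q * E_k` with `E₁ = i`, `E₂ = j`, `E₃ = k`, so that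
`[E₁, E₂] = 2 E₃`, `[E₂, E₃] = 2 E₁`, `[E₃, E₁] = 2 E₂`. -/

/-- The element `w₁ E₁ + w₂ E₂ + w₃ E₃` of the Lie algebra, as an imaginary quaternion. -/
def toQuat (w : E3) : ℍ[ℝ] := ⟨0, w 0, w 1, w 2⟩

/-- The coordinates of the imaginary part of a quaternion. -/
def ofQuat (q : ℍ[ℝ]) : E3 := !₂[q.imI, q.imJ, q.imK]

/-- `ψ` is a smooth immersion in the 3-sphere. -/
def IsImmersionS3 (ψ : S → ℍ[ℝ]) : Prop := (∀ p, ‖ψ p‖ = 1) ∧ IsSmoothImmersion ψ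

/-- The vector field `N₁ E₁(ψ) + N₂ E₂(ψ) + N₃ E₃(ψ)` along `ψ`, where `(N₁, N₂, N₃)` is the
point of the 2-sphere with stereographic projection `g`. -/
def normalS3 (ψ : S → ℍ[ℝ]) (g : S → OnePoint ℂ) (p : S) : ℍ[ℝ] := ψ p * toQuat (invStereo (g p))

/-- `g` is a Gauss map of the immersion `ψ` in the 3-sphere: the left translation to the identity
of a unit normal field, followed by stereographic projection. -/
def IsGaussMapS3 (ψ : S → ℍ[ℝ]) (g : S → OnePoint ℂ) : Prop := IsUnitNormal ψ (normalS3 ψ g)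

/-- `det (ψ⁻¹ψ_u, ψ⁻¹ψ_v, ψ⁻¹N)`; its sign says whether `(ψ_u, ψ_v, N)` is positively oriented
in the 3-sphere, oriented by `(E₁, E₂, E₃)`. -/
def orientS3 (e : OpenPartialHomeomorph S E2) (ψ : S → ℍ[ℝ]) (g : S → OnePoint ℂ) (p : S) : ℝ :=
  triple (ofQuat (star (ψ p) * pd e 0 ψ p)) (ofQuat (star (ψ p) * pd e 1 ψ p)) (invStereo (g p))

/-! ### The differential equations -/

/-- `( -4 K_u / (√(-K) (1 + K)) )_v = 0` in the coordinates of `e`. -/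
def CurvatureCondition (e : OpenPartialHomeomorph S E2) (K : S → ℝ) : Prop :=
  ∀ p ∈ e.source, pd e 1 (fun q => -4 * pd e 0 K q / (√(-K q) * (1 + K q))) p = 0

/-- The system
`(log ((1 + √(-K))⁴ / (-K)))_u = (log (-K'))_u`, `(log ((-1 + √(-K))⁴ / (-K)))_v = (log (-K'))_v`
in the coordinates of `e`. -/
def CurvatureSystem (e : OpenPartialHomeomorph S E2) (K K' : S → ℝ) : Prop :=
  ∀ p ∈ e.source,
    pd e 0 (fun q => Real.log ((1 + √(-K q)) ^ 4 / (-K q))) p =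
      pd e 0 (fun q => Real.log (-K' q)) p ∧
    pd e 1 (fun q => Real.log ((-1 + √(-K q)) ^ 4 / (-K q))) p =
      pd e 1 (fun q => Real.log (-K' q)) p

end Surface

end NegCurv

end

/-! Let N be the unit vector field with stereographic projection g, let (u, v) be null coordinates,
X_i = N × N_i for i = u, v, and k = √(-K).

For a surface in the 3-sphere the vectors w_i = ψ⁻¹ψ_i are orthogonal to N, and II(∂_i, ∂_j) =
-⟨N_i, w_j⟩ + det(w_i, w_j, N), where the determinant comes from the group structure. With f > 0 and
positive orientation this forces w_u = X_u / (k - 1) and w_v = -X_v / (k + 1) (`leftPd_of_isNull`).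
In Euclidean space the determinant is absent, and the same argument gives ψ*_u = r X_u, ψ*_v = -r
X_v with K* = -1/r² (`pd_of_isNull`). Constructing either surface therefore means integrating a
1-form built from N and one function: the condition is Maurer-Cartan, ∂_u w_v - ∂_v w_u + 2 w_u ×
w_v = 0, on one side and closedness, ∂_v(r X_u) = ∂_u(-r X_v), on the other.

The heart is `closed_eq_smul_flat`: when r and k are related by (1), the defect of closedness is a
nonzero multiple of the Maurer-Cartan defect. The terms in N_u × N_v drop out of both, in the second
because 1/(k - 1) - 1/(k + 1) = 2/(k² - 1), and (1) says exactly that the remaining terms are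
proportional. Hence one form is integrable if and only if the other is. In the converse r is given
by K*; in the direct statement (1) is a system for log |r|, whose compatibility is the assumed
condition on K_u.

Globally, null charts with f > 0 and a common orientation differ by diagonal Jacobians
(`isDiagonal_of_isNull`), so forms defined direction by direction agree on overlaps. The functions
r, ψ* and ψ all come from one theorem, `exists_global_solution`, on dψ = ψθ in a normed algebra:
local solutions by radial ODEs and Grönwall, global ones by a section of a covering space over the
simply connected surface. -/

noncomputable section

namespace NegCurv

open Filter Topology Set

/-! ### Gluing local solutions over a simply connected space. -/

section

/-- On a simply connected space, local group-valued functions that differ on overlaps by locally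
constant left factors are, up to such factors, restrictions of one global function. -/
theorem exists_global_of_eventually_const {S : Type*} [TopologicalSpace S] [SimplyConnectedSpace S]
    [LocallyPathConnectedSpace S] {G : Type*} [Group G] {ι : Type*} (U : ι → Set S)
    (hU : ∀ i, IsOpen (U i)) (idx : S → ι) (hidx : ∀ p, p ∈ U (idx p)) (σ : ι → S → G)
    (hσ : ∀ i j, ∀ p ∈ U i ∩ U j,
      ∀ᶠ q in 𝓝 p, σ i q * (σ j q)⁻¹ = σ i p * (σ j p)⁻¹) :
    ∃ ψ : S → G, ∀ i, ∀ p ∈ U i, ∀ᶠ q in 𝓝 p, ψ q * (σ i q)⁻¹ = ψ p * (σ i p)⁻¹ := by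
  -- With discrete fibre the bundle is a covering of `S`. The point with coordinate c over x in the
  -- i-th trivialization stands for the germ of c · `σ i` at x, whence the coordinate change by
  -- right multiplication.
  let _ : TopologicalSpace G := ⊥
  have _ : DiscreteTopology G := ⟨rfl⟩
  let Z : FiberBundleCore ι S G :=
    { baseSet := U
      isOpen_baseSet := hU
      indexAt := idx
      mem_baseSet_at := hidx
      coordChange := fun i j x c => c * (σ i x * (σ j x)⁻¹)
      coordChange_self := by intro i x _ v; simp
      continuousOn_coordChange := by
        intro i j
        rintro ⟨x, c⟩ ⟨hx, -⟩
        apply ContinuousAt.continuousWithinAt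
        rw [ContinuousAt, nhds_discrete G, tendsto_pure, nhds_prod_eq, nhds_discrete G]
        have h1 := (hσ i j x hx).prod_inl (pure c)
        have h2 : ∀ᶠ z in 𝓝 x ×ˢ pure c, (z : S × G).2 = c :=
          Eventually.prod_inr (p := fun d : G => d = c) (by simp) (𝓝 x)
        filter_upwards [h1, h2] with z hz1 hz2
        rw [hz1, hz2]
      coordChange_comp := by intro i j k x _ v; group }
  have hcov : IsCoveringMap Z.proj := IsCoveringMap.mk Z.proj (fun _ => G) (fun x => Z.localTrivAt x) (fun x => Z.mem_localTrivAt_baseSet x)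
  obtain ⟨p₀⟩ : Nonempty S := inferInstance
  -- Simple connectivity enters here: the identity of `S` lifts to a section of the covering.
  obtain ⟨s, ⟨-, hs⟩, -⟩ := hcov.existsUnique_continuousMap_lifts (ContinuousMap.id S) p₀ (⟨p₀, (1 : G)⟩ : Z.TotalSpace) rfl
  have hs' : ∀ p, (s p).proj = p := fun p => congrFun hs p
  refine ⟨fun p => (show G from (s p).2) * σ (idx (s p).proj) p, fun i p hp => ?_⟩
  -- The i-th coordinate of the section is ψ (σ i)⁻¹; it is continuous with discrete values, hence
  -- locally constant.
  have key : ∀ q, (Z.localTriv i (s q)).2 =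
      ((show G from (s q).2) * σ (idx (s q).proj) q) * (σ i q)⁻¹ := by
    intro q
    show (show G from (s q).2) * (σ (idx (s q).proj) (s q).proj * (σ i (s q).proj)⁻¹) = _
    rw [hs' q]; exact (mul_assoc (show G from (s q).2) _ _).symm
  have hc : ContinuousAt (fun q => (Z.localTriv i (s q)).2) p := by
    have h3 : ContinuousAt (Z.localTriv i) (s p) := by
      apply (Z.localTriv i).continuousOn_toFun.continuousAt
      apply (Z.localTriv i).open_source.mem_nhds
      rw [(Z.localTriv i).mem_source]
      exact (show (s p).proj ∈ U i by rw [hs' p]; exact hp)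
    exact continuousAt_snd.comp (h3.comp s.continuous.continuousAt)
  rw [ContinuousAt, nhds_discrete G, tendsto_pure] at hc
  filter_upwards [hc] with q hq
  rw [← key, ← key, hq]

end

/-! ### A linear ODE and uniform Taylor bounds. -/

section

section LinearODE

variable {A : Type*} [NormedRing A] [NormedAlgebra ℝ A] [CompleteSpace A]

/-- The linear equation `Y' = Y c` with small coefficient has a solution on `[0, 1]`. -/
theorem exists_linear_ode_solution {c : ℝ → A} (hc : ContinuousOn c (Icc 0 1)) {δ : ℝ}
    (hδ : ∀ t ∈ Icc (0 : ℝ) 1, ‖c t‖ ≤ δ) (hδ' : (‖(1 : A)‖ + 1) * δ ≤ 1) :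
    ∃ Y : ℝ → A, Y 0 = 1 ∧ ∀ t ∈ Icc (0 : ℝ) 1,
      HasDerivWithinAt Y (Y t * c t) (Icc 0 1) t := by
  have hδ0 : 0 ≤ δ := (norm_nonneg _).trans (hδ 0 (by simp))
  have hball : ∀ y ∈ Metric.closedBall (1 : A) (1 : NNReal), ‖y‖ ≤ ‖(1 : A)‖ + 1 := by
    intro y hy
    have h1 : ‖y - 1‖ ≤ 1 := by simpa [dist_eq_norm] using hy
    calc ‖y‖ = ‖1 + (y - 1)‖ := by congr 1; abel
      _ ≤ ‖(1 : A)‖ + ‖y - 1‖ := norm_add_le _ _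
      _ ≤ _ := by linarith
  -- On the unit ball around 1 the speed is at most (‖1‖ + 1)δ ≤ 1, so no solution leaves the ball
  -- before time 1. The algebra need not satisfy ‖1‖ = 1.
  have hPL : IsPicardLindelof (fun t y => y * c t) (tmin := 0) (tmax := 1)
      ⟨0, by simp⟩ (1 : A) 1 0 1 ⟨δ, hδ0⟩ :=
    { lipschitzOnWith := by
        intro t ht
        refine LipschitzOnWith.of_dist_le_mul fun x _ y _ => ?_
        rw [dist_eq_norm, dist_eq_norm, ← sub_mul, mul_comm]
        exact (norm_mul_le _ _).trans (mul_le_mul_of_nonneg_left (hδ t ht) (norm_nonneg _))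
      continuousOn := fun x _ => continuousOn_const.mul hc
      norm_le := by
        intro t ht y hy
        refine (norm_mul_le _ _).trans (le_trans ?_ hδ')
        exact mul_le_mul (hball y hy) (hδ t ht) (norm_nonneg _) (by positivity)
      mul_max_le := by simp }
  exact hPL.exists_eq_forall_mem_Icc_hasDerivWithinAt₀


end LinearODE

/-- A differentiable `1`-form with locally Lipschitz derivative has locally uniform first order
Taylor expansions with quadratic remainder. -/
theorem exists_ball_taylor_bounds {E F : Type*} [NormedAddCommGroup E] [NormedSpace ℝ E]
    [NormedAddCommGroup F] [NormedSpace ℝ F] {θ : E → F} {U : Set E} (hU : IsOpen U)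
    (hθ : ContDiffOn ℝ ∞ θ U) {x₀ : E} (hx₀ : x₀ ∈ U) :
    ∃ r > 0, ∃ M : ℝ, 1 ≤ M ∧ Metric.ball x₀ r ⊆ U ∧
      (∀ z ∈ Metric.ball x₀ r, ‖θ z‖ ≤ M ∧ ‖fderiv ℝ θ z‖ ≤ M) ∧
      ∀ z ∈ Metric.ball x₀ r, ∀ w ∈ Metric.ball x₀ r,
        ‖θ w - θ z - fderiv ℝ θ z (w - z)‖ ≤ M * ‖w - z‖ ^ 2 := by
  have h1 : ContDiffAt ℝ ∞ θ x₀ := hθ.contDiffAt (hU.mem_nhds hx₀)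
  have h2 : ContDiffAt ℝ 1 (fderiv ℝ θ) x₀ := h1.fderiv_right (m := 1) (by norm_cast)
  obtain ⟨K, s, hs, hK⟩ := h2.exists_lipschitzOnWith
  have h3 : ∀ᶠ z in 𝓝 x₀, ‖θ z‖ < ‖θ x₀‖ + 1 :=
    h1.continuousAt.norm.eventually_lt_const (by linarith)
  have h4 : ∀ᶠ z in 𝓝 x₀, ‖fderiv ℝ θ z‖ < ‖fderiv ℝ θ x₀‖ + 1 :=
    h2.continuousAt.norm.eventually_lt_const (by linarith)
  obtain ⟨r, hr, hsub⟩ := Metric.eventually_nhds_iff_ball.mp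
    (((show ∀ᶠ z in 𝓝 x₀, z ∈ U from hU.mem_nhds hx₀).and (show ∀ᶠ z in 𝓝 x₀, z ∈ s from hs)).and
      (h3.and h4))
  have hθ0 := norm_nonneg (θ x₀)
  have hθ1 := norm_nonneg (fderiv ℝ θ x₀)
  refine ⟨r, hr, ‖θ x₀‖ + ‖fderiv ℝ θ x₀‖ + K + 1, by linarith [K.2], fun z hz => (hsub z hz).1.1,
    fun z hz => ⟨by linarith [(hsub z hz).2.1, K.2], by linarith [(hsub z hz).2.2, K.2]⟩,
    fun z hz w hw => ?_⟩
  have hseg : segment ℝ z w ⊆ Metric.ball x₀ r := (convex_ball x₀ r).segment_subset hz hw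
  -- Mean value inequality on the segment: `fderiv ℝ θ` is Lipschitz there, so it differs from its
  -- value at z by at most K‖w - z‖.
  have h5 : ‖θ w - θ z - fderiv ℝ θ z (w - z)‖ ≤ (K * ‖w - z‖) * ‖w - z‖ := by
    refine (convex_segment z w).norm_image_sub_le_of_norm_hasFDerivWithin_le'
      (f' := fderiv ℝ θ) (fun ξ hξ => ?_) (fun ξ hξ => ?_)
      (left_mem_segment ℝ z w) (right_mem_segment ℝ z w)
    · exact ((hθ.differentiableOn (by simp)).differentiableAt
        (hU.mem_nhds (hsub ξ (hseg hξ)).1.1)).hasFDerivAt.hasFDerivWithinAt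
    · refine (hK.norm_sub_le (hsub ξ (hseg hξ)).1.2 (hsub z hz).1.2).trans ?_
      refine mul_le_mul_of_nonneg_left ?_ K.2
      obtain ⟨a, b, ha, hb, hab, rfl⟩ := hξ
      have : a • z + b • w - z = b • (w - z) := by
        have : a = 1 - b := by linarith
        subst this; module
      rw [this, norm_smul, Real.norm_of_nonneg hb]
      exact mul_le_of_le_one_left (norm_nonneg _) (by linarith)
  refine h5.trans ?_
  rw [mul_assoc, ← sq]
  exact mul_le_mul_of_nonneg_right (by linarith) (by positivity)

end

/-! ### Flat 1-forms and the radial remainder estimate. -/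

section

variable {E : Type*} [NormedAddCommGroup E] [NormedSpace ℝ E]
  {A : Type*} [NormedRing A] [NormedAlgebra ℝ A]

/-- The right hand side `h ↦ y θ(h)` of the equation `dψ = ψ θ`. -/
def leftMulForm (y : A) (θ : E →L[ℝ] A) : E →L[ℝ] A := (ContinuousLinearMap.mul ℝ A y).comp θ

@[simp] theorem leftMulForm_apply (y : A) (θ : E →L[ℝ] A) (h : E) :
    leftMulForm y θ h = y * θ h := rfl

/-- The Maurer-Cartan equation for an algebra-valued `1`-form. -/
def IsFlatAt (θ : E → E →L[ℝ] A) (z : E) : Prop :=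
  ∀ h k, fderiv ℝ θ z h k - fderiv ℝ θ z k h + θ z h * θ z k - θ z k * θ z h = 0

/-- The remainder in the comparison of two radial solutions is quadratic. -/
theorem norm_radial_remainder_le {θ : E → E →L[ℝ] A} {z x h : E} {t M : ℝ} (ht : t ∈ Icc (0 : ℝ) 1)
    (hM : 1 ≤ M) (hflat : IsFlatAt θ z) (h1 : ‖θ z‖ ≤ M)
    (h3 : ‖fderiv ℝ θ z‖ ≤ M) (hx : ‖x‖ ≤ 1) (hxh : ‖x + h‖ ≤ 1)
    (h4 : ‖θ (z + t • h) - θ z - fderiv ℝ θ z (t • h)‖ ≤ M * ‖t • h‖ ^ 2) :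
    ‖(1 + t • θ z h) * θ (z + t • h) (x + h) - θ z x * (1 + t • θ z h) - θ z h
      - t • fderiv ℝ θ z x h‖ ≤ 8 * M ^ 2 * ‖h‖ ^ 2 := by
  -- Expanding θ at z, the terms linear in h are t(θ'(h)x + θ(h)θ(x) - θ(x)θ(h) - θ'(x)h), which
  -- vanish by flatness. What is left is quadratic or of higher order in h.
  have key : (1 + t • θ z h) * θ (z + t • h) (x + h) - θ z x * (1 + t • θ z h) - θ z h
      - t • fderiv ℝ θ z x h =
      (θ (z + t • h) - θ z - fderiv ℝ θ z (t • h)) (x + h) + t • fderiv ℝ θ z h h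
        + t • (θ z h * ((θ (z + t • h) - θ z - fderiv ℝ θ z (t • h)) (x + h)
          + t • fderiv ℝ θ z h (x + h) + θ z h)) := by
    have hf := hflat h x
    have hf' : fderiv ℝ θ z x h = fderiv ℝ θ z h x + θ z h * θ z x - θ z x * θ z h := by
      rw [eq_comm, ← sub_eq_zero, ← hf]; abel
    rw [hf']
    simp only [map_smul, map_add, sub_apply,
      smul_apply, smul_add, smul_sub, add_mul, mul_add, mul_sub, one_mul,
      mul_one, smul_mul_assoc, mul_smul_comm]
    abel_nf
  have ht0 := ht.1
  have ht1 := ht.2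
  have hth : ‖t • h‖ ≤ ‖h‖ := by
    rw [norm_smul, Real.norm_of_nonneg ht0]; exact mul_le_of_le_one_left (norm_nonneg _) ht1
  -- This absorbs the cubic terms into the quadratic bound.
  have hh : ‖h‖ ≤ 2 := by
    calc ‖h‖ = ‖(x + h) - x‖ := by congr 1; abel
      _ ≤ ‖x + h‖ + ‖x‖ := norm_sub_le _ _
      _ ≤ 2 := by linarith
  have hh0 := norm_nonneg h
  have tsm : ∀ a : A, ‖t • a‖ ≤ ‖a‖ := fun a => by
    rw [norm_smul, Real.norm_of_nonneg ht0]; exact mul_le_of_le_one_left (norm_nonneg _) ht1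
  have e1 : ‖(θ (z + t • h) - θ z - fderiv ℝ θ z (t • h)) (x + h)‖ ≤ M * ‖h‖ ^ 2 := by
    calc _ ≤ ‖θ (z + t • h) - θ z - fderiv ℝ θ z (t • h)‖ * ‖x + h‖ :=
          ContinuousLinearMap.le_opNorm _ _
      _ ≤ (M * ‖t • h‖ ^ 2) * 1 := by gcongr
      _ ≤ (M * ‖h‖ ^ 2) * 1 := by gcongr
      _ = _ := mul_one _
  have e2 : ∀ k : E, ‖fderiv ℝ θ z h k‖ ≤ M * ‖h‖ * ‖k‖ := fun k =>
    (ContinuousLinearMap.le_opNorm₂ _ _ _).trans (by gcongr)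
  have e3 : ‖θ z h‖ ≤ M * ‖h‖ := (ContinuousLinearMap.le_opNorm _ _).trans (by gcongr)
  have e4 : ‖fderiv ℝ θ z h (x + h)‖ ≤ M * ‖h‖ :=
    (e2 _).trans (mul_le_of_le_one_right (by positivity) hxh)
  rw [key]
  calc _ ≤ ‖(θ (z + t • h) - θ z - fderiv ℝ θ z (t • h)) (x + h)‖ + ‖fderiv ℝ θ z h h‖
        + ‖θ z h‖ * (‖(θ (z + t • h) - θ z - fderiv ℝ θ z (t • h)) (x + h)‖
          + ‖fderiv ℝ θ z h (x + h)‖ + ‖θ z h‖) := by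
        refine (norm_add₃_le).trans ?_
        gcongr
        · exact tsm _
        · refine (tsm _).trans ((norm_mul_le _ _).trans ?_)
          gcongr
          refine (norm_add₃_le).trans ?_
          gcongr
          exact tsm _
    _ ≤ M * ‖h‖ ^ 2 + M * ‖h‖ * ‖h‖ + M * ‖h‖ * (M * ‖h‖ ^ 2 + M * ‖h‖ + M * ‖h‖) := by
        gcongr
        exact e2 h
    _ = M * ‖h‖ ^ 2 * 2 + M ^ 2 * ‖h‖ ^ 2 * (‖h‖ + 2) := by ring
    _ ≤ (M * M) * ‖h‖ ^ 2 * 2 + M ^ 2 * ‖h‖ ^ 2 * (2 + 2) := by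
        gcongr
        exact le_mul_of_one_le_left (by linarith) hM
    _ ≤ _ := by nlinarith [mul_nonneg (sq_nonneg M) (sq_nonneg ‖h‖)]

end

/-! ### Local integration of dψ = ψθ. -/

section

variable {E : Type*} [NormedAddCommGroup E] [NormedSpace ℝ E]
  {A : Type*} [NormedRing A] [NormedAlgebra ℝ A]

/-- Radial solutions of a flat equation `dψ = ψ θ` assemble to a differentiable solution. -/
theorem hasFDerivAt_of_radial [CompleteSpace A] {θ : E → E →L[ℝ] A} {x₀ : E} {r M : ℝ} (hr : r ≤ 1)
    (hM : 1 ≤ M)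
    (hdiff : ∀ z ∈ Metric.ball x₀ r, DifferentiableAt ℝ θ z)
    (hflat : ∀ z ∈ Metric.ball x₀ r, IsFlatAt θ z)
    (hbd : ∀ z ∈ Metric.ball x₀ r, ‖θ z‖ ≤ M ∧ ‖fderiv ℝ θ z‖ ≤ M)
    (htaylor : ∀ z ∈ Metric.ball x₀ r, ∀ w ∈ Metric.ball x₀ r,
        ‖θ w - θ z - fderiv ℝ θ z (w - z)‖ ≤ M * ‖w - z‖ ^ 2)
    {Y : E → ℝ → A} (hY0 : ∀ x ∈ Metric.ball x₀ r, Y x 0 = 1)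
    (hY : ∀ x ∈ Metric.ball x₀ r, ∀ t ∈ Icc (0 : ℝ) 1,
      HasDerivWithinAt (Y x) (Y x t * θ (x₀ + t • (x - x₀)) (x - x₀)) (Icc 0 1) t)
    {x : E} (hx : x ∈ Metric.ball x₀ r) :
    HasFDerivAt (fun x => Y x 1) (leftMulForm (Y x 1) (θ x)) x := by
  have hray : ∀ w ∈ Metric.ball x₀ r, ∀ t ∈ Icc (0 : ℝ) 1, x₀ + t • (w - x₀) ∈ Metric.ball x₀ r := by
    intro w hw t ht
    rw [mem_ball_iff_norm] at hw ⊢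
    rw [add_sub_cancel_left, norm_smul, Real.norm_of_nonneg ht.1]
    exact (mul_le_of_le_one_left (norm_nonneg _) ht.2).trans_lt hw
  have hle : ∀ w ∈ Metric.ball x₀ r, ‖w - x₀‖ ≤ 1 := fun w hw =>
    (mem_ball_iff_norm.mp hw).le.trans hr
  -- The bound depends on x but not on h, so the final estimate is O(‖h‖²).
  obtain ⟨B, hB⟩ := (isCompact_Icc (a := (0 : ℝ)) (b := 1)).exists_bound_of_continuousOn
    (fun t ht => (hY x hx t ht).continuousWithinAt)
  have hB0 : 0 ≤ B := (norm_nonneg _).trans (hB 0 (by simp))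
  have main : ∀ h : E, x + h ∈ Metric.ball x₀ r →
      ‖Y (x + h) 1 - Y x 1 - Y x 1 * θ x h‖ ≤
        ((B * (8 * M ^ 2)) / M * (Real.exp M - 1)) * ‖h‖ ^ 2 := by
    intro h hxh
    -- The point z(t) on the ray moves by t h when x moves by h, so a solution of dψ = ψθ changes to
    -- first order by Y θ(t h). `W` is the error of this prediction; it vanishes at t = 0, and at t
    -- = 1 it is the error in the claimed derivative.
    set W : ℝ → A := fun t => Y (x + h) t - Y x t * (1 + t • θ (x₀ + t • (x - x₀)) h) with hWdef
    have hW : ∀ t ∈ Icc (0 : ℝ) 1, HasDerivWithinAt W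
        (Y (x + h) t * θ (x₀ + t • (x + h - x₀)) (x + h - x₀) -
          (Y x t * θ (x₀ + t • (x - x₀)) (x - x₀) * (1 + t • θ (x₀ + t • (x - x₀)) h) +
            Y x t * (θ (x₀ + t • (x - x₀)) h
              + t • fderiv ℝ θ (x₀ + t • (x - x₀)) (x - x₀) h))) (Icc 0 1) t := by
      intro t ht
      refine (hY _ hxh t ht).sub ((hY x hx t ht).mul ?_)
      have g1 : HasDerivAt (fun t : ℝ => x₀ + t • (x - x₀)) (x - x₀) t := by
        simpa using ((hasDerivAt_id t).smul_const (x - x₀)).const_add x₀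
      have g2 : HasDerivAt (fun t : ℝ => θ (x₀ + t • (x - x₀)))
          (fderiv ℝ θ (x₀ + t • (x - x₀)) (x - x₀)) t :=
        (hdiff _ (hray x hx t ht)).hasFDerivAt.comp_hasDerivAt t g1
      have g3 : HasDerivAt (fun t : ℝ => θ (x₀ + t • (x - x₀)) h)
          (fderiv ℝ θ (x₀ + t • (x - x₀)) (x - x₀) h) t := by
        simpa using g2.clm_apply (hasDerivAt_const t h)
      have g4 := ((hasDerivAt_id t).smul g3).const_add (1 : A)
      refine HasDerivAt.hasDerivWithinAt ?_
      refine HasDerivAt.congr_deriv g4 ?_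
      rw [one_smul, add_comm]
      rfl
    have hgr := norm_le_gronwallBound_of_norm_deriv_right_le (f := W) (δ := 0) (K := M)
      (ε := B * (8 * M ^ 2 * ‖h‖ ^ 2)) (a := 0) (b := 1)
      (fun t ht => (hW t ht).continuousWithinAt)
      (fun t ht => (hW t (Ico_subset_Icc_self ht)).mono_of_mem_nhdsWithin
        (Icc_mem_nhdsGE_of_mem ht))
      (by simp [hWdef, hY0 x hx, hY0 _ hxh]) ?_ 1 (by simp)
    · rw [gronwallBound_of_K_ne_0 (by linarith)] at hgr
      simp only [hWdef, one_smul, add_sub_cancel, mul_add, mul_one, zero_mul, zero_add,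
        sub_zero] at hgr
      rw [sub_sub]
      refine hgr.trans (le_of_eq ?_)
      ring
    · intro t ht'
      have ht := Ico_subset_Icc_self ht'
      have hz := hray x hx t ht
      have hzh := hray _ hxh t ht
      have ez : x₀ + t • (x + h - x₀) = x₀ + t • (x - x₀) + t • h := by module
      have ex : x + h - x₀ = (x - x₀) + h := by abel
      rw [ez] at hzh
      have hrem := norm_radial_remainder_le (x := x - x₀) (h := h) ht hM (hflat _ hz) (hbd _ hz).1
        (hbd _ hz).2 (hle x hx) (by rw [← ex]; exact hle _ hxh)
        (by simpa using htaylor _ hz _ hzh)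
      rw [ez, ex]
      set z := x₀ + t • (x - x₀)
      -- `W` satisfies W' = Wθ + Yρ with ρ quadratic in h, which is the form required by Grönwall's
      -- inequality.
      have e : Y (x + h) t * θ (z + t • h) (x - x₀ + h) -
          (Y x t * θ z (x - x₀) * (1 + t • θ z h) +
            Y x t * (θ z h + t • fderiv ℝ θ z (x - x₀) h)) =
          W t * θ (z + t • h) (x - x₀ + h) +
          Y x t * ((1 + t • θ z h) * θ (z + t • h) (x - x₀ + h) - θ z (x - x₀) * (1 + t • θ z h)
            - θ z h - t • fderiv ℝ θ z (x - x₀) h) := by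
        rw [show W t = Y (x + h) t - Y x t * (1 + t • θ z h) from rfl]
        noncomm_ring
      rw [e]
      refine (norm_add_le _ _).trans (add_le_add ?_ ?_)
      · rw [mul_comm M]
        refine (norm_mul_le _ _).trans (mul_le_mul_of_nonneg_left ?_ (norm_nonneg _))
        refine (ContinuousLinearMap.le_opNorm _ _).trans ?_
        rw [← ex]
        exact (mul_le_of_le_one_right (norm_nonneg _) (hle _ hxh)).trans (hbd _ hzh).1
      · exact (norm_mul_le _ _).trans (mul_le_mul (hB t ht) hrem (norm_nonneg _) hB0)
  rw [hasFDerivAt_iff_isLittleO_nhds_zero]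
  refine Asymptotics.IsBigO.trans_isLittleO (g := fun h : E => ‖h‖ ^ 2) ?_ ?_
  · refine Asymptotics.IsBigO.of_bound ((B * (8 * M ^ 2)) / M * (Real.exp M - 1)) ?_
    have hnear : ∀ᶠ h in 𝓝 (0 : E), x + h ∈ Metric.ball x₀ r := by
      refine (continuous_const.add continuous_id).continuousAt.eventually_mem
        (Metric.isOpen_ball.mem_nhds ?_)
      simpa using hx
    filter_upwards [hnear] with h hh
    simpa using main h hh
  · simpa using Asymptotics.isLittleO_norm_pow_id (E' := E) (n := 2) one_lt_two

/-- Local integration of a flat algebra-valued `1`-form. -/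
theorem exists_local_solution [CompleteSpace A] {θ : E → E →L[ℝ] A} {U : Set E} (hU : IsOpen U)
    (hθ : ContDiffOn ℝ ∞ θ U) (hflat : ∀ z ∈ U, IsFlatAt θ z) {x₀ : E} (hx₀ : x₀ ∈ U) :
    ∃ r > 0, Metric.ball x₀ r ⊆ U ∧ ∃ y : E → A, ∀ x ∈ Metric.ball x₀ r,
      IsUnit (y x) ∧ HasFDerivAt y (leftMulForm (y x) (θ x)) x := by
  obtain ⟨r₀, hr₀, M, hM, hsub, hbd, htaylor⟩ := exists_ball_taylor_bounds hU hθ hx₀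
  have hA : 0 < (‖(1 : A)‖ + 1) * M := by positivity
  -- Small enough for the Taylor bounds, for the bound 1 on the rays, and for the smallness
  -- condition of the ODE lemma.
  set r : ℝ := min r₀ (min 1 (1 / ((‖(1 : A)‖ + 1) * M))) with hrdef
  have hr : 0 < r := by positivity
  have hr1 : r ≤ 1 := (min_le_right _ _).trans (min_le_left _ _)
  have hrA : (‖(1 : A)‖ + 1) * (M * r) ≤ 1 := by
    have : r ≤ 1 / ((‖(1 : A)‖ + 1) * M) := (min_le_right _ _).trans (min_le_right _ _)
    rw [le_div_iff₀ hA] at this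
    linarith
  have hball : Metric.ball x₀ r ⊆ Metric.ball x₀ r₀ := Metric.ball_subset_ball (min_le_left _ _)
  have hray : ∀ w ∈ Metric.ball x₀ r, ∀ t ∈ Icc (0 : ℝ) 1, x₀ + t • (w - x₀) ∈ Metric.ball x₀ r := by
    intro w hw t ht
    rw [mem_ball_iff_norm] at hw ⊢
    rw [add_sub_cancel_left, norm_smul, Real.norm_of_nonneg ht.1]
    exact (mul_le_of_le_one_left (norm_nonneg _) ht.2).trans_lt hw
  have hode : ∀ x : E, ∃ Y : ℝ → A, x ∈ Metric.ball x₀ r → Y 0 = 1 ∧ ∀ t ∈ Icc (0 : ℝ) 1,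
      HasDerivWithinAt Y (Y t * θ (x₀ + t • (x - x₀)) (x - x₀)) (Icc 0 1) t := by
    intro x
    by_cases hx : x ∈ Metric.ball x₀ r
    · have hc : ContinuousOn (fun t : ℝ => θ (x₀ + t • (x - x₀)) (x - x₀)) (Icc 0 1) := by
        refine ContinuousOn.clm_apply ?_ continuousOn_const
        exact hθ.continuousOn.comp (by fun_prop) fun t ht => hsub (hball (hray x hx t ht))
      obtain ⟨Y, hY⟩ := exists_linear_ode_solution hc (δ := M * r) (fun t ht =>
        (ContinuousLinearMap.le_opNorm _ _).trans
          (mul_le_mul (hbd _ (hball (hray x hx t ht))).1 (mem_ball_iff_norm.mp hx).le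
            (norm_nonneg _) (by linarith))) hrA
      exact ⟨Y, fun _ => hY⟩
    · exact ⟨fun _ => 0, fun h => absurd h hx⟩
  choose Y hY using hode
  have hder : ∀ x ∈ Metric.ball x₀ r,
      HasFDerivAt (fun x => Y x 1) (leftMulForm (Y x 1) (θ x)) x := fun x hx =>
    hasFDerivAt_of_radial hr1 hM
      (fun z hz => (hθ.contDiffAt (hU.mem_nhds (hsub (hball hz)))).differentiableAt (by simp))
      (fun z hz => hflat z (hsub (hball hz))) (fun z hz => hbd z (hball hz))
      (fun z hz w hw => htaylor z (hball hz) w (hball hw)) (fun x hx => (hY x hx).1)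
      (fun x hx => (hY x hx).2) hx
  have hx₀r := Metric.mem_ball_self (x := x₀) hr
  -- The ray at the centre is constant, so its solution stays 1; nearby values are then units
  -- because units form an open set.
  have h1 : Y x₀ 1 = 1 := by
    have h := hY x₀ hx₀r
    rw [← h.1]
    refine constant_of_has_deriv_right_zero (fun t ht => (h.2 t ht).continuousWithinAt)
      (fun t ht => ?_) 1 (by simp)
    have := (h.2 t (Ico_subset_Icc_self ht)).mono_of_mem_nhdsWithin (Icc_mem_nhdsGE_of_mem ht)
    simpa using this
  have hunit : ∀ᶠ x in 𝓝 x₀, IsUnit (Y x 1) := by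
    refine (hder x₀ hx₀r).continuousAt.eventually_mem (Units.isOpen.mem_nhds ?_)
    simp [h1]
  obtain ⟨r', hr', hsub'⟩ := Metric.eventually_nhds_iff_ball.mp hunit
  refine ⟨min r r', by positivity, fun z hz => hsub (hball (Metric.ball_subset_ball
    (min_le_left _ _) hz)), fun x => Y x 1, fun x hx => ⟨hsub' x ?_, hder x ?_⟩⟩
  · exact Metric.ball_subset_ball (min_le_right _ _) hx
  · exact Metric.ball_subset_ball (min_le_left _ _) hx

end

/-! ### Uniqueness and smoothness of solutions; changes of charts. -/

section

section Uniqueness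

variable {E : Type*} [NormedAddCommGroup E] [NormedSpace ℝ E]
  {A : Type*} [NormedRing A] [NormedAlgebra ℝ A]

/-- Two invertible solutions of `dψ = ψ θ` differ locally by a constant left factor. -/
theorem eventually_mul_inverse_eq [CompleteSpace A] {θ : E → E →L[ℝ] A} {f₁ f₂ : E → A} {z₀ : E}
    (h₁ : ∀ᶠ z in 𝓝 z₀, HasFDerivAt f₁ (leftMulForm (f₁ z) (θ z)) z)
    (h₂ : ∀ᶠ z in 𝓝 z₀, IsUnit (f₂ z) ∧ HasFDerivAt f₂ (leftMulForm (f₂ z) (θ z)) z) :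
    ∀ᶠ z in 𝓝 z₀, f₁ z * Ring.inverse (f₂ z) = f₁ z₀ * Ring.inverse (f₂ z₀) := by
  obtain ⟨r, hr, hsub⟩ := Metric.eventually_nhds_iff_ball.mp (h₁.and h₂)
  -- The derivative of f₁f₂⁻¹ is f₁θf₂⁻¹ - f₁f₂⁻¹(f₂θ)f₂⁻¹ = 0.
  have hder : ∀ z ∈ Metric.ball z₀ r,
      HasFDerivAt (fun z => f₁ z * Ring.inverse (f₂ z)) (0 : E →L[ℝ] A) z := by
    intro z hz
    obtain ⟨g₁, ⟨u, hu⟩, g₂⟩ := hsub z hz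
    have g₃ := hasFDerivAt_ringInverse (𝕜 := ℝ) u
    rw [hu] at g₃
    refine (g₁.mul' (g₃.comp z g₂)).congr_fderiv ?_
    ext h
    simp [← hu, mul_assoc]
  filter_upwards [Metric.ball_mem_nhds z₀ hr] with z hz
  exact (convex_ball z₀ r).is_const_of_fderivWithin_eq_zero (𝕜 := ℝ)
    (fun z hz => (hder z hz).differentiableAt.differentiableWithinAt)
    (fun z hz => ((hder z hz).hasFDerivWithinAt).fderivWithin
      (Metric.isOpen_ball.uniqueDiffWithinAt hz)) hz (Metric.mem_ball_self hr)

/-- Solutions of `dψ = ψ θ` with smooth `θ` are smooth. -/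
theorem contDiffOn_of_leftMulForm {θ : E → E →L[ℝ] A} {y : E → A} {U : Set E} (hU : IsOpen U)
    (hθ : ContDiffOn ℝ ∞ θ U)
    (hy : ∀ z ∈ U, HasFDerivAt y (leftMulForm (y z) (θ z)) z) : ContDiffOn ℝ ∞ y U := by
  refine contDiffOn_infty.mpr fun n => ?_
  induction n with
  | zero => exact contDiffOn_zero.mpr fun z hz => (hy z hz).continuousAt.continuousWithinAt
  | succ n ih =>
    push_cast
    rw [contDiffOn_succ_iff_fderiv_of_isOpen hU]
    refine ⟨fun z hz => (hy z hz).differentiableAt.differentiableWithinAt, by simp, ?_⟩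
    -- Bootstrapping: the derivative yθ is as smooth as y, so y gains one order.
    have h1 : ContDiffOn ℝ n (fun z => (ContinuousLinearMap.mul ℝ A (y z)).comp (θ z)) U :=
      ((ContinuousLinearMap.mul ℝ A).contDiff.comp_contDiffOn ih).clm_comp
        (hθ.of_le (by exact_mod_cast le_top))
    exact h1.congr fun z hz => (hy z hz).fderiv

end Uniqueness

variable {S : Type*} [TopologicalSpace S] [ChartedSpace E2 S]

/-- The Jacobian of the change of coordinates from `e` to `e'`: `jac e e' i j` is the derivative
of the `j`-th coordinate of `e` with respect to the `i`-th coordinate of `e'`. -/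
def jac (e e' : OpenPartialHomeomorph S E2) (i j : Fin 2) (p : S) : ℝ :=
  fderiv ℝ (e ∘ e'.symm) (e' p) (EuclideanSpace.single i 1) j

theorem contDiffOn_transition {e e' : OpenPartialHomeomorph S E2}
    (he : e ∈ IsManifold.maximalAtlas (𝓡 2) ∞ S) (he' : e' ∈ IsManifold.maximalAtlas (𝓡 2) ∞ S) :
    ContDiffOn ℝ ∞ (e ∘ e'.symm) (e'.symm ≫ₕ e).source := by
  have h := (contDiffGroupoid ∞ (𝓡 2)).compatible_of_mem_maximalAtlas he' he
  rw [contDiffGroupoid, mem_groupoid_of_pregroupoid] at h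
  simpa [contDiffPregroupoid] using h.1

theorem differentiableAt_transition {e e' : OpenPartialHomeomorph S E2}
    (he : e ∈ IsManifold.maximalAtlas (𝓡 2) ∞ S) (he' : e' ∈ IsManifold.maximalAtlas (𝓡 2) ∞ S)
    {p : S} (hp : p ∈ e.source) (hp' : p ∈ e'.source) :
    DifferentiableAt ℝ (e ∘ e'.symm) (e' p) := by
  refine ((contDiffOn_transition he he').contDiffAt
    ((e'.symm ≫ₕ e).open_source.mem_nhds ?_)).differentiableAt (by simp)
  simp [hp, hp']

omit [ChartedSpace E2 S] in
theorem eventually_symm_mem {e e' : OpenPartialHomeomorph S E2}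
    {p : S} (hp : p ∈ e.source) (hp' : p ∈ e'.source) :
    ∀ᶠ z in 𝓝 (e' p), z ∈ e'.target ∧ e'.symm z ∈ e.source := by
  have := (e'.symm ≫ₕ e).open_source.mem_nhds (x := e' p) (by simp [hp, hp'])
  filter_upwards [this] with z hz
  simpa using hz

omit [ChartedSpace E2 S] in
theorem comp_symm_eventuallyEq {W : Type*} (h : S → W) {e e' : OpenPartialHomeomorph S E2}
    {p : S} (hp : p ∈ e.source) (hp' : p ∈ e'.source) :
    h ∘ e'.symm =ᶠ[𝓝 (e' p)] (h ∘ e.symm) ∘ (e ∘ e'.symm) := by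
  filter_upwards [eventually_symm_mem hp hp'] with z hz
  simp [e.left_inv hz.2]

theorem eq_sum_single (x : E2) :
    x = x 0 • EuclideanSpace.single 0 1 + x 1 • EuclideanSpace.single 1 1 := by
  ext i
  fin_cases i <;> simp

section Calculus

variable {W : Type*} [NormedAddCommGroup W] [NormedSpace ℝ W]

theorem hasFDerivAt_change {e e' : OpenPartialHomeomorph S E2}
    (he : e ∈ IsManifold.maximalAtlas (𝓡 2) ∞ S) (he' : e' ∈ IsManifold.maximalAtlas (𝓡 2) ∞ S)
    {p : S} (hp : p ∈ e.source) (hp' : p ∈ e'.source) {h : S → W} {L : E2 →L[ℝ] W}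
    (hh : HasFDerivAt (h ∘ e.symm) L (e p)) :
    HasFDerivAt (h ∘ e'.symm) (L.comp (fderiv ℝ (e ∘ e'.symm) (e' p))) (e' p) := by
  have h1 := (differentiableAt_transition he he' hp hp').hasFDerivAt
  have h2 : HasFDerivAt (h ∘ e.symm) L ((e ∘ e'.symm) (e' p)) := by simpa [hp'] using hh
  exact (h2.comp _ h1).congr_of_eventuallyEq (comp_symm_eventuallyEq h hp hp')

theorem fderiv_change {e e' : OpenPartialHomeomorph S E2}
    (he : e ∈ IsManifold.maximalAtlas (𝓡 2) ∞ S) (he' : e' ∈ IsManifold.maximalAtlas (𝓡 2) ∞ S)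
    {p : S} (hp : p ∈ e.source) (hp' : p ∈ e'.source) {h : S → W}
    (hh : DifferentiableAt ℝ (h ∘ e.symm) (e p)) (i : Fin 2) :
    fderiv ℝ (h ∘ e'.symm) (e' p) (EuclideanSpace.single i 1) =
      jac e e' i 0 p • fderiv ℝ (h ∘ e.symm) (e p) (EuclideanSpace.single 0 1) +
      jac e e' i 1 p • fderiv ℝ (h ∘ e.symm) (e p) (EuclideanSpace.single 1 1) := by
  rw [(hasFDerivAt_change he he' hp hp' hh.hasFDerivAt).fderiv, ContinuousLinearMap.comp_apply]
  rw [eq_sum_single (fderiv ℝ (e ∘ e'.symm) (e' p) (EuclideanSpace.single i 1)), map_add, map_smul,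
    map_smul]
  rfl

/-- The Jacobian matrices of the two opposite coordinate changes are inverse to each other, so their
determinants have product 1. -/
theorem jac_det_ne_zero {e e' : OpenPartialHomeomorph S E2}
    (he : e ∈ IsManifold.maximalAtlas (𝓡 2) ∞ S) (he' : e' ∈ IsManifold.maximalAtlas (𝓡 2) ∞ S)
    {p : S} (hp : p ∈ e.source) (hp' : p ∈ e'.source) :
    jac e e' 0 0 p * jac e e' 1 1 p - jac e e' 0 1 p * jac e e' 1 0 p ≠ 0 := by
  have h1 : ∀ i : Fin 2, fderiv ℝ (e ∘ e.symm) (e p) (EuclideanSpace.single i 1) =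
      EuclideanSpace.single i 1 := by
    intro i
    have : e ∘ e.symm =ᶠ[𝓝 (e p)] id := by
      filter_upwards [e.open_target.mem_nhds (e.map_source hp)] with z hz
      simp [hz]
    rw [this.fderiv_eq, fderiv_id]; rfl
  have h2 : ∀ i, EuclideanSpace.single i 1 =
      jac e' e i 0 p • fderiv ℝ (e ∘ e'.symm) (e' p) (EuclideanSpace.single 0 1) +
      jac e' e i 1 p • fderiv ℝ (e ∘ e'.symm) (e' p) (EuclideanSpace.single 1 1) := fun i => by
    rw [← h1 i]
    exact fderiv_change he' he hp' hp (differentiableAt_transition he he' hp hp') i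
  have h3 : ∀ i j : Fin 2, (EuclideanSpace.single i (1 : ℝ) : E2) j =
      jac e' e i 0 p * jac e e' 0 j p + jac e' e i 1 p * jac e e' 1 j p := fun i j => by
    rw [h2 i]; rfl
  have a := h3 0 0
  have b := h3 0 1
  have c := h3 1 0
  have d := h3 1 1
  simp at a b c d
  intro h0
  have : (1 : ℝ) = 0 := by
    linear_combination (a) * (jac e' e 1 0 p * jac e e' 0 1 p + jac e' e 1 1 p * jac e e' 1 1 p) + d
      - b * (jac e' e 1 0 p * jac e e' 0 0 p + jac e' e 1 1 p * jac e e' 1 0 p)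
      + (jac e' e 0 0 p * jac e' e 1 1 p - jac e' e 0 1 p * jac e' e 1 0 p) * h0
  exact one_ne_zero this

end Calculus

end

/-! ### Global integration on a simply connected surface. -/

section

variable {S : Type*} [TopologicalSpace S] [ChartedSpace E2 S]

section Integration

variable {A : Type*} [NormedRing A] [NormedAlgebra ℝ A] [CompleteSpace A]

/-- On a simply connected surface a flat algebra-valued `1`-form, given in the charts of a
covering, can be integrated globally. -/
theorem exists_global_solution [SimplyConnectedSpace S] {𝒜 : Set (OpenPartialHomeomorph S E2)}
    (h𝒜 : IsCovering 𝒜) (θ : OpenPartialHomeomorph S E2 → E2 → E2 →L[ℝ] A)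
    (hθ : ∀ e ∈ 𝒜, ContDiffOn ℝ ∞ (θ e) e.target)
    (hflat : ∀ e ∈ 𝒜, ∀ z ∈ e.target, IsFlatAt (θ e) z)
    (hcompat : ∀ e ∈ 𝒜, ∀ e' ∈ 𝒜, ∀ p ∈ e.source, p ∈ e'.source →
      θ e' (e' p) = (θ e (e p)).comp (fderiv ℝ (e ∘ e'.symm) (e' p))) :
    ∃ ψ : S → Aˣ, ∀ e ∈ 𝒜, ∀ p ∈ e.source,
      HasFDerivAt ((fun q => (ψ q : A)) ∘ e.symm) (leftMulForm (ψ p : A) (θ e (e p))) (e p) := by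
  classical
  have hlps : LocallyPathConnectedSpace S := ChartedSpace.locallyPathConnectedSpace E2 S
  have hloc : ∀ p : S, ∃ e ∈ 𝒜, p ∈ e.source ∧ ∃ r > 0, Metric.ball (e p) r ⊆ e.target ∧
      ∃ y : E2 → A, ∀ x ∈ Metric.ball (e p) r,
        IsUnit (y x) ∧ HasFDerivAt y (leftMulForm (y x) (θ e x)) x := by
    intro p
    obtain ⟨e, he, hp⟩ := h𝒜.2 p
    exact ⟨e, he, hp, exists_local_solution e.open_target (hθ e he) (hflat e he)
      (e.map_source hp)⟩
  choose c hc hpc r hr hball y hy using hloc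
  set U : S → Set S := fun i => (c i).source ∩ c i ⁻¹' Metric.ball (c i i) (r i) with hUdef
  have hU : ∀ i, IsOpen (U i) := fun i => (c i).isOpen_inter_preimage Metric.isOpen_ball
  set σ : S → S → Aˣ := fun i q => if h : q ∈ U i then (hy i (c i q) h.2).1.unit else 1 with hσdef
  have hσ : ∀ i, ∀ q ∈ U i, (σ i q : A) = y i (c i q) := by
    intro i q hq
    simp only [hσdef, dif_pos hq]
    rfl
  have hder : ∀ i, ∀ p ∈ U i, ∀ e ∈ 𝒜, p ∈ e.source → HasFDerivAt
      ((fun q => (σ i q : A)) ∘ e.symm) (leftMulForm (σ i p : A) (θ e (e p))) (e p) := by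
    intro i p hp e he hpe
    have hev : (fun q => (σ i q : A)) ∘ (c i).symm =ᶠ[𝓝 (c i p)] y i := by
      filter_upwards [Metric.isOpen_ball.mem_nhds hp.2] with z hz
      have hzt := hball i hz
      rw [Function.comp_apply, hσ i _ ⟨(c i).map_target hzt, by
        simpa only [mem_preimage, (c i).right_inv hzt] using hz⟩, (c i).right_inv hzt]
    have h1 := ((hy i (c i p) hp.2).2).congr_of_eventuallyEq hev
    rw [← hσ i p hp] at h1
    refine (hasFDerivAt_change (h𝒜.1 (hc i)) (h𝒜.1 he) hp.1 hpe h1).congr_fderiv ?_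
    rw [hcompat (c i) (hc i) e he p hp.1 hpe]
    rfl
  obtain ⟨ψ, hψ⟩ := exists_global_of_eventually_const U hU id
    (fun p => ⟨hpc p, Metric.mem_ball_self (hr p)⟩) σ (by
      rintro i j p ⟨hpi, hpj⟩
      have hpe := hpi.1
      have hnear : ∀ᶠ q in 𝓝 p, q ∈ U i ∧ q ∈ U j ∧ q ∈ (c i).source :=
        inter_mem ((hU i).mem_nhds hpi)
          (inter_mem ((hU j).mem_nhds hpj) ((c i).open_source.mem_nhds hpe))
      have htend : Tendsto (c i).symm (𝓝 (c i p)) (𝓝 p) := (c i).tendsto_symm hpe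
      have hnear' := htend.eventually hnear
      have htgt : ∀ᶠ z in 𝓝 (c i p), z ∈ (c i).target :=
        (c i).open_target.mem_nhds ((c i).map_source hpe)
      -- By `hcompat` both local solutions satisfy the same equation in the chart `c i`, so their
      -- quotient is locally constant there.
      have h := eventually_mul_inverse_eq (θ := θ (c i))
        (f₁ := (fun q => (σ i q : A)) ∘ (c i).symm) (f₂ := (fun q => (σ j q : A)) ∘ (c i).symm)
        (z₀ := c i p) (by
          filter_upwards [hnear', htgt] with z hz hzt
          have := hder i _ hz.1 (c i) (hc i) hz.2.2
          rwa [(c i).right_inv hzt] at this) (by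
          filter_upwards [hnear', htgt] with z hz hzt
          have := hder j _ hz.2.1 (c i) (hc i) hz.2.2
          rw [(c i).right_inv hzt] at this
          exact ⟨Units.isUnit _, this⟩)
      have h' := ((c i).continuousAt hpe).eventually h
      filter_upwards [h', (c i).open_source.mem_nhds hpe] with q hq hqs
      simp only [Function.comp_apply, (c i).left_inv hqs, (c i).left_inv hpe,
        Ring.inverse_unit] at hq
      exact_mod_cast hq)
  refine ⟨ψ, fun e he p hp => ?_⟩
  have hpU : p ∈ U p := ⟨hpc p, Metric.mem_ball_self (hr p)⟩
  -- Near p the glued function is a constant times the local solution, and a constant left factor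
  -- preserves dψ = ψθ.
  have h1 := (hder p p hpU e he hp).const_mul ((ψ p * (σ p p)⁻¹ : Aˣ) : A)
  have hev : (fun q => (ψ q : A)) ∘ e.symm =ᶠ[𝓝 (e p)]
      fun z => ((ψ p * (σ p p)⁻¹ : Aˣ) : A) * ((fun q => (σ p q : A)) ∘ e.symm) z := by
    filter_upwards [(e.tendsto_symm hp).eventually (hψ p p hpU)] with z hz
    rw [← hz]
    simp
  refine (h1.congr_of_eventuallyEq hev).congr_fderiv ?_
  ext h
  simp [mul_assoc]

/-- The `1`-form with coefficients `a 0`, `a 1` in the chart `e`. -/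
def formOf (e : OpenPartialHomeomorph S E2) (a : Fin 2 → S → A) (z : E2) : E2 →L[ℝ] A :=
  (EuclideanSpace.proj (0 : Fin 2) : E2 →L[ℝ] ℝ).smulRight (a 0 (e.symm z)) +
    (EuclideanSpace.proj (1 : Fin 2) : E2 →L[ℝ] ℝ).smulRight (a 1 (e.symm z))

omit [ChartedSpace E2 S] [CompleteSpace A] in
theorem formOf_apply (e : OpenPartialHomeomorph S E2) (a : Fin 2 → S → A) (z h : E2) :
    formOf e a z h = h 0 • a 0 (e.symm z) + h 1 • a 1 (e.symm z) := rfl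

omit [ChartedSpace E2 S] [CompleteSpace A] in
theorem fderiv_formOf_apply {e : OpenPartialHomeomorph S E2} {a : Fin 2 → S → A} {z : E2}
    (ha : ∀ i, DifferentiableAt ℝ (a i ∘ e.symm) z) (h k : E2) :
    fderiv ℝ (formOf e a) z h k =
      k 0 • fderiv ℝ (a 0 ∘ e.symm) z h + k 1 • fderiv ℝ (a 1 ∘ e.symm) z h := by
  have h0 := ((ContinuousLinearMap.smulRightL ℝ E2 A
    (EuclideanSpace.proj (0 : Fin 2) : E2 →L[ℝ] ℝ)).hasFDerivAt).comp z (ha 0).hasFDerivAt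
  have h1 := ((ContinuousLinearMap.smulRightL ℝ E2 A
    (EuclideanSpace.proj (1 : Fin 2) : E2 →L[ℝ] ℝ)).hasFDerivAt).comp z (ha 1).hasFDerivAt
  have h2 : HasFDerivAt (formOf e a) _ z := h0.add h1
  rw [h2.fderiv]
  rfl

omit [CompleteSpace A] in
theorem fderiv_apply_eq {W : Type*} [NormedAddCommGroup W] [NormedSpace ℝ W] (L : E2 →L[ℝ] W)
    (h : E2) : L h = h 0 • L (EuclideanSpace.single 0 1) + h 1 • L (EuclideanSpace.single 1 1) := by
  conv_lhs => rw [eq_sum_single h]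
  simp

/-- Global integration of `ψ_u = ψ a₀`, `ψ_v = ψ a₁` on a simply connected surface. -/
theorem exists_global_solution_of_coeffs [SimplyConnectedSpace S]
    {𝒜 : Set (OpenPartialHomeomorph S E2)}
    (h𝒜 : IsCovering 𝒜) (a : OpenPartialHomeomorph S E2 → Fin 2 → S → A)
    (ha : ∀ e ∈ 𝒜, ∀ i, ContDiffOn ℝ ∞ (a e i ∘ e.symm) e.target)
    (hflat : ∀ e ∈ 𝒜, ∀ p ∈ e.source,
      fderiv ℝ (a e 1 ∘ e.symm) (e p) (EuclideanSpace.single 0 1) -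
        fderiv ℝ (a e 0 ∘ e.symm) (e p) (EuclideanSpace.single 1 1) +
        (a e 0 p * a e 1 p - a e 1 p * a e 0 p) = 0)
    (hcompat : ∀ e ∈ 𝒜, ∀ e' ∈ 𝒜, ∀ p ∈ e.source, p ∈ e'.source → ∀ i,
      a e' i p = jac e e' i 0 p • a e 0 p + jac e e' i 1 p • a e 1 p) :
    ∃ ψ : S → Aˣ, ∀ e ∈ 𝒜, ContDiffOn ℝ ∞ ((fun q => (ψ q : A)) ∘ e.symm) e.target ∧
      ∀ p ∈ e.source, ∀ i,
        fderiv ℝ ((fun q => (ψ q : A)) ∘ e.symm) (e p) (EuclideanSpace.single i 1) =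
          (ψ p : A) * a e i p := by
  have hsm : ∀ e ∈ 𝒜, ContDiffOn ℝ ∞ (formOf e (a e)) e.target := by
    intro e he
    have h0 := (ContinuousLinearMap.smulRightL ℝ E2 A
      (EuclideanSpace.proj (0 : Fin 2) : E2 →L[ℝ] ℝ)).contDiff.comp_contDiffOn (ha e he 0)
    have h1 := (ContinuousLinearMap.smulRightL ℝ E2 A
      (EuclideanSpace.proj (1 : Fin 2) : E2 →L[ℝ] ℝ)).contDiff.comp_contDiffOn (ha e he 1)
    exact h0.add h1
  have hfl : ∀ e ∈ 𝒜, ∀ z ∈ e.target, IsFlatAt (formOf e (a e)) z := by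
    intro e he z hz h k
    have hd : ∀ i, DifferentiableAt ℝ (a e i ∘ e.symm) z := fun i =>
      ((ha e he i).contDiffAt (e.open_target.mem_nhds hz)).differentiableAt (by simp)
    have hf := hflat e he _ (e.map_target hz)
    rw [e.right_inv hz] at hf
    rw [fderiv_formOf_apply hd, fderiv_formOf_apply hd, formOf_apply, formOf_apply,
      fderiv_apply_eq (fderiv ℝ (a e 0 ∘ e.symm) z) h,
      fderiv_apply_eq (fderiv ℝ (a e 0 ∘ e.symm) z) k,
      fderiv_apply_eq (fderiv ℝ (a e 1 ∘ e.symm) z) h,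
      fderiv_apply_eq (fderiv ℝ (a e 1 ∘ e.symm) z) k]
    -- The Maurer-Cartan expression is bilinear and alternating in (h, k), so it is the coordinate
    -- determinant of (h, k) times its value on the basis vectors.
    have hz' := congrArg (fun w => (h 0 * k 1 - h 1 * k 0) • w) hf
    simp only [smul_zero] at hz'
    rw [← hz']
    simp only [smul_add, smul_sub, add_mul, mul_add, smul_mul_smul_comm]
    module
  have hco : ∀ e ∈ 𝒜, ∀ e' ∈ 𝒜, ∀ p ∈ e.source, p ∈ e'.source →
      formOf e' (a e') (e' p) = (formOf e (a e) (e p)).comp (fderiv ℝ (e ∘ e'.symm) (e' p)) := by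
    intro e he e' he' p hp hp'
    ext h
    rw [fderiv_apply_eq (formOf e' (a e') (e' p)) h,
      fderiv_apply_eq ((formOf e (a e) (e p)).comp _) h]
    simp only [ContinuousLinearMap.comp_apply, formOf_apply, e.left_inv hp, e'.left_inv hp']
    have h0 := hcompat e he e' he' p hp hp' 0
    have h1 := hcompat e he e' he' p hp hp' 1
    simp only [jac] at h0 h1
    simp [h0, h1]
  obtain ⟨ψ, hψ⟩ := exists_global_solution h𝒜 (fun e => formOf e (a e)) hsm hfl hco
  refine ⟨ψ, fun e he => ⟨?_, fun p hp i => ?_⟩⟩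
  · refine contDiffOn_of_leftMulForm (θ := formOf e (a e)) e.open_target (hsm e he) fun z hz => ?_
    have := hψ e he _ (e.map_target hz)
    rwa [e.right_inv hz] at this
  · rw [(hψ e he p hp).fderiv, leftMulForm_apply, formOf_apply, e.left_inv hp]
    fin_cases i <;> simp

end Integration

end

/-! ### Calculus of partial derivatives in a chart, and primitives. -/

section

variable {S : Type*} [TopologicalSpace S] [ChartedSpace E2 S]

@[simp] theorem toQuat_re (w : E3) : (toQuat w).re = 0 := rfl
@[simp] theorem toQuat_imI (w : E3) : (toQuat w).imI = w 0 := rfl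
@[simp] theorem toQuat_imJ (w : E3) : (toQuat w).imJ = w 1 := rfl
@[simp] theorem toQuat_imK (w : E3) : (toQuat w).imK = w 2 := rfl
@[simp] theorem ofQuat_apply_zero (q : ℍ[ℝ]) : ofQuat q 0 = q.imI := rfl
@[simp] theorem ofQuat_apply_one (q : ℍ[ℝ]) : ofQuat q 1 = q.imJ := rfl
@[simp] theorem ofQuat_apply_two (q : ℍ[ℝ]) : ofQuat q 2 = q.imK := rfl

/-- Quaternionic conjugation as a continuous linear map. -/
def quatStarL : ℍ[ℝ] →L[ℝ] ℍ[ℝ] :=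
  LinearMap.toContinuousLinearMap
    { toFun := star, map_add' := star_add, map_smul' := fun c x => by ext <;> simp }

/-- `toQuat` as a continuous linear map. -/
def toQuatL : E3 →L[ℝ] ℍ[ℝ] :=
  LinearMap.toContinuousLinearMap
    { toFun := toQuat
      map_add' := fun x y => by ext <;> simp
      map_smul' := fun c x => by ext <;> simp }

/-- `ofQuat` as a continuous linear map. -/
def ofQuatL : ℍ[ℝ] →L[ℝ] E3 :=
  LinearMap.toContinuousLinearMap
    { toFun := ofQuat
      map_add' := fun x y => by ext i; fin_cases i <;> simp [ofQuat]
      map_smul' := fun c x => by ext i; fin_cases i <;> simp [ofQuat] }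

/-- The function `h` is smooth in the coordinates of `e`. -/
def SmoothIn {W : Type*} [NormedAddCommGroup W] [NormedSpace ℝ W]
    (e : OpenPartialHomeomorph S E2) (h : S → W) : Prop :=
  ContDiffOn ℝ ∞ (h ∘ e.symm) e.target

/-- The coordinate line through `p` in the direction of the `i`-th coordinate. -/
def coordLine (e : OpenPartialHomeomorph S E2) (i : Fin 2) (p : S) (t : ℝ) : S :=
  e.symm (e p + t • EuclideanSpace.single i 1)

omit [ChartedSpace E2 S] in
theorem coordLine_zero {e : OpenPartialHomeomorph S E2} {i : Fin 2} {p : S} (hp : p ∈ e.source) :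
    coordLine e i p 0 = p := by simp [coordLine, hp]

section

variable {V : Type*} [NormedAddCommGroup V] [InnerProductSpace ℝ V]
  {V' : Type*} [NormedAddCommGroup V'] [InnerProductSpace ℝ V']
  {e : OpenPartialHomeomorph S E2} {p : S} {i j : Fin 2}

omit [ChartedSpace E2 S] in
theorem SmoothIn.differentiableAt {f : S → V} (hf : SmoothIn e f) (hp : p ∈ e.source) :
    DifferentiableAt ℝ (f ∘ e.symm) (e p) :=
  (ContDiffOn.contDiffAt hf (e.open_target.mem_nhds (e.map_source hp))).differentiableAt (by simp)

-- Chart derivatives become derivatives in one real variable, so the product and chain rules below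
-- follow from those for `HasDerivAt`.
omit [ChartedSpace E2 S] in
theorem SmoothIn.hasDerivAt {f : S → V} (hf : SmoothIn e f) (i : Fin 2) (hp : p ∈ e.source) :
    HasDerivAt (fun t => f (coordLine e i p t)) (pd e i f p) 0 := by
  have h1 : HasDerivAt (fun t : ℝ => e p + t • (EuclideanSpace.single i 1 : E2))
      (EuclideanSpace.single i 1) 0 := by
    simpa using ((hasDerivAt_id (0 : ℝ)).smul_const (EuclideanSpace.single i 1 : E2)).const_add (e p)
  have h2 : HasFDerivAt (f ∘ e.symm) (fderiv ℝ (f ∘ e.symm) (e p))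
      (e p + (0 : ℝ) • (EuclideanSpace.single i 1 : E2)) := by
    simpa using (hf.differentiableAt hp).hasFDerivAt
  exact h2.comp_hasDerivAt 0 h1

omit [ChartedSpace E2 S] in
theorem pd_eq_of_hasDerivAt {f : S → V} (hf : SmoothIn e f) (hp : p ∈ e.source) {f' : V}
    (h : HasDerivAt (fun t => f (coordLine e i p t)) f' 0) : pd e i f p = f' :=
  (hf.hasDerivAt i hp).unique h

omit [ChartedSpace E2 S] in
theorem pd_congr {f g : S → V} (hp : p ∈ e.source) (h : ∀ q ∈ e.source, f q = g q) :
    pd e i f p = pd e i g p := by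
  have : f ∘ e.symm =ᶠ[𝓝 (e p)] g ∘ e.symm := by
    filter_upwards [e.open_target.mem_nhds (e.map_source hp)] with z hz
    exact h _ (e.map_target hz)
  simp only [pd, this.fderiv_eq]

omit [ChartedSpace E2 S] in
theorem SmoothIn.congr {f g : S → V} (hf : SmoothIn e f) (h : ∀ q ∈ e.source, g q = f q) :
    SmoothIn e g :=
  ContDiffOn.congr hf fun _ hz => h _ (e.map_target hz)

omit [ChartedSpace E2 S] in
theorem SmoothIn.pd {f : S → V} (hf : SmoothIn e f) (i : Fin 2) : SmoothIn e (pd e i f) := by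
  have h1 : ContDiffOn ℝ ∞ (fun z => fderiv ℝ (f ∘ e.symm) z (EuclideanSpace.single i 1))
      e.target :=
    (ContDiffOn.fderiv_of_isOpen hf e.open_target (by simp)).clm_apply contDiffOn_const
  refine h1.congr fun z hz => ?_
  simp [NegCurv.pd, e.right_inv hz]

omit [ChartedSpace E2 S] in
theorem pd_pd_apply {f : S → V} (hf : SmoothIn e f) (hp : p ∈ e.source) :
    pd e i (pd e j f) p = fderiv ℝ (fderiv ℝ (f ∘ e.symm)) (e p) (EuclideanSpace.single i 1)
      (EuclideanSpace.single j 1) := by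
  have h0 : ContDiffAt ℝ ∞ (f ∘ e.symm) (e p) :=
    ContDiffOn.contDiffAt hf (e.open_target.mem_nhds (e.map_source hp))
  have h1 : DifferentiableAt ℝ (fderiv ℝ (f ∘ e.symm)) (e p) :=
    (h0.fderiv_right (m := 1) (by norm_cast)).differentiableAt (by simp)
  have h2 : pd e j f ∘ e.symm =ᶠ[𝓝 (e p)]
      fun z => fderiv ℝ (f ∘ e.symm) z (EuclideanSpace.single j 1) := by
    filter_upwards [e.open_target.mem_nhds (e.map_source hp)] with z hz
    simp [NegCurv.pd, e.right_inv hz]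
  have h3 := h1.hasFDerivAt.clm_apply
    (hasFDerivAt_const (EuclideanSpace.single j 1 : E2) (e p))
  rw [pd, h2.fderiv_eq, h3.fderiv]
  simp

omit [ChartedSpace E2 S] in
theorem pd_comm {f : S → V} (hf : SmoothIn e f) (hp : p ∈ e.source) :
    pd e i (pd e j f) p = pd e j (pd e i f) p := by
  have h0 : ContDiffAt ℝ ∞ (f ∘ e.symm) (e p) :=
    ContDiffOn.contDiffAt hf (e.open_target.mem_nhds (e.map_source hp))
  rw [pd_pd_apply hf hp, pd_pd_apply hf hp]
  exact h0.isSymmSndFDerivAt (by rw [minSmoothness_of_isRCLikeNormedField]; norm_cast) _ _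

omit [ChartedSpace E2 S] in
theorem SmoothIn.add {f g : S → V} (hf : SmoothIn e f) (hg : SmoothIn e g) :
    SmoothIn e (fun q => f q + g q) := ContDiffOn.add hf hg

omit [ChartedSpace E2 S] in
theorem SmoothIn.neg {f : S → V} (hf : SmoothIn e f) : SmoothIn e (fun q => -f q) :=
  ContDiffOn.neg hf

omit [ChartedSpace E2 S] in
theorem SmoothIn.sub {f g : S → V} (hf : SmoothIn e f) (hg : SmoothIn e g) :
    SmoothIn e (fun q => f q - g q) := ContDiffOn.sub hf hg

omit [ChartedSpace E2 S] in
theorem SmoothIn.smul {c : S → ℝ} {f : S → V} (hc : SmoothIn e c) (hf : SmoothIn e f) :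
    SmoothIn e (fun q => c q • f q) := ContDiffOn.smul hc hf

omit [ChartedSpace E2 S] in
theorem SmoothIn.mul {f g : S → ℝ} (hf : SmoothIn e f) (hg : SmoothIn e g) :
    SmoothIn e (fun q => f q * g q) := ContDiffOn.mul hf hg

omit [ChartedSpace E2 S] in
theorem SmoothIn.inner {f g : S → V} (hf : SmoothIn e f) (hg : SmoothIn e g) :
    SmoothIn e (fun q => ⟪f q, g q⟫) := ContDiffOn.inner ℝ hf hg

omit [ChartedSpace E2 S] in
theorem SmoothIn.const (c : V) : SmoothIn e (fun _ : S => c) := contDiffOn_const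

omit [ChartedSpace E2 S] in
theorem SmoothIn.clm (L : V →L[ℝ] V') {f : S → V} (hf : SmoothIn e f) :
    SmoothIn e (fun q => L (f q)) := L.contDiff.comp_contDiffOn hf

omit [ChartedSpace E2 S] in
theorem SmoothIn.comp_real {φ : ℝ → ℝ} {f : S → ℝ} (hf : SmoothIn e f)
    (hφ : ∀ q ∈ e.source, ContDiffAt ℝ ∞ φ (f q)) : SmoothIn e (fun q => φ (f q)) :=
  fun z hz => ContDiffAt.comp_contDiffWithinAt (g := φ) (f := f ∘ e.symm) z
    (hφ _ (e.map_target hz)) (hf z hz)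

omit [ChartedSpace E2 S] in
theorem SmoothIn.quatMul {f g : S → ℍ[ℝ]} (hf : SmoothIn e f) (hg : SmoothIn e g) :
    SmoothIn e (fun q => f q * g q) := ContDiffOn.mul hf hg

omit [ChartedSpace E2 S] in
theorem SmoothIn.quatStar {f : S → ℍ[ℝ]} (hf : SmoothIn e f) :
    SmoothIn e (fun q => star (f q)) :=
  hf.clm quatStarL

omit [ChartedSpace E2 S] in
theorem pd_sub {f g : S → V} (hf : SmoothIn e f) (hg : SmoothIn e g) (hp : p ∈ e.source) :
    pd e i (fun q => f q - g q) p = pd e i f p - pd e i g p :=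
  pd_eq_of_hasDerivAt (hf.sub hg) hp ((hf.hasDerivAt i hp).sub (hg.hasDerivAt i hp))

omit [ChartedSpace E2 S] in
theorem pd_neg {f : S → V} (hf : SmoothIn e f) (hp : p ∈ e.source) :
    pd e i (fun q => -f q) p = -pd e i f p :=
  pd_eq_of_hasDerivAt hf.neg hp (hf.hasDerivAt i hp).neg

omit [ChartedSpace E2 S] in
theorem pd_const (c : V) (hp : p ∈ e.source) : pd e i (fun _ : S => c) p = 0 :=
  pd_eq_of_hasDerivAt (SmoothIn.const c) hp (hasDerivAt_const _ _)

omit [ChartedSpace E2 S] in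
theorem pd_clm (L : V →L[ℝ] V') {f : S → V} (hf : SmoothIn e f) (hp : p ∈ e.source) :
    pd e i (fun q => L (f q)) p = L (pd e i f p) :=
  pd_eq_of_hasDerivAt (hf.clm L) hp (L.hasFDerivAt.comp_hasDerivAt 0 (hf.hasDerivAt i hp))

omit [ChartedSpace E2 S] in
theorem pd_smul {c : S → ℝ} {f : S → V} (hc : SmoothIn e c) (hf : SmoothIn e f)
    (hp : p ∈ e.source) :
    pd e i (fun q => c q • f q) p = c p • pd e i f p + pd e i c p • f p := by
  have h := (hc.hasDerivAt i hp).smul (hf.hasDerivAt i hp)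
  rw [coordLine_zero hp] at h
  exact pd_eq_of_hasDerivAt (hc.smul hf) hp h

omit [ChartedSpace E2 S] in
theorem pd_mul {f g : S → ℝ} (hf : SmoothIn e f) (hg : SmoothIn e g) (hp : p ∈ e.source) :
    pd e i (fun q => f q * g q) p = pd e i f p * g p + f p * pd e i g p := by
  have h := (hf.hasDerivAt i hp).mul (hg.hasDerivAt i hp)
  rw [coordLine_zero hp] at h
  exact pd_eq_of_hasDerivAt (hf.mul hg) hp h

omit [ChartedSpace E2 S] in
theorem pd_inner {f g : S → V} (hf : SmoothIn e f) (hg : SmoothIn e g) (hp : p ∈ e.source) :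
    pd e i (fun q => ⟪f q, g q⟫) p = ⟪f p, pd e i g p⟫ + ⟪pd e i f p, g p⟫ := by
  have h := (hf.hasDerivAt i hp).inner ℝ (hg.hasDerivAt i hp)
  rw [coordLine_zero hp] at h
  exact pd_eq_of_hasDerivAt (hf.inner hg) hp h

omit [ChartedSpace E2 S] in
theorem pd_comp_real {φ : ℝ → ℝ} {f : S → ℝ} (hf : SmoothIn e f)
    (hφ : ∀ q ∈ e.source, ContDiffAt ℝ ∞ φ (f q)) (hp : p ∈ e.source) {φ' : ℝ}
    (hφ' : HasDerivAt φ φ' (f p)) :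
    pd e i (fun q => φ (f q)) p = φ' * pd e i f p := by
  have h : HasDerivAt φ φ' (f (coordLine e i p 0)) := by rwa [coordLine_zero hp]
  exact pd_eq_of_hasDerivAt (hf.comp_real hφ) hp (h.comp 0 (hf.hasDerivAt i hp))

omit [ChartedSpace E2 S] in
theorem pd_quatMul {f g : S → ℍ[ℝ]} (hf : SmoothIn e f) (hg : SmoothIn e g) (hp : p ∈ e.source) :
    pd e i (fun q => f q * g q) p = pd e i f p * g p + f p * pd e i g p := by
  have h := (hf.hasDerivAt i hp).mul (hg.hasDerivAt i hp)
  rw [coordLine_zero hp] at h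
  exact pd_eq_of_hasDerivAt (hf.quatMul hg) hp h

omit [ChartedSpace E2 S] in
theorem pd_quatStar {f : S → ℍ[ℝ]} (hf : SmoothIn e f) (hp : p ∈ e.source) :
    pd e i (fun q => star (f q)) p = star (pd e i f p) :=
  pd_clm quatStarL hf hp

theorem smoothIn_of_contMDiff {f : S → V} (hf : ContMDiff (𝓡 2) 𝓘(ℝ, V) ∞ f)
    (he : e ∈ IsManifold.maximalAtlas (𝓡 2) ∞ S) : SmoothIn e f := by
  have h := (hf.contMDiffOn (s := univ)).comp (contMDiffOn_symm_of_mem_maximalAtlas he)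
    (fun _ _ => mem_univ _)
  exact contMDiffOn_iff_contDiffOn.mp h

theorem contMDiff_of_smoothIn {𝒜 : Set (OpenPartialHomeomorph S E2)} (h𝒜 : IsCovering 𝒜)
    {f : S → V} (hf : ∀ e ∈ 𝒜, SmoothIn e f) : ContMDiff (𝓡 2) 𝓘(ℝ, V) ∞ f := by
  intro p
  obtain ⟨e, he, hp⟩ := h𝒜.2 p
  have h1 : ContMDiffAt 𝓘(ℝ, E2) 𝓘(ℝ, V) ∞ (f ∘ e.symm) (e p) :=
    (ContDiffOn.contDiffAt (hf e he) (e.open_target.mem_nhds (e.map_source hp))).contMDiffAt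
  have h2 := contMDiffAt_of_mem_maximalAtlas (h𝒜.1 he) hp
  refine (h1.comp p h2).congr_of_eventuallyEq ?_
  filter_upwards [e.open_source.mem_nhds hp] with q hq
  simp [e.left_inv hq]

theorem pd_change {e e' : OpenPartialHomeomorph S E2}
    (he : e ∈ IsManifold.maximalAtlas (𝓡 2) ∞ S) (he' : e' ∈ IsManifold.maximalAtlas (𝓡 2) ∞ S)
    {p : S} (hp : p ∈ e.source) (hp' : p ∈ e'.source) {h : S → V} (hh : SmoothIn e h)
    (i : Fin 2) :
    pd e' i h p = jac e e' i 0 p • pd e 0 h p + jac e e' i 1 p • pd e 1 h p :=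
  fderiv_change he he' hp hp' (hh.differentiableAt hp) i

end

/-- Global integration of `r_u = r a₀`, `r_v = r a₁` for real functions. -/
theorem exists_real_solution [SimplyConnectedSpace S]
    {𝒜 : Set (OpenPartialHomeomorph S E2)}
    (h𝒜 : IsCovering 𝒜) (a : OpenPartialHomeomorph S E2 → Fin 2 → S → ℝ)
    (ha : ∀ e ∈ 𝒜, ∀ i, SmoothIn e (a e i))
    (hclosed : ∀ e ∈ 𝒜, ∀ p ∈ e.source, pd e 0 (a e 1) p = pd e 1 (a e 0) p)
    (hcompat : ∀ e ∈ 𝒜, ∀ e' ∈ 𝒜, ∀ p ∈ e.source, p ∈ e'.source → ∀ i,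
      a e' i p = jac e e' i 0 p • a e 0 p + jac e e' i 1 p • a e 1 p) :
    ∃ r : S → ℝ, (∀ p, r p ≠ 0) ∧ ∀ e ∈ 𝒜, SmoothIn e r ∧
      ∀ p ∈ e.source, ∀ i, pd e i r p = r p * a e i p := by
  obtain ⟨ψ, hψ⟩ := exists_global_solution_of_coeffs h𝒜 a ha (fun e he p hp => by
    -- In the commutative algebra ℝ the commutator vanishes, and Maurer-Cartan is plain closedness.
    rw [mul_comm, sub_self, add_zero]
    exact sub_eq_zero.mpr (hclosed e he p hp)) hcompat
  exact ⟨fun q => ψ q, fun p => (ψ p).ne_zero, hψ⟩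

/-- Global integration of `φ_u = b₀`, `φ_v = b₁` for real functions. -/
theorem exists_real_primitive [SimplyConnectedSpace S]
    {𝒜 : Set (OpenPartialHomeomorph S E2)}
    (h𝒜 : IsCovering 𝒜) (b : OpenPartialHomeomorph S E2 → Fin 2 → S → ℝ)
    (hb : ∀ e ∈ 𝒜, ∀ i, SmoothIn e (b e i))
    (hclosed : ∀ e ∈ 𝒜, ∀ p ∈ e.source, pd e 0 (b e 1) p = pd e 1 (b e 0) p)
    (hcompat : ∀ e ∈ 𝒜, ∀ e' ∈ 𝒜, ∀ p ∈ e.source, p ∈ e'.source → ∀ i,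
      b e' i p = jac e e' i 0 p • b e 0 p + jac e e' i 1 p • b e 1 p) :
    ∃ φ : S → ℝ, ∀ e ∈ 𝒜, SmoothIn e φ ∧ ∀ p ∈ e.source, ∀ i, pd e i φ p = b e i p := by
  obtain ⟨r, hr, h⟩ := exists_real_solution h𝒜 b hb hclosed hcompat
  -- The multiplicative equation for r becomes additive under the logarithm. `Real.log` is log |r|,
  -- so the sign of r does not matter.
  refine ⟨fun q => Real.log (r q), fun e he => ⟨?_, fun p hp i => ?_⟩⟩
  · exact (h e he).1.comp_real fun q _ => Real.contDiffAt_log.mpr (hr q)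
  · rw [pd_comp_real (h e he).1 (fun q _ => Real.contDiffAt_log.mpr (hr q)) hp
      (Real.hasDerivAt_log (hr p)), (h e he).2 p hp i, inv_mul_cancel_left₀ (hr p)]

/-- Global integration of `φ_u = b₀`, `φ_v = b₁` for maps to Euclidean 3-space. -/
theorem exists_E3_primitive [SimplyConnectedSpace S]
    {𝒜 : Set (OpenPartialHomeomorph S E2)}
    (h𝒜 : IsCovering 𝒜) (b : OpenPartialHomeomorph S E2 → Fin 2 → S → E3)
    (hb : ∀ e ∈ 𝒜, ∀ i, SmoothIn e (b e i))
    (hclosed : ∀ e ∈ 𝒜, ∀ p ∈ e.source, pd e 0 (b e 1) p = pd e 1 (b e 0) p)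
    (hcompat : ∀ e ∈ 𝒜, ∀ e' ∈ 𝒜, ∀ p ∈ e.source, p ∈ e'.source → ∀ i,
      b e' i p = jac e e' i 0 p • b e 0 p + jac e e' i 1 p • b e 1 p) :
    ∃ φ : S → E3, ∀ e ∈ 𝒜, SmoothIn e φ ∧ ∀ p ∈ e.source, ∀ i, pd e i φ p = b e i p := by
  have hk : ∀ k : Fin 3, ∃ φ : S → ℝ, ∀ e ∈ 𝒜, SmoothIn e φ ∧
      ∀ p ∈ e.source, ∀ i, pd e i φ p = b e i p k := by
    intro k
    refine exists_real_primitive h𝒜 (fun e i q => b e i q k)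
      (fun e he i => (hb e he i).clm (EuclideanSpace.proj k : E3 →L[ℝ] ℝ))
      (fun e he p hp => ?_) (fun e he e' he' p hp hp' i => ?_)
    · have h1 := pd_clm (i := 0) (EuclideanSpace.proj k : E3 →L[ℝ] ℝ) (hb e he 1) hp
      have h2 := pd_clm (i := 1) (EuclideanSpace.proj k : E3 →L[ℝ] ℝ) (hb e he 0) hp
      rw [hclosed e he p hp] at h1
      exact h1.trans h2.symm
    · rw [hcompat e he e' he' p hp hp' i]
      rfl
  choose φ hφ using hk
  refine ⟨fun q => WithLp.toLp 2 fun k => φ k q, fun e he => ?_⟩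
  have hsm : SmoothIn e (fun q => (WithLp.toLp 2 fun k => φ k q : E3)) := by
    refine contDiffOn_euclidean.mpr fun k => ?_
    exact (hφ k e he).1
  refine ⟨hsm, fun p hp i => ?_⟩
  ext k
  have h1 := pd_clm (i := i) (EuclideanSpace.proj k : E3 →L[ℝ] ℝ) hsm hp
  rw [← (hφ k e he).2 p hp i]
  exact h1.symm

end

/-! ### Cross products, determinants and imaginary quaternions. -/

section

/-- The cross product of `E3`. -/
def cr (a b : E3) : E3 :=
  !₂[a 1 * b 2 - a 2 * b 1, a 2 * b 0 - a 0 * b 2, a 0 * b 1 - a 1 * b 0]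

@[simp] theorem cr_apply_zero (a b : E3) : cr a b 0 = a 1 * b 2 - a 2 * b 1 := rfl
@[simp] theorem cr_apply_one (a b : E3) : cr a b 1 = a 2 * b 0 - a 0 * b 2 := rfl
@[simp] theorem cr_apply_two (a b : E3) : cr a b 2 = a 0 * b 1 - a 1 * b 0 := rfl

theorem inner_E3 (a b : E3) : ⟪a, b⟫ = a 0 * b 0 + a 1 * b 1 + a 2 * b 2 := by
  simp [PiLp.inner_apply, Fin.sum_univ_three, mul_comm]

theorem triple_eq (a b c : E3) : triple a b c =
    a 0 * (b 1 * c 2 - b 2 * c 1) - a 1 * (b 0 * c 2 - b 2 * c 0)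
      + a 2 * (b 0 * c 1 - b 1 * c 0) := by
  simp [triple, Matrix.det_fin_three]
  ring

theorem E3_ext {a b : E3} (h0 : a 0 = b 0) (h1 : a 1 = b 1) (h2 : a 2 = b 2) : a = b := by
  ext i
  fin_cases i
  · exact h0
  · exact h1
  · exact h2

/-- Cramer's rule: the coefficients are the entries of b × c, c × a and a × b. -/
theorem eq_of_inner_eq {a b c z z' : E3} (h : triple a b c ≠ 0) (ha : ⟪z, a⟫ = ⟪z', a⟫)
    (hb : ⟪z, b⟫ = ⟪z', b⟫) (hc : ⟪z, c⟫ = ⟪z', c⟫) : z = z' := by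
  rw [triple_eq] at h
  rw [inner_E3, inner_E3] at ha hb hc
  refine E3_ext (mul_left_cancel₀ h ?_) (mul_left_cancel₀ h ?_) (mul_left_cancel₀ h ?_)
  · linear_combination (b 1 * c 2 - b 2 * c 1) * ha + (c 1 * a 2 - c 2 * a 1) * hb
      + (a 1 * b 2 - a 2 * b 1) * hc
  · linear_combination (b 2 * c 0 - b 0 * c 2) * ha + (c 2 * a 0 - c 0 * a 2) * hb
      + (a 2 * b 0 - a 0 * b 2) * hc
  · linear_combination (b 0 * c 1 - b 1 * c 0) * ha + (c 0 * a 1 - c 1 * a 0) * hb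
      + (a 0 * b 1 - a 1 * b 0) * hc

/-- If `N, w, w'` is a frame with `N` a unit vector orthogonal to `w, w'`, and `n ⟂ w`, then
`N × n` is a multiple of `w`. -/
theorem smul_eq_cr {N n w w' : E3} {s : ℝ} (hN : ⟪N, N⟫ = 1)
    (hw : ⟪N, w⟫ = 0) (hw' : ⟪N, w'⟫ = 0) (hD : triple w w' N ≠ 0) (h0 : ⟪n, w⟫ = 0)
    (h1 : ⟪n, w'⟫ = -(s * triple w w' N)) : s • w = cr N n := by
  -- Both sides are tested against the basis N, N × w, N × w'; the inner products of cross products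
  -- are expanded by the Binet-Cauchy identity.
  have ht : triple N (cr N w) (cr N w') ≠ 0 := by
    have : triple N (cr N w) (cr N w') = ⟪N, N⟫ * triple w w' N := by
      simp only [triple_eq, inner_E3, cr_apply_zero, cr_apply_one, cr_apply_two]; ring
    rwa [this, hN, one_mul]
  refine eq_of_inner_eq ht ?_ ?_ ?_
  · rw [inner_smul_left, real_inner_comm, hw]
    simp only [inner_E3, cr_apply_zero, cr_apply_one, cr_apply_two]; simp; ring
  · have e1 : ⟪s • w, cr N w⟫ = 0 := by
      rw [inner_smul_left, inner_E3]; simp; right; ring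
    have e2 : ⟪cr N n, cr N w⟫ = ⟪N, N⟫ * ⟪n, w⟫ - ⟪N, w⟫ * ⟪N, n⟫ := by
      simp only [inner_E3, cr_apply_zero, cr_apply_one, cr_apply_two]; ring
    rw [e1, e2, h0, hw]; ring
  · have e1 : ⟪s • w, cr N w'⟫ = -(s * triple w w' N) := by
      rw [inner_smul_left, inner_E3, triple_eq]; simp; ring
    have e2 : ⟪cr N n, cr N w'⟫ = ⟪N, N⟫ * ⟪n, w'⟫ - ⟪N, w'⟫ * ⟪N, n⟫ := by
      simp only [inner_E3, cr_apply_zero, cr_apply_one, cr_apply_two]; ring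
    rw [e1, e2, h1, hN, hw']; ring

/-- The Gram determinant of two vectors orthogonal to the unit vector `N`. -/
theorem gram_eq_triple_sq {N w w' : E3} (hN : ⟪N, N⟫ = 1) (hw : ⟪N, w⟫ = 0) (hw' : ⟪N, w'⟫ = 0) :
    ⟪w, w⟫ * ⟪w', w'⟫ - ⟪w, w'⟫ * ⟪w', w⟫ = triple w w' N ^ 2 := by
  -- The square of a determinant is the Gram determinant of its three vectors, here expanded along
  -- N.
  have h : triple w w' N ^ 2 = ⟪N, N⟫ * (⟪w, w⟫ * ⟪w', w'⟫ - ⟪w, w'⟫ * ⟪w', w⟫)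
      - ⟪N, w⟫ * (⟪N, w⟫ * ⟪w', w'⟫ - ⟪N, w'⟫ * ⟪w, w'⟫)
      + ⟪N, w'⟫ * (⟪N, w⟫ * ⟪w, w'⟫ - ⟪N, w'⟫ * ⟪w, w⟫) := by
    simp only [triple_eq, inner_E3]; ring
  rw [h, hN, hw, hw']; ring

theorem inner_cr_self (N n : E3) : ⟪N, cr N n⟫ = 0 := by rw [inner_E3]; simp; ring
theorem inner_self_cr (N n : E3) : ⟪n, cr N n⟫ = 0 := by rw [inner_E3]; simp; ring
theorem inner_cr (N n m : E3) : ⟪n, cr N m⟫ = -triple N n m := by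
  rw [inner_E3, triple_eq]; simp; ring

theorem triple_cr_cr {N n m : E3} (hN : ⟪N, N⟫ = 1) :
    triple (cr N n) (cr N m) N = triple N n m := by
  have : triple (cr N n) (cr N m) N = ⟪N, N⟫ * triple N n m := by
    simp only [triple_eq, inner_E3, cr_apply_zero, cr_apply_one, cr_apply_two]; ring
  rw [this, hN, one_mul]

theorem triple_swap (a b c : E3) : triple b a c = -triple a b c := by
  simp only [triple_eq]; ring

theorem triple_smul_smul (s t : ℝ) (a b c : E3) :
    triple (s • a) (t • b) c = s * t * triple a b c := by
  simp only [triple_eq, PiLp.smul_apply, smul_eq_mul]; ring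

theorem triple_comb (a b c d : ℝ) (x y z : E3) :
    triple (a • x + b • y) (c • x + d • y) z = (a * d - b * c) * triple x y z := by
  simp only [triple_eq, PiLp.smul_apply, PiLp.add_apply, smul_eq_mul]; ring

/-- `N ⟂ n, m` implies `(N × n) × (N × m) = n × m`. -/
theorem cr_cr_cr {N n m : E3} (hN : ⟪N, N⟫ = 1) (hn : ⟪N, n⟫ = 0) (hm : ⟪N, m⟫ = 0) :
    cr (cr N n) (cr N m) = cr n m := by
  rw [inner_E3] at hN hn hm
  refine E3_ext ?_ ?_ ?_
  · simp only [cr_apply_zero, cr_apply_one, cr_apply_two]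
    linear_combination (n 1 * m 2 - n 2 * m 1) * hN
      + (N 2 * m 1 - N 1 * m 2) * hn + (N 1 * n 2 - N 2 * n 1) * hm
  · simp only [cr_apply_zero, cr_apply_one, cr_apply_two]
    linear_combination (n 2 * m 0 - n 0 * m 2) * hN
      + (N 0 * m 2 - N 2 * m 0) * hn + (N 2 * n 0 - N 0 * n 2) * hm
  · simp only [cr_apply_zero, cr_apply_one, cr_apply_two]
    linear_combination (n 0 * m 1 - n 1 * m 0) * hN
      + (N 1 * m 0 - N 0 * m 1) * hn + (N 0 * n 1 - N 1 * n 0) * hm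

theorem cr_swap (a b : E3) : cr b a = -cr a b := by
  refine E3_ext ?_ ?_ ?_ <;> simp <;> ring

theorem cr_smul_smul (s t : ℝ) (a b : E3) : cr (s • a) (t • b) = (s * t) • cr a b := by
  refine E3_ext ?_ ?_ ?_ <;> simp <;> ring

theorem cr_eq_ofQuat (a b : E3) : cr a b = ofQuat (toQuat a * toQuat b) := by
  refine E3_ext ?_ ?_ ?_ <;> simp; ring

theorem toQuat_commutator (a b : E3) :
    toQuat a * toQuat b - toQuat b * toQuat a = toQuat ((2 : ℝ) • cr a b) := by
  ext <;> simp <;> ring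

theorem toQuat_mul (a b : E3) : toQuat a * toQuat b = ((-⟪a, b⟫ : ℝ) : ℍ[ℝ]) + toQuat (cr a b) := by
  rw [inner_E3]
  ext <;> simp <;> ring

theorem ofQuat_toQuat (a : E3) : ofQuat (toQuat a) = a := E3_ext rfl rfl rfl
theorem toQuat_ofQuat {q : ℍ[ℝ]} (h : q.re = 0) : toQuat (ofQuat q) = q := by
  ext <;> simp [h]

theorem star_toQuat (a : E3) : star (toQuat a) = -toQuat a := by ext <;> simp
theorem inner_toQuat (a b : E3) : ⟪toQuat a, toQuat b⟫ = ⟪a, b⟫ := by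
  rw [Quaternion.inner_def, inner_E3]; simp

theorem norm_toQuat (a : E3) : ‖toQuat a‖ = ‖a‖ := by
  rw [@norm_eq_sqrt_real_inner ℍ[ℝ], @norm_eq_sqrt_real_inner E3, inner_toQuat]

theorem inner_coe_toQuat (t : ℝ) (a : E3) : ⟪(t : ℍ[ℝ]), toQuat a⟫ = 0 := by
  rw [Quaternion.inner_def]; simp

/-- The quaternion norm is multiplicative, so left multiplication by a unit is an isometry;
polarization passes to inner products. -/
theorem inner_mul_mul {x a b : ℍ[ℝ]} (hx : ‖x‖ = 1) : ⟪x * a, x * b⟫ = ⟪a, b⟫ := by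
  rw [real_inner_eq_norm_add_mul_self_sub_norm_mul_self_sub_norm_mul_self_div_two,
    real_inner_eq_norm_add_mul_self_sub_norm_mul_self_sub_norm_mul_self_div_two, ← mul_add,
    norm_mul, norm_mul, norm_mul, hx, one_mul, one_mul, one_mul]

theorem star_mul_self_of_norm_one {x : ℍ[ℝ]} (hx : ‖x‖ = 1) : star x * x = 1 := by
  rw [Quaternion.star_mul_self, Quaternion.normSq_eq_norm_mul_self, hx]; simp

theorem self_mul_star_of_norm_one {x : ℍ[ℝ]} (hx : ‖x‖ = 1) : x * star x = 1 := by
  rw [Quaternion.self_mul_star, Quaternion.normSq_eq_norm_mul_self, hx]; simp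

/-- The second fundamental form in the frame `(w_i, N)`: `w_i` is the left translation of the
`i`-th partial derivative of the immersion, `n` that of the left-translated normal. -/
theorem inner_left_translated {x : ℍ[ℝ]} (hx : ‖x‖ = 1) (N n w w' : E3) :
    -⟪x * (toQuat w * toQuat N + toQuat n), x * toQuat w'⟫ = -⟪n, w'⟫ + triple w w' N := by
  -- The real part of wN is orthogonal to w', and its imaginary part w × N gives -⟨w × N, w'⟩ =
  -- det(w, w', N). This term is what later shifts k to k - 1 and k + 1.
  rw [inner_mul_mul hx, toQuat_mul, inner_add_left, inner_add_left, inner_coe_toQuat, inner_toQuat,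
    inner_toQuat]
  simp only [inner_E3, triple_eq, cr_apply_zero, cr_apply_one, cr_apply_two]
  ring

section

variable {S : Type*} [TopologicalSpace S] {e : OpenPartialHomeomorph S E2} {p : S} {i j : Fin 2}

theorem SmoothIn.toQuat {f : S → E3} (hf : SmoothIn e f) : SmoothIn e (fun q => toQuat (f q)) :=
  hf.clm toQuatL

theorem SmoothIn.ofQuat {f : S → ℍ[ℝ]} (hf : SmoothIn e f) : SmoothIn e (fun q => ofQuat (f q)) :=
  hf.clm ofQuatL

theorem pd_toQuat {f : S → E3} (hf : SmoothIn e f) (hp : p ∈ e.source) :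
    pd e i (fun q => toQuat (f q)) p = toQuat (pd e i f p) := pd_clm toQuatL hf hp

theorem pd_ofQuat {f : S → ℍ[ℝ]} (hf : SmoothIn e f) (hp : p ∈ e.source) :
    pd e i (fun q => ofQuat (f q)) p = ofQuat (pd e i f p) := pd_clm ofQuatL hf hp

theorem ofQuat_add (a b : ℍ[ℝ]) : ofQuat (a + b) = ofQuat a + ofQuat b := ofQuatL.map_add a b
theorem ofQuat_smul (c : ℝ) (a : ℍ[ℝ]) : ofQuat (c • a) = c • ofQuat a := ofQuatL.map_smul c a

theorem SmoothIn.cr {f g : S → E3} (hf : SmoothIn e f) (hg : SmoothIn e g) :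
    SmoothIn e (fun q => cr (f q) (g q)) :=
  (hf.toQuat.quatMul hg.toQuat).ofQuat.congr fun _ _ => cr_eq_ofQuat _ _

theorem pd_cr {f g : S → E3} (hf : SmoothIn e f) (hg : SmoothIn e g) (hp : p ∈ e.source) :
    pd e i (fun q => NegCurv.cr (f q) (g q)) p =
      NegCurv.cr (pd e i f p) (g p) + NegCurv.cr (f p) (pd e i g p) := by
  simp only [cr_eq_ofQuat]
  rw [pd_ofQuat (hf.toQuat.quatMul hg.toQuat) hp, pd_quatMul hf.toQuat hg.toQuat hp,
    pd_toQuat hf hp, pd_toQuat hg hp, ofQuat_add]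

end

end

/-! ### Fundamental forms under changes of charts; null charts. -/

section

variable {S : Type*} [TopologicalSpace S] [ChartedSpace E2 S]

section Transfer

variable {V : Type*} [NormedAddCommGroup V] [InnerProductSpace ℝ V]
  {e e' : OpenPartialHomeomorph S E2} {p : S} {ψ n : S → V}

/-- The determinant of the first fundamental form. -/
def gramDet (e : OpenPartialHomeomorph S E2) (ψ : S → V) (p : S) : ℝ :=
  firstFF e ψ 0 0 p * firstFF e ψ 1 1 p - firstFF e ψ 0 1 p * firstFF e ψ 1 0 p

/-- The determinant of the second fundamental form. -/
def secondDet (e : OpenPartialHomeomorph S E2) (ψ n : S → V) (p : S) : ℝ :=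
  secondFF e ψ n 0 0 p * secondFF e ψ n 1 1 p - secondFF e ψ n 0 1 p * secondFF e ψ n 1 0 p

/-- Like `secondDet_change`, this has the square of the Jacobian as factor, so det II = K det I need
only be checked in a covering family of charts. -/
theorem gramDet_change (he : e ∈ IsManifold.maximalAtlas (𝓡 2) ∞ S)
    (he' : e' ∈ IsManifold.maximalAtlas (𝓡 2) ∞ S) (hp : p ∈ e.source) (hp' : p ∈ e'.source)
    (hψ : SmoothIn e ψ) :
    gramDet e' ψ p = (jac e e' 0 0 p * jac e e' 1 1 p - jac e e' 0 1 p * jac e e' 1 0 p) ^ 2 *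
      gramDet e ψ p := by
  simp only [gramDet, firstFF, pd_change he he' hp hp' hψ, inner_add_left, inner_add_right,
    real_inner_smul_left, real_inner_smul_right]
  ring

theorem secondFF_change (he : e ∈ IsManifold.maximalAtlas (𝓡 2) ∞ S)
    (he' : e' ∈ IsManifold.maximalAtlas (𝓡 2) ∞ S) (hp : p ∈ e.source) (hp' : p ∈ e'.source)
    (hψ : SmoothIn e ψ) (hn : SmoothIn e n) (i j : Fin 2) :
    secondFF e' ψ n i j p =
      jac e e' i 0 p * jac e e' j 0 p * secondFF e ψ n 0 0 p
      + jac e e' i 0 p * jac e e' j 1 p * secondFF e ψ n 0 1 p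
      + jac e e' i 1 p * jac e e' j 0 p * secondFF e ψ n 1 0 p
      + jac e e' i 1 p * jac e e' j 1 p * secondFF e ψ n 1 1 p := by
  simp only [secondFF, pd_change he he' hp hp' hψ, pd_change he he' hp hp' hn, inner_add_left,
    inner_add_right, real_inner_smul_left, real_inner_smul_right]
  ring

theorem secondDet_change (he : e ∈ IsManifold.maximalAtlas (𝓡 2) ∞ S)
    (he' : e' ∈ IsManifold.maximalAtlas (𝓡 2) ∞ S) (hp : p ∈ e.source) (hp' : p ∈ e'.source)
    (hψ : SmoothIn e ψ) (hn : SmoothIn e n) :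
    secondDet e' ψ n p =
      (jac e e' 0 0 p * jac e e' 1 1 p - jac e e' 0 1 p * jac e e' 1 0 p) ^ 2 *
        secondDet e ψ n p := by
  simp only [secondDet, secondFF_change he he' hp hp' hψ hn]
  ring

omit [ChartedSpace E2 S] in
theorem linearIndependent_of_gramDet_ne_zero (h : gramDet e ψ p ≠ 0) :
    LinearIndependent ℝ ![pd e 0 ψ p, pd e 1 ψ p] := by
  rw [LinearIndependent.pair_iff]
  intro s t hst
  have h0 : ⟪s • pd e 0 ψ p + t • pd e 1 ψ p, pd e 0 ψ p⟫ = 0 := by rw [hst, inner_zero_left]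
  have h1 : ⟪s • pd e 0 ψ p + t • pd e 1 ψ p, pd e 1 ψ p⟫ = 0 := by rw [hst, inner_zero_left]
  simp only [inner_add_left, real_inner_smul_left] at h0 h1
  simp only [gramDet, firstFF] at h
  constructor
  · refine (mul_eq_zero.mp ?_).resolve_right h
    linear_combination ⟪pd e 1 ψ p, pd e 1 ψ p⟫ * h0 - ⟪pd e 1 ψ p, pd e 0 ψ p⟫ * h1
  · refine (mul_eq_zero.mp ?_).resolve_right h
    linear_combination ⟪pd e 0 ψ p, pd e 0 ψ p⟫ * h1 - ⟪pd e 0 ψ p, pd e 1 ψ p⟫ * h0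

omit [ChartedSpace E2 S] in
/-- The second fundamental form is symmetric. -/
theorem secondFF_symm (hψ : SmoothIn e ψ) (hn : SmoothIn e n)
    (horth : ∀ q ∈ e.source, ∀ i, ⟪n q, pd e i ψ q⟫ = 0) (hp : p ∈ e.source) :
    secondFF e ψ n 1 0 p = secondFF e ψ n 0 1 p := by
  have h : ∀ i j : Fin 2, ⟪n p, pd e i (pd e j ψ) p⟫ + ⟪pd e i n p, pd e j ψ p⟫ = 0 := by
    intro i j
    rw [← pd_inner hn (hψ.pd j) hp, pd_congr (g := fun _ => (0 : ℝ)) hp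
      (fun q hq => horth q hq j), pd_const _ hp]
  have h01 := h 0 1
  have h10 := h 1 0
  rw [pd_comm hψ hp] at h10
  simp only [secondFF]
  linarith

variable {𝒜 : Set (OpenPartialHomeomorph S E2)}

/-- The definitions quantify over the whole maximal atlas, while surfaces are constructed in the
charts of `𝒜`. This lemma and the next two pass from the covering to all charts. -/
theorem isSmoothImmersion_of_covering (h𝒜 : IsCovering 𝒜) (hψ : ∀ e ∈ 𝒜, SmoothIn e ψ)
    (hI : ∀ e ∈ 𝒜, ∀ p ∈ e.source, gramDet e ψ p ≠ 0) : IsSmoothImmersion ψ := by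
  refine ⟨contMDiff_of_smoothIn h𝒜 hψ, fun e' he' p hp' => ?_⟩
  obtain ⟨e, he, hp⟩ := h𝒜.2 p
  refine linearIndependent_of_gramDet_ne_zero ?_
  rw [gramDet_change (h𝒜.1 he) he' hp hp' (hψ e he)]
  exact mul_ne_zero (pow_ne_zero _ (jac_det_ne_zero (h𝒜.1 he) he' hp hp')) (hI e he p hp)

theorem isUnitNormal_of_covering (h𝒜 : IsCovering 𝒜) (hψ : ∀ e ∈ 𝒜, SmoothIn e ψ)
    (hn : ∀ e ∈ 𝒜, SmoothIn e n) (h1 : ∀ p, ‖n p‖ = 1)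
    (horth : ∀ e ∈ 𝒜, ∀ p ∈ e.source, ∀ i, ⟪n p, pd e i ψ p⟫ = 0) : IsUnitNormal ψ n := by
  refine ⟨contMDiff_of_smoothIn h𝒜 hn, h1, fun e' he' p hp' i => ?_⟩
  obtain ⟨e, he, hp⟩ := h𝒜.2 p
  rw [pd_change (h𝒜.1 he) he' hp hp' (hψ e he), inner_add_right, real_inner_smul_right,
    real_inner_smul_right, horth e he p hp, horth e he p hp]
  simp

theorem hasExtrinsicCurvature_of_covering (h𝒜 : IsCovering 𝒜) (hψ : ∀ e ∈ 𝒜, SmoothIn e ψ)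
    (hn : ∀ e ∈ 𝒜, SmoothIn e n) {K : S → ℝ}
    (hK : ∀ e ∈ 𝒜, ∀ p ∈ e.source, secondDet e ψ n p = K p * gramDet e ψ p) :
    HasExtrinsicCurvature ψ n K := by
  intro e' he' p hp'
  obtain ⟨e, he, hp⟩ := h𝒜.2 p
  change secondDet e' ψ n p = K p * gramDet e' ψ p
  rw [gramDet_change (h𝒜.1 he) he' hp hp' (hψ e he),
    secondDet_change (h𝒜.1 he) he' hp hp' (hψ e he) (hn e he), hK e he p hp]
  ring

/-- All changes of coordinates between charts of `𝒜` preserve both coordinate directions. -/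
def IsDiagonal (𝒜 : Set (OpenPartialHomeomorph S E2)) : Prop :=
  ∀ e ∈ 𝒜, ∀ e' ∈ 𝒜, ∀ p ∈ e.source, p ∈ e'.source → jac e e' 0 1 p = 0 ∧ jac e e' 1 0 p = 0

/-- Null coordinates with positive `II(∂_u, ∂_v)` and equal orientation have the same null
directions, in the same order. -/
theorem isDiagonal_of_isNull (h𝒜 : IsCovering 𝒜) (hψ : ∀ e ∈ 𝒜, SmoothIn e ψ)
    (hn : ∀ e ∈ 𝒜, SmoothIn e n)
    (horth : ∀ e ∈ 𝒜, ∀ p ∈ e.source, ∀ i, ⟪n p, pd e i ψ p⟫ = 0)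
    (hnull : ∀ e ∈ 𝒜, IsNull e ψ n) (hpos : ∀ e ∈ 𝒜, ∀ p ∈ e.source, 0 < secondFF e ψ n 0 1 p)
    (D : OpenPartialHomeomorph S E2 → S → ℝ) (hD : ∀ e ∈ 𝒜, ∀ p ∈ e.source, 0 < D e p)
    (hDchange : ∀ e ∈ 𝒜, ∀ e' ∈ 𝒜, ∀ p ∈ e.source, p ∈ e'.source → D e' p =
      (jac e e' 0 0 p * jac e e' 1 1 p - jac e e' 0 1 p * jac e e' 1 0 p) * D e p) :
    IsDiagonal 𝒜 := by
  intro e he e' he' p hp hp'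
  have hch := secondFF_change (h𝒜.1 he) (h𝒜.1 he') hp hp' (hψ e he) (hn e he)
  have h00 := hch 0 0
  have h11 := hch 1 1
  have h01 := hch 0 1
  rw [(hnull e' he' p hp').1, (hnull e he p hp).1, (hnull e he p hp).2,
    secondFF_symm (hψ e he) (hn e he) (horth e he) hp] at h00
  rw [(hnull e' he' p hp').2, (hnull e he p hp).1, (hnull e he p hp).2,
    secondFF_symm (hψ e he) (hn e he) (horth e he) hp] at h11
  rw [(hnull e he p hp).1, (hnull e he p hp).2,
    secondFF_symm (hψ e he) (hn e he) (horth e he) hp] at h01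
  have hf := hpos e he p hp
  have hf' := hpos e' he' p hp'
  have hd := hD e he p hp
  have hd' := hD e' he' p hp'
  rw [hDchange e he e' he' p hp hp'] at hd'
  -- For the Jacobian with rows (a, b), (c, d), the orientations give ad - bc > 0 and the mixed
  -- coefficients of II give ad + bc > 0. Hence ad > 0, and the null conditions ab = 0 = cd force b
  -- = c = 0.
  have hj := (mul_pos_iff_of_pos_right hd).mp hd'
  have hs : 0 < jac e e' 0 0 p * jac e e' 1 1 p + jac e e' 0 1 p * jac e e' 1 0 p := by
    refine (mul_pos_iff_of_pos_right hf).mp ?_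
    rw [h01] at hf'
    linarith
  have hprod : 0 < jac e e' 0 0 p * jac e e' 1 1 p := by linarith
  have hne0 : jac e e' 0 0 p ≠ 0 := left_ne_zero_of_mul hprod.ne'
  have hne1 : jac e e' 1 1 p ≠ 0 := right_ne_zero_of_mul hprod.ne'
  constructor
  · have : jac e e' 0 1 p * (2 * jac e e' 0 0 p * secondFF e ψ n 0 1 p) = 0 := by linarith
    exact (mul_eq_zero.mp this).resolve_right (by positivity)
  · have : jac e e' 1 0 p * (2 * jac e e' 1 1 p * secondFF e ψ n 0 1 p) = 0 := by linarith
    exact (mul_eq_zero.mp this).resolve_right (by positivity)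

theorem IsDiagonal.pd_eq (h : IsDiagonal 𝒜) (h𝒜 : IsCovering 𝒜) (he : e ∈ 𝒜) (he' : e' ∈ 𝒜)
    (hp : p ∈ e.source) (hp' : p ∈ e'.source) (hψ : SmoothIn e ψ) (i : Fin 2) :
    pd e' i ψ p = jac e e' i i p • pd e i ψ p := by
  rw [pd_change (h𝒜.1 he) (h𝒜.1 he') hp hp' hψ]
  fin_cases i
  · simp [(h e he e' he' p hp hp').1]
  · simp [(h e he e' he' p hp hp').2]

omit [ChartedSpace E2 S] in
/-- Forms whose coefficients are multiples of `du` and `dv` depending on the direction only are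
compatible with diagonal changes of coordinates. -/
theorem IsDiagonal.compat {W : Type*} [AddCommGroup W] [Module ℝ W] (h : IsDiagonal 𝒜)
    (he : e ∈ 𝒜) (he' : e' ∈ 𝒜) (hp : p ∈ e.source) (hp' : p ∈ e'.source)
    {a a' : Fin 2 → W} {i : Fin 2} (ha : a' i = jac e e' i i p • a i) :
    a' i = jac e e' i 0 p • a 0 + jac e e' i 1 p • a 1 := by
  rw [ha]
  fin_cases i
  · simp [(h e he e' he' p hp hp').1]
  · simp [(h e he e' he' p hp hp').2]

end Transfer

end

/-! ### The integrability conditions and left-translated derivatives. -/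

section

variable {S : Type*} [TopologicalSpace S] {e : OpenPartialHomeomorph S E2} {p : S}

/-- The conormal derivative `N × N_i` of a field of unit vectors. -/
def rotPd (e : OpenPartialHomeomorph S E2) (N : S → E3) (i : Fin 2) (q : S) : E3 :=
  cr (N q) (pd e i N q)

theorem SmoothIn.rotPd {N : S → E3} (hN : SmoothIn e N) (i : Fin 2) :
    SmoothIn e (rotPd e N i) := hN.cr (hN.pd i)

theorem inner_self_of_norm_one {x : E3} (h : ‖x‖ = 1) : ⟪x, x⟫ = 1 := by
  rw [real_inner_self_eq_norm_sq, h, one_pow]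

theorem inner_pd_of_norm_one {V : Type*} [NormedAddCommGroup V] [InnerProductSpace ℝ V]
    {N : S → V} (hN : SmoothIn e N) (h1 : ∀ q, ‖N q‖ = 1)
    (hp : p ∈ e.source) (i : Fin 2) : ⟪N p, pd e i N p⟫ = 0 := by
  have h := pd_inner (i := i) hN hN hp
  rw [pd_congr (g := fun _ => (1 : ℝ)) hp
    (fun q _ => by rw [real_inner_self_eq_norm_sq, h1, one_pow]),
    pd_const _ hp, real_inner_comm (N p)] at h
  linarith

theorem pd_rotPd {N : S → E3} (hN : SmoothIn e N) (hp : p ∈ e.source) (i j : Fin 2) :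
    pd e j (rotPd e N i) p =
      cr (pd e j N p) (pd e i N p) + cr (N p) (pd e j (pd e i N) p) :=
  pd_cr hN (hN.pd i) hp

section Integrability

variable {N : S → E3} {k r : S → ℝ}

/-- Used with c = 1 and c = -1, which is why later formulas contain k - (-1). -/
theorem contDiffAt_inv_sub_const {c t : ℝ} (h : t - c ≠ 0) :
    ContDiffAt ℝ ∞ (fun t : ℝ => (t - c)⁻¹) t :=
  (contDiffAt_id.sub contDiffAt_const).inv h

theorem hasDerivAt_inv_sub_const {c t : ℝ} (h : t - c ≠ 0) :
    HasDerivAt (fun t : ℝ => (t - c)⁻¹) (-1 / (t - c) ^ 2) t :=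
  ((hasDerivAt_id t).sub_const c).inv h

/-- The relation between the integrability conditions for surfaces in the 3-sphere and in
Euclidean 3-space with a common Gauss map. -/
theorem closed_eq_smul_flat (hN : SmoothIn e N) (h1 : ∀ q, ‖N q‖ = 1) (hk : SmoothIn e k)
    (hr : SmoothIn e r) (hk0 : ∀ q ∈ e.source, 0 < k q) (hk1 : ∀ q ∈ e.source, k q ≠ 1)
    (hp : p ∈ e.source)
    (hr0 : pd e 0 r p = -(r p * (k p - 1) / (k p * (k p + 1)) * pd e 0 k p))
    (hr1 : pd e 1 r p = -(r p * (k p + 1) / (k p * (k p - 1)) * pd e 1 k p)) :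
    pd e 1 (fun q => r q • rotPd e N 0 q) p - pd e 0 (fun q => -(r q • rotPd e N 1 q)) p =
      (-(r p * (k p ^ 2 - 1) / k p)) •
        (pd e 0 (fun q => -((k q - (-1))⁻¹ • rotPd e N 1 q)) p -
          pd e 1 (fun q => (k q - 1)⁻¹ • rotPd e N 0 q) p +
          (2 : ℝ) • cr ((k p - 1)⁻¹ • rotPd e N 0 p) (-((k p - (-1))⁻¹ • rotPd e N 1 p))) := by
  have hm : ∀ q ∈ e.source, k q - 1 ≠ 0 := fun q hq => sub_ne_zero.mpr (hk1 q hq)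
  have hpl : ∀ q ∈ e.source, k q - (-1) ≠ 0 := fun q hq => by linarith [hk0 q hq]
  have hsa : SmoothIn e (fun q => (k q - 1)⁻¹) :=
    hk.comp_real (φ := fun t => (t - 1)⁻¹) fun q hq => contDiffAt_inv_sub_const (hm q hq)
  have hsb : SmoothIn e (fun q => (k q - (-1))⁻¹) :=
    hk.comp_real (φ := fun t => (t - (-1))⁻¹) fun q hq => contDiffAt_inv_sub_const (hpl q hq)
  have ha : pd e 1 (fun q => (k q - 1)⁻¹) p = -1 / (k p - 1) ^ 2 * pd e 1 k p :=
    pd_comp_real (φ := fun t => (t - 1)⁻¹) hk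
      (fun q hq => contDiffAt_inv_sub_const (hm q hq)) hp (hasDerivAt_inv_sub_const (hm p hp))
  have hb : pd e 0 (fun q => (k q - (-1))⁻¹) p = -1 / (k p - (-1)) ^ 2 * pd e 0 k p :=
    pd_comp_real (φ := fun t => (t - (-1))⁻¹) hk
      (fun q hq => contDiffAt_inv_sub_const (hpl q hq)) hp (hasDerivAt_inv_sub_const (hpl p hp))
  have hX0 := hN.rotPd 0
  have hX1 := hN.rotPd 1
  rw [pd_neg (hr.smul hX1) hp, pd_neg (hsb.smul hX1) hp, pd_smul hr hX0 hp, pd_smul hr hX1 hp,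
    pd_smul hsa hX0 hp, pd_smul hsb hX1 hp, ha, hb, hr0, hr1, pd_rotPd hN hp, pd_rotPd hN hp,
    ← neg_smul, cr_smul_smul, rotPd, rotPd, cr_cr_cr (inner_self_of_norm_one (h1 p))
      (inner_pd_of_norm_one hN h1 hp 0) (inner_pd_of_norm_one hN h1 hp 1),
    pd_comm (i := 1) (j := 0) hN hp, cr_swap (pd e 0 N p)]
  have hkp := (hk0 p hp).ne'
  have hmp := hm p hp
  have hpp : k p + 1 ≠ 0 := by linarith [hk0 p hp]
  simp only [sub_neg_eq_add]
  -- The coefficients of N × N_u, N × N_v, N × N_uv and N_u × N_v are compared. On the left N_u ×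
  -- N_v cancels by antisymmetry; on the right its coefficient 1/(k-1) - 1/(k+1) - 2/(k²-1) is zero.
  -- The two derivative terms match by `hr0` and `hr1`.
  match_scalars <;> field_simp <;> ring

end Integrability

section LeftTranslation

variable {ψ : S → ℍ[ℝ]}

/-- The left translation to the identity of the `i`-th partial derivative of `ψ`. -/
def leftPd (e : OpenPartialHomeomorph S E2) (ψ : S → ℍ[ℝ]) (i : Fin 2) (q : S) : E3 :=
  ofQuat (star (ψ q) * pd e i ψ q)

/-- As ‖ψ‖ is constant, ψ⁻¹ψ_i is purely imaginary, so `ofQuat` loses nothing. -/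
theorem pd_eq_mul_leftPd (hψ : SmoothIn e ψ) (h1 : ∀ q, ‖ψ q‖ = 1) (hp : p ∈ e.source)
    (i : Fin 2) : pd e i ψ p = ψ p * toQuat (leftPd e ψ i p) := by
  have hre : (star (ψ p) * pd e i ψ p).re = 0 := by
    have h2 := inner_pd_of_norm_one hψ h1 hp i
    have h3 : ⟪ψ p * 1, ψ p * (star (ψ p) * pd e i ψ p)⟫ = 0 := by
      rw [mul_one, ← mul_assoc, self_mul_star_of_norm_one (h1 p), one_mul, h2]
    rw [inner_mul_mul (h1 p), Quaternion.inner_def] at h3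
    simp at h3 ⊢
    linarith
  rw [leftPd, toQuat_ofQuat hre, ← mul_assoc, self_mul_star_of_norm_one (h1 p), one_mul]

/-- The Maurer-Cartan equation of a surface in the 3-sphere. -/
theorem leftPd_flat (hψ : SmoothIn e ψ) (h1 : ∀ q, ‖ψ q‖ = 1) (hp : p ∈ e.source) :
    pd e 0 (leftPd e ψ 1) p - pd e 1 (leftPd e ψ 0) p +
      (2 : ℝ) • cr (leftPd e ψ 0 p) (leftPd e ψ 1 p) = 0 := by
  have hd : ∀ i j : Fin 2, pd e j (leftPd e ψ i) p =
      ofQuat (star (pd e j ψ p) * pd e i ψ p + star (ψ p) * pd e j (pd e i ψ) p) := by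
    intro i j
    have := pd_ofQuat (i := j) (hψ.quatStar.quatMul (hψ.pd i)) hp
    rw [pd_quatMul hψ.quatStar (hψ.pd i) hp, pd_quatStar hψ hp] at this
    exact this
  have hs : ∀ i j : Fin 2, star (pd e j ψ p) * pd e i ψ p =
      -(toQuat (leftPd e ψ j p) * toQuat (leftPd e ψ i p)) := by
    intro i j
    rw [pd_eq_mul_leftPd hψ h1 hp, pd_eq_mul_leftPd hψ h1 hp, star_mul, star_toQuat, mul_assoc,
      ← mul_assoc (star (ψ p)), star_mul_self_of_norm_one (h1 p), one_mul, neg_mul]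
  -- The mixed second derivatives cancel, leaving a commutator of imaginary quaternions, which is
  -- twice the cross product.
  rw [hd, hd, hs, hs, pd_comm (i := 1) (j := 0) hψ hp, ofQuat_add, ofQuat_add]
  have h3 := congrArg ofQuat (toQuat_commutator (leftPd e ψ 0 p) (leftPd e ψ 1 p))
  rw [ofQuat_toQuat] at h3
  rw [← h3]
  refine E3_ext ?_ ?_ ?_ <;> simp <;> ring

variable {N : S → E3}

theorem SmoothIn.mul_toQuat (hψ : SmoothIn e ψ) (hN : SmoothIn e N) :
    SmoothIn e (fun q => ψ q * NegCurv.toQuat (N q)) := hψ.quatMul hN.toQuat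

theorem pd_mul_toQuat (hψ : SmoothIn e ψ) (h1 : ∀ q, ‖ψ q‖ = 1) (hN : SmoothIn e N)
    (hp : p ∈ e.source) (i : Fin 2) :
    pd e i (fun q => ψ q * toQuat (N q)) p =
      ψ p * (toQuat (leftPd e ψ i p) * toQuat (N p) + toQuat (pd e i N p)) := by
  rw [pd_quatMul hψ hN.toQuat hp, pd_toQuat hN hp, pd_eq_mul_leftPd hψ h1 hp, mul_add, mul_assoc]

theorem secondFF_eq_of_leftPd (hψ : SmoothIn e ψ) (h1 : ∀ q, ‖ψ q‖ = 1) (hN : SmoothIn e N)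
    (hp : p ∈ e.source) (i j : Fin 2) :
    secondFF e ψ (fun q => ψ q * toQuat (N q)) i j p =
      -⟪pd e i N p, leftPd e ψ j p⟫ + triple (leftPd e ψ i p) (leftPd e ψ j p) (N p) := by
  rw [secondFF, pd_mul_toQuat hψ h1 hN hp, pd_eq_mul_leftPd hψ h1 hp j,
    inner_left_translated (h1 p)]

theorem firstFF_eq_of_leftPd (hψ : SmoothIn e ψ) (h1 : ∀ q, ‖ψ q‖ = 1)
    (hp : p ∈ e.source) (i j : Fin 2) :
    firstFF e ψ i j p = ⟪leftPd e ψ i p, leftPd e ψ j p⟫ := by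
  rw [firstFF, pd_eq_mul_leftPd hψ h1 hp i, pd_eq_mul_leftPd hψ h1 hp j, inner_mul_mul (h1 p),
    inner_toQuat]

theorem inner_normal_eq_of_leftPd (hψ : SmoothIn e ψ) (h1 : ∀ q, ‖ψ q‖ = 1)
    (hp : p ∈ e.source) (i : Fin 2) :
    ⟪ψ p * toQuat (N p), pd e i ψ p⟫ = ⟪N p, leftPd e ψ i p⟫ := by
  rw [pd_eq_mul_leftPd hψ h1 hp i, inner_mul_mul (h1 p), inner_toQuat]

end LeftTranslation

end

/-! ### Logarithmic derivatives; fundamental forms in terms of N. -/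

section

variable {S : Type*} [TopologicalSpace S] {e : OpenPartialHomeomorph S E2} {p : S}

section Logarithms

variable {K : S → ℝ}

omit [TopologicalSpace S] in
theorem sqrt_neg_sq (hK : ∀ q, K q < 0) (q : S) : √(-K q) ^ 2 = -K q :=
  Real.sq_sqrt (by linarith [hK q])

omit [TopologicalSpace S] in
theorem sqrt_neg_pos (hK : ∀ q, K q < 0) (q : S) : 0 < √(-K q) :=
  Real.sqrt_pos.mpr (by linarith [hK q])

omit [TopologicalSpace S] in
theorem sqrt_neg_ne_one (hK : ∀ q, K q < 0) (hK1 : ∀ q, K q ≠ -1) (q : S) : √(-K q) ≠ 1 := by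
  intro h
  have := sqrt_neg_sq hK q
  rw [h] at this
  exact hK1 q (by linarith)

theorem SmoothIn.sqrt_neg (hKs : SmoothIn e K) (hK : ∀ q, K q < 0) :
    SmoothIn e (fun q => √(-K q)) :=
  hKs.neg.comp_real fun q _ => Real.contDiffAt_sqrt (by linarith [hK q])

theorem pd_eq_of_sqrt_neg (hKs : SmoothIn e K) (hK : ∀ q, K q < 0) (hp : p ∈ e.source)
    (i : Fin 2) : pd e i K p = -(2 * √(-K p) * pd e i (fun q => √(-K q)) p) := by
  have hk := hKs.sqrt_neg hK
  rw [pd_congr (g := fun q => -(√(-K q) * √(-K q))) hp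
    (fun q _ => by rw [← sq, sqrt_neg_sq hK, neg_neg]), pd_neg (hk.mul hk) hp, pd_mul hk hk hp]
  ring

/-- The function `log ((c + √(-K))⁴ / (-K))`. -/
def logK (c : ℝ) (K : S → ℝ) (q : S) : ℝ := Real.log ((c + √(-K q)) ^ 4 / (-K q))

/-- For c = -1 the sum c + t may be negative; the fourth power keeps the argument of the logarithm
positive. -/
theorem contDiffAt_log_pow_div {c t : ℝ} (ht : 0 < t) (hc : c + t ≠ 0) :
    ContDiffAt ℝ ∞ (fun t : ℝ => Real.log ((c + t) ^ 4 / t ^ 2)) t := by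
  refine ContDiffAt.log (ContDiffAt.div (by fun_prop) (by fun_prop) (by positivity)) ?_
  positivity

theorem hasDerivAt_log_pow_div {c t : ℝ} (ht : 0 < t) (hc : c + t ≠ 0) :
    HasDerivAt (fun t : ℝ => Real.log ((c + t) ^ 4 / t ^ 2)) (4 / (c + t) - 2 / t) t := by
  have h1 : HasDerivAt (fun t : ℝ => (c + t) ^ 4) (4 * (c + t) ^ 3) t := by
    exact (((hasDerivAt_id t).const_add c).pow 4).congr_deriv (by simp)
  have h2 : HasDerivAt (fun t : ℝ => t ^ 2) (2 * t) t := by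
    simpa using hasDerivAt_pow 2 t
  have h3 : t ^ 2 ≠ 0 := by positivity
  have h4 : (c + t) ^ 4 / t ^ 2 ≠ 0 := by positivity
  refine ((h1.div h2 h3).log h4).congr_deriv ?_
  simp only [Pi.div_apply]
  field_simp

omit [TopologicalSpace S] in
theorem logK_eq (hK : ∀ q, K q < 0) (c : ℝ) (q : S) :
    logK c K q = Real.log ((c + √(-K q)) ^ 4 / √(-K q) ^ 2) := by
  rw [logK, sqrt_neg_sq hK]

theorem SmoothIn.logK (hKs : SmoothIn e K) (hK : ∀ q, K q < 0) {c : ℝ}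
    (hc : ∀ q, c + √(-K q) ≠ 0) : SmoothIn e (logK c K) :=
  ((hKs.sqrt_neg hK).comp_real (φ := fun t => Real.log ((c + t) ^ 4 / t ^ 2)) fun q _ =>
    contDiffAt_log_pow_div (sqrt_neg_pos hK q) (hc q)).congr fun q _ => logK_eq hK c q

theorem pd_logK (hKs : SmoothIn e K) (hK : ∀ q, K q < 0) {c : ℝ}
    (hc : ∀ q, c + √(-K q) ≠ 0) (hp : p ∈ e.source) (i : Fin 2) :
    pd e i (NegCurv.logK c K) p =
      (4 / (c + √(-K p)) - 2 / √(-K p)) * pd e i (fun q => √(-K q)) p := by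
  rw [pd_congr hp (fun q _ => logK_eq hK c q)]
  exact pd_comp_real (φ := fun t => Real.log ((c + t) ^ 4 / t ^ 2)) (hKs.sqrt_neg hK)
    (fun q _ => contDiffAt_log_pow_div (sqrt_neg_pos hK q) (hc q)) hp
    (hasDerivAt_log_pow_div (sqrt_neg_pos hK p) (hc p))

/-- The logarithmic derivative of a curvature `-r⁻²`. -/
theorem pd_log_neg {K' r : S → ℝ} (hr : SmoothIn e r) (hr0 : ∀ q ∈ e.source, r q ≠ 0)
    (hK' : ∀ q ∈ e.source, K' q = -(r q ^ 2)⁻¹) (hp : p ∈ e.source) (i : Fin 2) :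
    pd e i (fun q => Real.log (-K' q)) p = -2 * (pd e i r p / r p) := by
  -- Valid for either sign of r, since `Real.log` is even.
  rw [pd_congr (g := fun q => -2 * Real.log (r q)) hp (fun q hq => by
    rw [hK' q hq, neg_neg, Real.log_inv, Real.log_pow]; push_cast; ring)]
  have h := pd_comp_real (φ := fun t => -2 * Real.log t) (i := i) hr
    (fun q hq => contDiffAt_const.mul (Real.contDiffAt_log.mpr (hr0 q hq))) hp
    ((Real.hasDerivAt_log (hr0 p hp)).const_mul (-2))
  rw [h]
  field_simp

omit [TopologicalSpace S] in
theorem one_add_sqrt_ne_zero (hK : ∀ q, K q < 0) (q : S) : 1 + √(-K q) ≠ 0 := by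
  linarith [sqrt_neg_pos hK q]

omit [TopologicalSpace S] in
theorem neg_one_add_sqrt_ne_zero (hK : ∀ q, K q < 0) (hK1 : ∀ q, K q ≠ -1) (q : S) :
    -1 + √(-K q) ≠ 0 := fun h => sqrt_neg_ne_one hK hK1 q (by linarith)

end Logarithms

theorem continuous_sign {f : S → ℝ} [PreconnectedSpace S] (hf : Continuous f) (h0 : ∀ p, f p ≠ 0) :
    (∀ p, 0 < f p) ∨ ∀ p, f p < 0 := by
  by_contra! h
  obtain ⟨⟨a, ha⟩, ⟨b, hb⟩⟩ := h
  obtain ⟨c, hc⟩ := mem_range_of_exists_le_of_exists_ge hf ⟨a, ha⟩ ⟨b, hb⟩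
  exact h0 c hc

variable [ChartedSpace E2 S]

section Euclidean

variable {𝒜 : Set (OpenPartialHomeomorph S E2)} {N ψ' : S → E3} {r : S → ℝ}

omit [ChartedSpace E2 S] in
/-- Fundamental forms of a surface in Euclidean 3-space with `ψ'_u = r N × N_u` and
`ψ'_v = -r N × N_v`. -/
theorem euclidean_fundamental_forms (h1 : ∀ q, ‖N q‖ = 1) (h0 : pd e 0 ψ' p = r p • rotPd e N 0 p)
    (h1' : pd e 1 ψ' p = -(r p • rotPd e N 1 p)) :
    secondFF e ψ' N 0 0 p = 0 ∧ secondFF e ψ' N 1 1 p = 0 ∧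
    secondFF e ψ' N 0 1 p = -(r p * triple (N p) (pd e 0 N p) (pd e 1 N p)) ∧
    secondFF e ψ' N 1 0 p = -(r p * triple (N p) (pd e 0 N p) (pd e 1 N p)) ∧
    triple (pd e 0 ψ' p) (pd e 1 ψ' p) (N p) =
      -(r p ^ 2 * triple (N p) (pd e 0 N p) (pd e 1 N p)) ∧
    (∀ i, ⟪N p, pd e i ψ' p⟫ = 0) ∧
    gramDet e ψ' p = (r p ^ 2 * triple (N p) (pd e 0 N p) (pd e 1 N p)) ^ 2 := by
  have hNN := inner_self_of_norm_one (h1 p)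
  have ht : triple (pd e 0 ψ' p) (pd e 1 ψ' p) (N p) =
      -(r p ^ 2 * triple (N p) (pd e 0 N p) (pd e 1 N p)) := by
    rw [h0, h1', ← neg_smul, triple_smul_smul, rotPd, rotPd, triple_cr_cr hNN]
    ring
  have hperp : ∀ i, ⟪N p, pd e i ψ' p⟫ = 0 := by
    intro i
    fin_cases i
    · simp [h0, rotPd, inner_smul_right, inner_cr_self]
    · simp [h1', rotPd, inner_smul_right, inner_cr_self]
  have hswap : triple (N p) (pd e 1 N p) (pd e 0 N p) =
      -triple (N p) (pd e 0 N p) (pd e 1 N p) := by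
    simp only [triple_eq]; ring
  refine ⟨?_, ?_, ?_, ?_, ht, hperp, ?_⟩
  · simp [secondFF, h0, rotPd, inner_smul_right, inner_self_cr]
  · simp [secondFF, h1', rotPd, inner_smul_right, inner_self_cr]
  · simp [secondFF, h1', rotPd, inner_smul_right, inner_cr]
  · simp [secondFF, h0, rotPd, inner_smul_right, inner_cr, hswap]
  · have := gram_eq_triple_sq hNN (hperp 0) (hperp 1)
    rw [ht] at this
    simp only [gramDet, firstFF]
    rw [this]; ring

/-- A surface in Euclidean 3-space with `ψ'_u = r N × N_u`, `ψ'_v = -r N × N_v` is an immersion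
with unit normal `N` and extrinsic curvature `-r⁻²`. -/
theorem euclidean_surface (h𝒜 : IsCovering 𝒜) (hN : ∀ e ∈ 𝒜, SmoothIn e N)
    (h1 : ∀ q, ‖N q‖ = 1) (hψ' : ∀ e ∈ 𝒜, SmoothIn e ψ') (hr : ∀ q, r q ≠ 0)
    (hT : ∀ e ∈ 𝒜, ∀ p ∈ e.source, triple (N p) (pd e 0 N p) (pd e 1 N p) ≠ 0)
    (h0 : ∀ e ∈ 𝒜, ∀ p ∈ e.source, pd e 0 ψ' p = r p • rotPd e N 0 p)
    (h1' : ∀ e ∈ 𝒜, ∀ p ∈ e.source, pd e 1 ψ' p = -(r p • rotPd e N 1 p)) :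
    IsSmoothImmersion ψ' ∧ IsUnitNormal ψ' N ∧
      HasExtrinsicCurvature ψ' N (fun q => -(r q ^ 2)⁻¹) := by
  have hff := fun e he p hp => euclidean_fundamental_forms h1 (h0 e he p hp)
    (h1' e he p hp)
  refine ⟨isSmoothImmersion_of_covering h𝒜 hψ' fun e he p hp => ?_,
    isUnitNormal_of_covering h𝒜 hψ' hN h1 fun e he p hp => (hff e he p hp).2.2.2.2.2.1,
    hasExtrinsicCurvature_of_covering h𝒜 hψ' hN fun e he p hp => ?_⟩
  · rw [(hff e he p hp).2.2.2.2.2.2]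
    exact pow_ne_zero _ (mul_ne_zero (pow_ne_zero _ (hr p)) (hT e he p hp))
  · obtain ⟨a, b, c, d, -, -, f⟩ := hff e he p hp
    rw [secondDet, a, b, c, d, f]
    have := hr p
    field_simp
    ring

end Euclidean

section Spherical

variable {𝒜 : Set (OpenPartialHomeomorph S E2)} {N : S → E3} {ψ : S → ℍ[ℝ]} {k : S → ℝ}

omit [ChartedSpace E2 S] in
/-- Fundamental forms of a surface in the 3-sphere with `ψ⁻¹ψ_u = (k - 1)⁻¹ N × N_u` and
`ψ⁻¹ψ_v = -(k + 1)⁻¹ N × N_v`. -/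
theorem spherical_fundamental_forms (hψ : SmoothIn e ψ) (hψ1 : ∀ q, ‖ψ q‖ = 1)
    (hN : SmoothIn e N) (h1 : ∀ q, ‖N q‖ = 1) (hp : p ∈ e.source) (hk : k p - 1 ≠ 0)
    (hk' : k p - (-1) ≠ 0) (h0 : leftPd e ψ 0 p = (k p - 1)⁻¹ • rotPd e N 0 p)
    (h1' : leftPd e ψ 1 p = -((k p - (-1))⁻¹ • rotPd e N 1 p)) {D : ℝ}
    (hD : D = triple (leftPd e ψ 0 p) (leftPd e ψ 1 p) (N p)) :
    secondFF e ψ (fun q => ψ q * toQuat (N q)) 0 0 p = 0 ∧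
    secondFF e ψ (fun q => ψ q * toQuat (N q)) 1 1 p = 0 ∧
    secondFF e ψ (fun q => ψ q * toQuat (N q)) 0 1 p = k p * D ∧
    secondFF e ψ (fun q => ψ q * toQuat (N q)) 1 0 p = k p * D ∧
    triple (N p) (pd e 0 N p) (pd e 1 N p) = -((k p ^ 2 - 1) * D) ∧
    (∀ i, ⟪ψ p * toQuat (N p), pd e i ψ p⟫ = 0) ∧
    gramDet e ψ p = D ^ 2 := by
  have hNN := inner_self_of_norm_one (h1 p)
  set T := triple (N p) (pd e 0 N p) (pd e 1 N p) with hTdef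
  -- The triples (N × N_u, N × N_v, N) and (N, N_u, N_v) have equal determinants, so only the scalar
  -- factors of w_u and w_v remain.
  have ht : D = -((k p - 1)⁻¹ * (k p - (-1))⁻¹ * T) := by
    rw [hD, h0, h1', ← neg_smul, triple_smul_smul, rotPd, rotPd, triple_cr_cr hNN]
    ring
  have hperp : ∀ i, ⟪N p, leftPd e ψ i p⟫ = 0 := by
    intro i
    fin_cases i
    · simp [h0, rotPd, inner_smul_right, inner_cr_self]
    · simp [h1', rotPd, inner_smul_right, inner_cr_self]
  have hswap : triple (N p) (pd e 1 N p) (pd e 0 N p) = -T := by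
    simp only [hTdef, triple_eq]; ring
  have hself : ∀ a b : E3, triple a a b = 0 := fun a b => by simp only [triple_eq]; ring
  have hT : T = -((k p ^ 2 - 1) * D) := by
    rw [ht]; field_simp; ring
  refine ⟨?_, ?_, ?_, ?_, hT, ?_, ?_⟩
  · rw [secondFF_eq_of_leftPd hψ hψ1 hN hp, hself, h0, rotPd, inner_smul_right, inner_self_cr]
    simp
  · rw [secondFF_eq_of_leftPd hψ hψ1 hN hp, hself, h1', rotPd, inner_neg_right, inner_smul_right,
      inner_self_cr]
    simp
  · rw [secondFF_eq_of_leftPd hψ hψ1 hN hp, ← hD, h1', rotPd, inner_neg_right, inner_smul_right,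
      inner_cr, ← hTdef, ht]
    field_simp
    ring
  · rw [secondFF_eq_of_leftPd hψ hψ1 hN hp, triple_swap, ← hD, h0, rotPd, inner_smul_right,
      inner_cr, hswap, ht]
    field_simp
    ring
  · intro i
    rw [inner_normal_eq_of_leftPd hψ hψ1 hp, hperp]
  · have := gram_eq_triple_sq hNN (hperp 0) (hperp 1)
    rw [← hD] at this
    rw [gramDet, firstFF_eq_of_leftPd hψ hψ1 hp, firstFF_eq_of_leftPd hψ hψ1 hp,
      firstFF_eq_of_leftPd hψ hψ1 hp, firstFF_eq_of_leftPd hψ hψ1 hp, this]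

end Spherical

end

/-! ### From the 3-sphere to Euclidean 3-space. -/

section

variable {S : Type*} [TopologicalSpace S] [ChartedSpace E2 S]
  {𝒜 : Set (OpenPartialHomeomorph S E2)}

section Common

variable {V : Type*} [NormedAddCommGroup V] [InnerProductSpace ℝ V] {ψ n : S → V} {K : S → ℝ}

omit [ChartedSpace E2 S] in
theorem SmoothIn.firstFF {e : OpenPartialHomeomorph S E2} (hψ : SmoothIn e ψ) (i j : Fin 2) :
    SmoothIn e (firstFF e ψ i j) := (hψ.pd i).inner (hψ.pd j)

omit [ChartedSpace E2 S] in
theorem SmoothIn.secondFF {e : OpenPartialHomeomorph S E2} (hψ : SmoothIn e ψ)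
    (hn : SmoothIn e n) (i j : Fin 2) :
    SmoothIn e (secondFF e ψ n i j) := ((hn.pd i).inner (hψ.pd j)).neg

/-- The extrinsic curvature is smooth where the second fundamental form is non-degenerate. -/
theorem smoothIn_curvature {e : OpenPartialHomeomorph S E2}
    (he : e ∈ IsManifold.maximalAtlas (𝓡 2) ∞ S) (hψ : SmoothIn e ψ) (hn : SmoothIn e n)
    (hK : HasExtrinsicCurvature ψ n K) (hne : ∀ p ∈ e.source, gramDet e ψ p ≠ 0) :
    SmoothIn e K := by
  have h1 : SmoothIn e (gramDet e ψ) :=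
    ((hψ.firstFF 0 0).mul (hψ.firstFF 1 1)).sub ((hψ.firstFF 0 1).mul (hψ.firstFF 1 0))
  have h2 : SmoothIn e (secondDet e ψ n) :=
    ((hψ.secondFF hn 0 0).mul (hψ.secondFF hn 1 1)).sub
      ((hψ.secondFF hn 0 1).mul (hψ.secondFF hn 1 0))
  have h3 : SmoothIn e (fun q => (gramDet e ψ q)⁻¹) :=
    h1.comp_real (φ := fun t => t⁻¹) fun q hq => contDiffAt_inv ℝ (hne q hq)
  -- K = det II / det I, with nonvanishing denominator.
  refine (h2.mul h3).congr fun q hq => ?_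
  have h4 : secondDet e ψ n q = K q * gramDet e ψ q := hK e he q hq
  rw [h4, mul_inv_cancel_right₀ (hne q hq)]

theorem IsDiagonal.rotPd_eq {e e' : OpenPartialHomeomorph S E2} {p : S} {N : S → E3}
    (h : IsDiagonal 𝒜) (h𝒜 : IsCovering 𝒜) (he : e ∈ 𝒜)
    (he' : e' ∈ 𝒜) (hp : p ∈ e.source) (hp' : p ∈ e'.source) (hN : SmoothIn e N) (i : Fin 2) :
    rotPd e' N i p = jac e e' i i p • rotPd e N i p := by
  rw [rotPd, rotPd, h.pd_eq h𝒜 he he' hp hp' hN, ← one_smul ℝ (N p), cr_smul_smul, one_mul,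
    one_smul]

end Common

section Spherical

variable {ψ : S → ℍ[ℝ]} {g : S → OnePoint ℂ}

omit [ChartedSpace E2 S] in
theorem orientS3_eq (e : OpenPartialHomeomorph S E2) (p : S) :
    orientS3 e ψ g p = triple (leftPd e ψ 0 p) (leftPd e ψ 1 p) (normalR3 g p) := rfl

theorem leftPd_change {e e' : OpenPartialHomeomorph S E2}
    (he : e ∈ IsManifold.maximalAtlas (𝓡 2) ∞ S) (he' : e' ∈ IsManifold.maximalAtlas (𝓡 2) ∞ S)
    {p : S} (hp : p ∈ e.source) (hp' : p ∈ e'.source) (hψ : SmoothIn e ψ) (i : Fin 2) :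
    leftPd e' ψ i p = jac e e' i 0 p • leftPd e ψ 0 p + jac e e' i 1 p • leftPd e ψ 1 p := by
  simp only [leftPd, pd_change he he' hp hp' hψ, mul_add, mul_smul_comm, ofQuat_add, ofQuat_smul]

theorem orientS3_change {e e' : OpenPartialHomeomorph S E2}
    (he : e ∈ IsManifold.maximalAtlas (𝓡 2) ∞ S) (he' : e' ∈ IsManifold.maximalAtlas (𝓡 2) ∞ S)
    {p : S} (hp : p ∈ e.source) (hp' : p ∈ e'.source) (hψ : SmoothIn e ψ) :
    orientS3 e' ψ g p =
      (jac e e' 0 0 p * jac e e' 1 1 p - jac e e' 0 1 p * jac e e' 1 0 p) * orientS3 e ψ g p := by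
  rw [orientS3_eq, orientS3_eq, leftPd_change he he' hp hp' hψ, leftPd_change he he' hp hp' hψ,
    triple_comb]

theorem orientR3_change {ψ : S → E3} {e e' : OpenPartialHomeomorph S E2}
    (he : e ∈ IsManifold.maximalAtlas (𝓡 2) ∞ S) (he' : e' ∈ IsManifold.maximalAtlas (𝓡 2) ∞ S)
    {p : S} (hp : p ∈ e.source) (hp' : p ∈ e'.source) (hψ : SmoothIn e ψ) :
    orientR3 e' ψ g p =
      (jac e e' 0 0 p * jac e e' 1 1 p - jac e e' 0 1 p * jac e e' 1 0 p) * orientR3 e ψ g p := by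
  rw [orientR3, orientR3, pd_change he he' hp hp' hψ, pd_change he he' hp hp' hψ, triple_comb]

-- Smoothness is only known for the field ψN along ψ; multiplying by the conjugate of ψ recovers N.
omit [ChartedSpace E2 S] in
theorem smoothIn_of_normalS3 {e : OpenPartialHomeomorph S E2} (hψ : SmoothIn e ψ)
    (hψ1 : ∀ q, ‖ψ q‖ = 1) (hn : SmoothIn e (normalS3 ψ g)) : SmoothIn e (normalR3 g) := by
  refine (hψ.quatStar.quatMul hn).ofQuat.congr fun q _ => ?_
  rw [normalS3, ← mul_assoc, star_mul_self_of_norm_one (hψ1 q), one_mul, ofQuat_toQuat]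
  rfl

/-- In null coordinates, the left-translated partial derivatives of a surface in the 3-sphere are
determined by the Gauss map and the extrinsic curvature. -/
theorem leftPd_of_isNull {e : OpenPartialHomeomorph S E2}
    (he : e ∈ IsManifold.maximalAtlas (𝓡 2) ∞ S) (hψ : SmoothIn e ψ) (hψ1 : ∀ q, ‖ψ q‖ = 1)
    (hn : SmoothIn e (normalS3 ψ g)) (horth : ∀ q ∈ e.source, ∀ i, ⟪normalS3 ψ g q, pd e i ψ q⟫ = 0)
    {K : S → ℝ} (hK : HasExtrinsicCurvature ψ (normalS3 ψ g) K) (hKneg : ∀ q, K q < 0)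
    (hK1 : ∀ q, K q ≠ -1)
    (hnull : IsNull e ψ (normalS3 ψ g)) {p : S} (hp : p ∈ e.source)
    (hf : 0 < secondFF e ψ (normalS3 ψ g) 0 1 p) (hD : 0 < orientS3 e ψ g p) :
    leftPd e ψ 0 p = (√(-K p) - 1)⁻¹ • rotPd e (normalR3 g) 0 p ∧
      leftPd e ψ 1 p = -((√(-K p) - (-1))⁻¹ • rotPd e (normalR3 g) 1 p) := by
  have hN := smoothIn_of_normalS3 hψ hψ1 hn
  have hN1 : ∀ q, ‖normalR3 g q‖ = 1 := fun q => norm_invStereo _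
  have hNN := inner_self_of_norm_one (hN1 p)
  have hperp : ∀ i, ⟪normalR3 g p, leftPd e ψ i p⟫ = 0 := fun i => by
    rw [← inner_normal_eq_of_leftPd hψ hψ1 hp]; exact horth p hp i
  have hII : ∀ i j, secondFF e ψ (normalS3 ψ g) i j p =
      -⟪pd e i (normalR3 g) p, leftPd e ψ j p⟫ +
        triple (leftPd e ψ i p) (leftPd e ψ j p) (normalR3 g p) :=
    secondFF_eq_of_leftPd hψ hψ1 hN hp
  have hsym := secondFF_symm hψ hn horth hp
  rw [orientS3_eq] at hD
  have hk0 := sqrt_neg_pos hKneg p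
  have hk2 := sqrt_neg_sq hKneg p
  have hk1 := sqrt_neg_ne_one hKneg hK1 p
  set k := √(-K p)
  set D := triple (leftPd e ψ 0 p) (leftPd e ψ 1 p) (normalR3 g p) with hDdef
  -- In null coordinates det II = -f² and det I = D², so f² = k²D²; positivity of f and D selects
  -- the root f = kD.
  have hfD : secondFF e ψ (normalS3 ψ g) 0 1 p = k * D := by
    have h1 := hK e he p hp
    have h2 := gram_eq_triple_sq hNN (hperp 0) (hperp 1)
    rw [firstFF_eq_of_leftPd hψ hψ1 hp, firstFF_eq_of_leftPd hψ hψ1 hp,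
      firstFF_eq_of_leftPd hψ hψ1 hp, firstFF_eq_of_leftPd hψ hψ1 hp, h2, (hnull p hp).1,
      (hnull p hp).2, hsym] at h1
    have h3 : secondFF e ψ (normalS3 ψ g) 0 1 p ^ 2 = (k * D) ^ 2 := by
      rw [mul_pow, hk2]; linear_combination -h1
    exact (pow_left_inj₀ hf.le (by positivity) two_ne_zero).mp h3
  have hself : ∀ a b : E3, triple a a b = 0 := fun a b => by simp only [triple_eq]; ring
  have h00 := hII 0 0
  have h01 := hII 0 1
  have h10 := hII 1 0
  have h11 := hII 1 1
  rw [(hnull p hp).1, hself] at h00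
  rw [(hnull p hp).2, hself] at h11
  rw [hfD] at h01
  rw [hsym, hfD, triple_swap] at h10
  -- The two mixed coefficients give ⟨N_u, w_v⟩ = -(k - 1)D and ⟨N_v, w_u⟩ = -(k + 1)D: exchanging u
  -- and v changes the sign of the determinant term only.
  have e0 := smul_eq_cr (n := pd e 0 (normalR3 g) p) (s := k - 1) hNN (hperp 0) (hperp 1) hD.ne'
    (by linarith) (by linarith)
  have e1 := smul_eq_cr (n := pd e 1 (normalR3 g) p) (s := -(k + 1)) hNN (hperp 1) (hperp 0)
    (by rw [triple_swap]; exact neg_ne_zero.mpr hD.ne')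
    (by linarith) (by rw [triple_swap]; linarith)
  constructor
  · rw [rotPd, ← e0, inv_smul_smul₀ (sub_ne_zero.mpr hk1)]
  · rw [rotPd, ← e1, ← smul_neg, ← neg_smul, neg_neg, sub_neg_eq_add,
      inv_smul_smul₀ (by positivity)]

end Spherical

/-- From the 3-sphere to Euclidean 3-space. -/
theorem exists_euclidean_of_spherical [IsManifold (𝓡 2) ∞ S] [SimplyConnectedSpace S]
    {g : S → OnePoint ℂ} (h𝒜 : IsCovering 𝒜) {ψ : S → ℍ[ℝ]} {K : S → ℝ}
    (hψ : IsImmersionS3 ψ) (hg : IsGaussMapS3 ψ g)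
    (hK : HasExtrinsicCurvature ψ (normalS3 ψ g) K) (hK' : ∀ p, K p < 0 ∧ K p ≠ -1)
    (hnull : ∀ e ∈ 𝒜, IsNull e ψ (normalS3 ψ g) ∧ ∀ p ∈ e.source,
      0 < secondFF e ψ (normalS3 ψ g) 0 1 p ∧ 0 < orientS3 e ψ g p)
    (hcond : ∀ e ∈ 𝒜, CurvatureCondition e K) :
    ∃ (ψ' : S → E3) (K' : S → ℝ),
      IsSmoothImmersion ψ' ∧ IsGaussMapR3 ψ' g ∧ HasExtrinsicCurvature ψ' (normalR3 g) K' ∧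
      ContMDiff (𝓡 2) 𝓘(ℝ, ℝ) ∞ K' ∧ (∀ p, K' p < 0) ∧
      (∀ e ∈ 𝒜, IsNull e ψ' (normalR3 g) ∧ ∀ p ∈ e.source,
        0 < secondFF e ψ' (normalR3 g) 0 1 p ∧ 0 < -(1 + K p) * orientR3 e ψ' g p) ∧
      ∀ e ∈ 𝒜, CurvatureSystem e K K' := by
  obtain ⟨hψ1, hψs, -⟩ := hψ
  obtain ⟨hns, -, horth⟩ := hg
  have hKneg : ∀ q, K q < 0 := fun q => (hK' q).1
  have hK1 : ∀ q, K q ≠ -1 := fun q => (hK' q).2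
  have sψ : ∀ e ∈ 𝒜, SmoothIn e ψ := fun e he => smoothIn_of_contMDiff hψs (h𝒜.1 he)
  have sn : ∀ e ∈ 𝒜, SmoothIn e (normalS3 ψ g) := fun e he => smoothIn_of_contMDiff hns (h𝒜.1 he)
  have sN : ∀ e ∈ 𝒜, SmoothIn e (normalR3 g) := fun e he =>
    smoothIn_of_normalS3 (sψ e he) hψ1 (sn e he)
  have hN1 : ∀ q, ‖normalR3 g q‖ = 1 := fun q => norm_invStereo _
  have ho : ∀ e ∈ 𝒜, ∀ p ∈ e.source, ∀ i, ⟪normalS3 ψ g p, pd e i ψ p⟫ = 0 :=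
    fun e he => horth e (h𝒜.1 he)
  have hw := fun e he p hp => leftPd_of_isNull (h𝒜.1 he) (sψ e he) hψ1 (sn e he) (ho e he) hK
    hKneg hK1 (hnull e he).1 (p := p) hp ((hnull e he).2 p hp).1 ((hnull e he).2 p hp).2
  have hk0 := sqrt_neg_pos hKneg
  have hk2 := sqrt_neg_sq hKneg
  have hkm : ∀ q, √(-K q) - 1 ≠ 0 := fun q => sub_ne_zero.mpr (sqrt_neg_ne_one hKneg hK1 q)
  have hkp : ∀ q, √(-K q) - (-1) ≠ 0 := fun q => by linarith [hk0 q]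
  have hsf := fun e he p hp => spherical_fundamental_forms (k := fun q => √(-K q)) (sψ e he) hψ1
    (sN e he) hN1 (p := p) hp (hkm p) (hkp p) (hw e he p hp).1 (hw e he p hp).2
    (orientS3_eq (g := g) e p)
  have sK : ∀ e ∈ 𝒜, SmoothIn e K := fun e he =>
    smoothIn_curvature (h𝒜.1 he) (sψ e he) (sn e he) hK fun p hp => by
      rw [(hsf e he p hp).2.2.2.2.2.2]
      exact pow_ne_zero _ ((hnull e he).2 p hp).2.ne'
  have sk : ∀ e ∈ 𝒜, SmoothIn e (fun q => √(-K q)) := fun e he => (sK e he).sqrt_neg hKneg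
  have hc0 := one_add_sqrt_ne_zero hKneg
  have hc1 := neg_one_add_sqrt_ne_zero hKneg hK1
  have hdiag : IsDiagonal 𝒜 := isDiagonal_of_isNull h𝒜 sψ sn ho (fun e he => (hnull e he).1)
    (fun e he p hp => ((hnull e he).2 p hp).1) (fun e p => orientS3 e ψ g p)
    (fun e he p hp => ((hnull e he).2 p hp).2)
    (fun e he e' he' p hp hp' => orientS3_change (h𝒜.1 he) (h𝒜.1 he') hp hp' (sψ e he))
  -- The constants added to √(-K) in the u- and v-equations of (1).
  set c : Fin 2 → ℝ := ![1, -1]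
  have hc_zero : c 0 = 1 := rfl
  have hc_one : c 1 = -1 := rfl
  have hc : ∀ i q, c i + √(-K q) ≠ 0 := by
    intro i q
    fin_cases i
    · exact hc0 q
    · exact hc1 q
  -- the factor `r`
  obtain ⟨r₀, hr₀, hr₀'⟩ := exists_real_solution h𝒜
    (fun e i q => (-(1 / 2 : ℝ)) • pd e i (logK (c i) K) q)
    (fun e he i => (SmoothIn.const _).smul (((sK e he).logK hKneg (hc i)).pd i))
    (fun e he p hp => by
      have s0 := (sK e he).logK hKneg (hc 0)
      have s1 := (sK e he).logK hKneg (hc 1)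
      rw [pd_smul (SmoothIn.const _) (s1.pd 1) hp, pd_smul (SmoothIn.const _) (s0.pd 0) hp,
        pd_const _ hp, pd_const _ hp, pd_comm s1 hp, zero_smul, zero_smul, add_zero, add_zero,
        ← sub_eq_zero, ← smul_sub, ← pd_sub (s1.pd 0) (s0.pd 0) hp]
      have h := hcond e he p hp
      -- Up to sign, the quantity in the curvature condition is the difference of the u-derivatives
      -- of the two logarithms. Its vanishing v-derivative is therefore the compatibility of the
      -- system for r.
      have heq : ∀ q ∈ e.source, -4 * pd e 0 K q / (√(-K q) * (1 + K q)) =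
          -(pd e 0 (logK (c 1) K) q - pd e 0 (logK (c 0) K) q) := by
        intro q hq
        rw [pd_logK (sK e he) hKneg (hc 1) hq, pd_logK (sK e he) hKneg (hc 0) hq,
          pd_eq_of_sqrt_neg (sK e he) hKneg hq]
        have a := hc0 q
        have b := hc1 q
        have d := (hk0 q).ne'
        have f : 1 + K q = -((1 + √(-K q)) * (-1 + √(-K q))) := by linear_combination hk2 q
        rw [f]
        simp only [hc_zero, hc_one]
        field_simp
        ring
      rw [pd_congr hp heq, pd_neg ((s1.pd 0).sub (s0.pd 0)) hp, neg_eq_zero] at h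
      rw [h, smul_zero])
    (fun e he e' he' p hp hp' i => hdiag.compat he he' hp hp'
      (a := fun i => (-(1 / 2 : ℝ)) • pd e i (logK (c i) K) p)
      (a' := fun i => (-(1 / 2 : ℝ)) • pd e' i (logK (c i) K) p) (by
        rw [hdiag.pd_eq h𝒜 he he' hp hp' ((sK e he).logK hKneg (hc i)), smul_comm]))
  -- The system leaves the sign of r free. It is fixed by r(1 + K) < 0, because the new coefficient
  -- f equals -r(1 + K) times the positive orientation determinant of ψ.
  obtain ⟨r, hrpos, hr'⟩ : ∃ r : S → ℝ, (∀ p, 0 < r p * (-(1 + K p))) ∧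
      ∀ e ∈ 𝒜, SmoothIn e r ∧ ∀ p ∈ e.source, ∀ i,
        pd e i r p = r p * ((-(1 / 2 : ℝ)) • pd e i (logK (c i) K) p) := by
    have hcont : Continuous fun q => r₀ q * (-(1 + K q)) :=
      (contMDiff_of_smoothIn h𝒜 fun e he =>
        (hr₀' e he).1.mul (((SmoothIn.const (1 : ℝ)).add (sK e he)).neg)).continuous
    rcases continuous_sign hcont (fun q => mul_ne_zero (hr₀ q) (fun h => hK1 q (by linarith)))
      with h | h
    · exact ⟨r₀, h, hr₀'⟩
    · refine ⟨fun q => -r₀ q, fun p => by linarith [h p], fun e he =>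
        ⟨(hr₀' e he).1.neg, fun p hp i => ?_⟩⟩
      rw [pd_neg (hr₀' e he).1 hp, (hr₀' e he).2 p hp i, neg_mul]
  have hr : ∀ q, r q ≠ 0 := fun q h => by have := hrpos q; simp [h] at this
  have sr : ∀ e ∈ 𝒜, SmoothIn e r := fun e he => (hr' e he).1
  -- the surface
  have hflat : ∀ e ∈ 𝒜, ∀ p ∈ e.source,
      pd e 0 (fun q => -(r q • rotPd e (normalR3 g) 1 q)) p =
        pd e 1 (fun q => r q • rotPd e (normalR3 g) 0 q) p := by
    intro e he p hp
    have h := closed_eq_smul_flat (k := fun q => √(-K q)) (sN e he) hN1 (sk e he) (sr e he)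
      (fun q _ => hk0 q) (fun q _ => sqrt_neg_ne_one hKneg hK1 q) hp (by
        rw [(hr' e he).2 p hp 0, pd_logK (sK e he) hKneg (hc 0) hp]
        have a := hc0 p
        have a' : √(-K p) + 1 ≠ 0 := by rwa [add_comm]
        have d := (hk0 p).ne'
        simp only [hc_zero, smul_eq_mul]
        field_simp
        ring) (by
        rw [(hr' e he).2 p hp 1, pd_logK (sK e he) hKneg (hc 1) hp]
        have b := hc1 p
        have b' := hkm p
        have d := (hk0 p).ne'
        simp only [hc_one, smul_eq_mul]
        field_simp
        ring)
    -- The given surface satisfies Maurer-Cartan, so the proportional defect of closedness vanishes.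
    have hfl := leftPd_flat (sψ e he) hψ1 hp
    rw [pd_congr hp (fun q hq => (hw e he q hq).2), pd_congr hp (fun q hq => (hw e he q hq).1),
      (hw e he p hp).1, (hw e he p hp).2] at hfl
    rw [hfl, smul_zero, sub_eq_zero] at h
    exact h.symm
  obtain ⟨ψ', hψ'⟩ := exists_E3_primitive h𝒜
    (fun e => ![fun q => r q • rotPd e (normalR3 g) 0 q, fun q => -(r q • rotPd e (normalR3 g) 1 q)])
    (fun e he i => by
      fin_cases i
      · exact (sr e he).smul ((sN e he).rotPd 0)
      · exact ((sr e he).smul ((sN e he).rotPd 1)).neg)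
    hflat
    (fun e he e' he' p hp hp' i => hdiag.compat he he' hp hp' (i := i)
      (a := fun i => (![fun q => r q • rotPd e (normalR3 g) 0 q,
        fun q => -(r q • rotPd e (normalR3 g) 1 q)] : Fin 2 → S → E3) i p)
      (a' := fun i => (![fun q => r q • rotPd e' (normalR3 g) 0 q,
        fun q => -(r q • rotPd e' (normalR3 g) 1 q)] : Fin 2 → S → E3) i p) (by
        fin_cases i
        · change r p • rotPd e' (normalR3 g) 0 p = jac e e' 0 0 p • (r p • rotPd e (normalR3 g) 0 p)
          rw [hdiag.rotPd_eq h𝒜 he he' hp hp' (sN e he), smul_comm]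
        · change -(r p • rotPd e' (normalR3 g) 1 p) = jac e e' 1 1 p • (-(r p • rotPd e (normalR3 g) 1 p))
          rw [hdiag.rotPd_eq h𝒜 he he' hp hp' (sN e he), smul_comm, smul_neg]))
  have hT : ∀ e ∈ 𝒜, ∀ p ∈ e.source, triple (normalR3 g p) (pd e 0 (normalR3 g) p)
      (pd e 1 (normalR3 g) p) = (1 + K p) * orientS3 e ψ g p := by
    intro e he p hp
    rw [(hsf e he p hp).2.2.2.2.1, hk2]
    ring
  have hT0 : ∀ e ∈ 𝒜, ∀ p ∈ e.source, triple (normalR3 g p) (pd e 0 (normalR3 g) p)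
      (pd e 1 (normalR3 g) p) ≠ 0 := by
    intro e he p hp
    rw [hT e he p hp]
    exact mul_ne_zero (fun h => hK1 p (by linarith)) ((hnull e he).2 p hp).2.ne'
  have h0 : ∀ e ∈ 𝒜, ∀ p ∈ e.source, pd e 0 ψ' p = r p • rotPd e (normalR3 g) 0 p :=
    fun e he p hp => (hψ' e he).2 p hp 0
  have h1 : ∀ e ∈ 𝒜, ∀ p ∈ e.source, pd e 1 ψ' p = -(r p • rotPd e (normalR3 g) 1 p) :=
    fun e he p hp => (hψ' e he).2 p hp 1
  obtain ⟨r1, r2, r3⟩ := euclidean_surface h𝒜 sN hN1 (fun e he => (hψ' e he).1) hr hT0 h0 h1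
  refine ⟨ψ', fun q => -(r q ^ 2)⁻¹, r1, r2, r3, ?_, fun p => ?_, fun e he => ⟨fun p hp => ?_,
    fun p hp => ?_⟩, fun e he p hp => ?_⟩
  · refine contMDiff_of_smoothIn h𝒜 fun e he => ?_
    exact (sr e he).comp_real (φ := fun t => -(t ^ 2)⁻¹) fun q _ =>
      ((contDiffAt_id.pow 2).inv (pow_ne_zero 2 (hr q))).neg
  · have := hr p
    have : 0 < (r p ^ 2)⁻¹ := by positivity
    linarith
  · obtain ⟨a, b, -⟩ := euclidean_fundamental_forms hN1 (h0 e he p hp) (h1 e he p hp)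
    exact ⟨a, b⟩
  · obtain ⟨-, -, a, -, b, -⟩ := euclidean_fundamental_forms hN1 (h0 e he p hp) (h1 e he p hp)
    rw [a, show orientR3 e ψ' g p = triple (pd e 0 ψ' p) (pd e 1 ψ' p) (normalR3 g p) from rfl, b,
      hT e he p hp]
    have hD := ((hnull e he).2 p hp).2
    constructor
    · have := mul_pos (hrpos p) hD
      linarith
    -- The Euclidean orientation determinant is -r²(1 + K) times the spherical one, so multiplying
    -- it by -(1 + K) produces this square.
    · have h2 : (r p * (1 + K p)) ^ 2 * orientS3 e ψ g p > 0 := by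
        have : r p * (1 + K p) ≠ 0 := fun h => by have := hrpos p; linarith
        positivity
      linarith
  · have hlog := fun i => pd_log_neg (K' := fun q => -(r q ^ 2)⁻¹) (sr e he) (fun q _ => hr q)
      (fun q _ => rfl) hp i
    have hd := hr p
    refine ⟨?_, ?_⟩
    · rw [hlog 0, (hr' e he).2 p hp 0]
      change pd e 0 (logK (c 0) K) p = _
      simp only [smul_eq_mul]
      field_simp
    · rw [hlog 1, (hr' e he).2 p hp 1]
      change pd e 1 (logK (c 1) K) p = _
      simp only [smul_eq_mul]
      field_simp

end

/-! ### From Euclidean 3-space to the 3-sphere. -/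

section

variable {S : Type*} [TopologicalSpace S] [ChartedSpace E2 S]
  {𝒜 : Set (OpenPartialHomeomorph S E2)}

/-- In null coordinates, the partial derivatives of a surface in Euclidean 3-space are determined
by the Gauss map and the extrinsic curvature. -/
theorem pd_of_isNull {ψ' N : S → E3} {e : OpenPartialHomeomorph S E2}
    (he : e ∈ IsManifold.maximalAtlas (𝓡 2) ∞ S) (hψ : SmoothIn e ψ') (hN : SmoothIn e N)
    (hN1 : ∀ q, ‖N q‖ = 1) (horth : ∀ q ∈ e.source, ∀ i, ⟪N q, pd e i ψ' q⟫ = 0)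
    {K' : S → ℝ} (hK : HasExtrinsicCurvature ψ' N K') (hKneg : ∀ q, K' q < 0)
    (hnull : IsNull e ψ' N) {ε : ℝ} (hε : ε = 1 ∨ ε = -1) {p : S} (hp : p ∈ e.source)
    (hf : 0 < secondFF e ψ' N 0 1 p)
    (hD : 0 < ε * triple (pd e 0 ψ' p) (pd e 1 ψ' p) (N p)) :
    pd e 0 ψ' p = (ε * (√(-K' p))⁻¹) • rotPd e N 0 p ∧
      pd e 1 ψ' p = -((ε * (√(-K' p))⁻¹) • rotPd e N 1 p) := by
  have hNN := inner_self_of_norm_one (hN1 p)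
  have hperp := horth p hp
  have hsym := secondFF_symm hψ hN horth hp
  have hk0 := sqrt_neg_pos hKneg p
  have hk2 := sqrt_neg_sq hKneg p
  have hεε : ε * ε = 1 := by rcases hε with rfl | rfl <;> norm_num
  have hεne : ε ≠ 0 := left_ne_zero_of_mul_eq_one hεε
  set k := √(-K' p)
  set D := triple (pd e 0 ψ' p) (pd e 1 ψ' p) (N p) with hDdef
  have hDne : D ≠ 0 := right_ne_zero_of_mul hD.ne'
  have hfD : secondFF e ψ' N 0 1 p = k * (ε * D) := by
    have h1 : secondDet e ψ' N p = K' p * gramDet e ψ' p := hK e he p hp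
    have h2 : gramDet e ψ' p = D ^ 2 := gram_eq_triple_sq hNN (hperp 0) (hperp 1)
    rw [secondDet, h2, (hnull p hp).1, (hnull p hp).2, hsym] at h1
    have h3 : secondFF e ψ' N 0 1 p ^ 2 = (k * (ε * D)) ^ 2 := by
      rw [mul_pow, mul_pow, hk2, sq ε, hεε]; linear_combination -h1
    exact (pow_left_inj₀ hf.le (by positivity) two_ne_zero).mp h3
  have h00 := (hnull p hp).1
  have h11 := (hnull p hp).2
  have h01 := hfD
  have h10 := hsym.trans hfD
  rw [secondFF] at h00 h01 h10 h11
  -- Without the determinant term, both directions have the same factor kε up to sign, and ε absorbs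
  -- the orientation.
  have e0 := smul_eq_cr (n := pd e 0 N p) (s := k * ε) hNN (hperp 0) (hperp 1) hDne
    (by linarith) (by rw [← hDdef]; linarith)
  have e1 := smul_eq_cr (n := pd e 1 N p) (s := -(k * ε)) hNN (hperp 1) (hperp 0)
    (by rw [triple_swap]; exact neg_ne_zero.mpr hDne)
    (by linarith) (by rw [triple_swap, ← hDdef]; linarith)
  have hinv : ε * k⁻¹ * (k * ε) = 1 := by
    field_simp
    linarith
  constructor
  · rw [rotPd, ← e0, smul_smul, hinv, one_smul]
  · rw [rotPd, ← e1, neg_smul, smul_neg, neg_neg, smul_smul, hinv, one_smul]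

omit [ChartedSpace E2 S] in
theorem inner_self_mul_toQuat (x : ℍ[ℝ]) (w : E3) : ⟪x, x * toQuat w⟫ = 0 := by
  rw [Quaternion.inner_def]
  simp
  ring

/-- Integration of the Maurer-Cartan equation in the group of unit quaternions. -/
theorem exists_unit_quaternion_solution [SimplyConnectedSpace S] (h𝒜 : IsCovering 𝒜)
    (w : OpenPartialHomeomorph S E2 → Fin 2 → S → E3)
    (hw : ∀ e ∈ 𝒜, ∀ i, SmoothIn e (w e i))
    (hflat : ∀ e ∈ 𝒜, ∀ p ∈ e.source,
      pd e 0 (w e 1) p - pd e 1 (w e 0) p + (2 : ℝ) • cr (w e 0 p) (w e 1 p) = 0)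
    (hcompat : ∀ e ∈ 𝒜, ∀ e' ∈ 𝒜, ∀ p ∈ e.source, p ∈ e'.source → ∀ i,
      w e' i p = jac e e' i 0 p • w e 0 p + jac e e' i 1 p • w e 1 p) :
    ∃ ψ : S → ℍ[ℝ], (∀ q, ‖ψ q‖ = 1) ∧ ∀ e ∈ 𝒜, SmoothIn e ψ ∧
      ∀ p ∈ e.source, ∀ i, leftPd e ψ i p = w e i p := by
  obtain ⟨Ψ, hΨ⟩ := exists_global_solution_of_coeffs h𝒜 (fun e i q => toQuat (w e i q))
    (fun e he i => (hw e he i).toQuat)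
    (fun e he p hp => by
      have h1 : pd e 0 (fun q => toQuat (w e 1 q)) p - pd e 1 (fun q => toQuat (w e 0 q)) p +
          (toQuat (w e 0 p) * toQuat (w e 1 p) - toQuat (w e 1 p) * toQuat (w e 0 p)) = 0 := by
        rw [pd_toQuat (hw e he 1) hp, pd_toQuat (hw e he 0) hp, toQuat_commutator]
        have := congrArg toQuatL (hflat e he p hp)
        rw [map_add, map_sub, map_zero] at this
        exact this
      exact h1)
    (fun e he e' he' p hp hp' i => by
      have := congrArg toQuatL (hcompat e he e' he' p hp hp' i)
      rw [map_add, map_smul, map_smul] at this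
      exact this)
  set F : S → ℍ[ℝ] := fun q => (Ψ q : ℍ[ℝ]) with hF
  have sF : ∀ e ∈ 𝒜, SmoothIn e F := fun e he => (hΨ e he).1
  have hpd : ∀ e ∈ 𝒜, ∀ p ∈ e.source, ∀ i, pd e i F p = F p * toQuat (w e i p) :=
    fun e he => (hΨ e he).2
  have hne : ∀ q, F q ≠ 0 := fun q => (Ψ q).ne_zero
  have hpos : ∀ q, 0 < ⟪F q, F q⟫ := fun q => real_inner_self_pos.mpr (hne q)
  -- The solution takes values in nonzero quaternions. Since F is orthogonal to F times an imaginary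
  -- quaternion, |F| has zero derivative, and normalizing F leaves ψ⁻¹dψ unchanged.
  set m : S → ℝ := fun q => (√⟪F q, F q⟫)⁻¹ with hm
  have hφ : ∀ q, ContDiffAt ℝ ∞ (fun t : ℝ => (√t)⁻¹) ⟪F q, F q⟫ := fun q =>
    (Real.contDiffAt_sqrt (hpos q).ne').inv (Real.sqrt_pos.mpr (hpos q)).ne'
  have sm : ∀ e ∈ 𝒜, SmoothIn e m := fun e he =>
    ((sF e he).inner (sF e he)).comp_real (φ := fun t => (√t)⁻¹) fun q _ => hφ q
  have hmpd : ∀ e ∈ 𝒜, ∀ p ∈ e.source, ∀ i, pd e i m p = 0 := by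
    intro e he p hp i
    have h := pd_comp_real (φ := fun t => (√t)⁻¹) (i := i) ((sF e he).inner (sF e he))
      (fun q _ => hφ q) hp ((hφ p).differentiableAt (by simp)).hasDerivAt
    have h0 : ⟪F p * toQuat (w e i p), F p⟫ = 0 := by
      rw [real_inner_comm, inner_self_mul_toQuat]
    rw [pd_inner (sF e he) (sF e he) hp, hpd e he p hp, inner_self_mul_toQuat, h0,
      add_zero, mul_zero] at h
    exact h
  have hunit : ∀ q, ‖m q • F q‖ = 1 := by
    intro q
    have h1 : m q = ‖F q‖⁻¹ := by rw [hm]; simp only; rw [← norm_eq_sqrt_real_inner]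
    rw [norm_smul, h1, norm_inv, norm_norm, inv_mul_cancel₀ (norm_ne_zero_iff.mpr (hne q))]
  refine ⟨fun q => m q • F q, hunit, fun e he => ⟨(sm e he).smul (sF e he), fun p hp i => ?_⟩⟩
  rw [leftPd, pd_smul (sm e he) (sF e he) hp, hmpd e he p hp, zero_smul, add_zero,
    hpd e he p hp, ← smul_mul_assoc, ← mul_assoc, star_mul_self_of_norm_one (hunit p), one_mul,
    ofQuat_toQuat]

/-- A surface in the 3-sphere with `ψ⁻¹ψ_u = (k - 1)⁻¹ N × N_u` and
`ψ⁻¹ψ_v = -(k + 1)⁻¹ N × N_v` is an immersion with Gauss map `N` and extrinsic curvature `-k²`. -/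
theorem spherical_surface (h𝒜 : IsCovering 𝒜) {ψ : S → ℍ[ℝ]} {g : S → OnePoint ℂ} {K : S → ℝ}
    (hKneg : ∀ q, K q < 0) (hK1 : ∀ q, K q ≠ -1)
    (hN : ∀ e ∈ 𝒜, SmoothIn e (normalR3 g)) (hψ : ∀ e ∈ 𝒜, SmoothIn e ψ)
    (hψ1 : ∀ q, ‖ψ q‖ = 1)
    (hT : ∀ e ∈ 𝒜, ∀ p ∈ e.source,
      triple (normalR3 g p) (pd e 0 (normalR3 g) p) (pd e 1 (normalR3 g) p) ≠ 0)
    (h0 : ∀ e ∈ 𝒜, ∀ p ∈ e.source,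
      leftPd e ψ 0 p = (√(-K p) - 1)⁻¹ • rotPd e (normalR3 g) 0 p)
    (h1 : ∀ e ∈ 𝒜, ∀ p ∈ e.source,
      leftPd e ψ 1 p = -((√(-K p) - (-1))⁻¹ • rotPd e (normalR3 g) 1 p)) :
    IsImmersionS3 ψ ∧ IsGaussMapS3 ψ g ∧ HasExtrinsicCurvature ψ (normalS3 ψ g) K ∧
      ∀ e ∈ 𝒜, IsNull e ψ (normalS3 ψ g) ∧ ∀ p ∈ e.source,
        secondFF e ψ (normalS3 ψ g) 0 1 p = √(-K p) * orientS3 e ψ g p ∧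
        triple (normalR3 g p) (pd e 0 (normalR3 g) p) (pd e 1 (normalR3 g) p) =
          (1 + K p) * orientS3 e ψ g p := by
  have hN1 : ∀ q, ‖normalR3 g q‖ = 1 := fun q => norm_invStereo _
  have hk0 := sqrt_neg_pos hKneg
  have hk2 := sqrt_neg_sq hKneg
  have hkm : ∀ q, √(-K q) - 1 ≠ 0 := fun q => sub_ne_zero.mpr (sqrt_neg_ne_one hKneg hK1 q)
  have hkp : ∀ q, √(-K q) - (-1) ≠ 0 := fun q => by linarith [hk0 q]
  have hsf := fun e he p hp => spherical_fundamental_forms (k := fun q => √(-K q)) (hψ e he) hψ1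
    (hN e he) hN1 (p := p) hp (hkm p) (hkp p) (h0 e he p hp) (h1 e he p hp)
    (orientS3_eq (g := g) e p)
  have hTD : ∀ e ∈ 𝒜, ∀ p ∈ e.source,
      triple (normalR3 g p) (pd e 0 (normalR3 g) p) (pd e 1 (normalR3 g) p) =
        (1 + K p) * orientS3 e ψ g p := by
    intro e he p hp
    rw [(hsf e he p hp).2.2.2.2.1, hk2]
    ring
  have hn : ∀ e ∈ 𝒜, SmoothIn e (normalS3 ψ g) := fun e he => (hψ e he).mul_toQuat (hN e he)
  refine ⟨⟨hψ1, isSmoothImmersion_of_covering h𝒜 hψ fun e he p hp => ?_⟩,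
    isUnitNormal_of_covering h𝒜 hψ hn (fun p => ?_) fun e he p hp => ?_,
    hasExtrinsicCurvature_of_covering h𝒜 hψ hn fun e he p hp => ?_, fun e he =>
    ⟨fun p hp => ⟨(hsf e he p hp).1, (hsf e he p hp).2.1⟩, fun p hp =>
      ⟨(hsf e he p hp).2.2.1, hTD e he p hp⟩⟩⟩
  · rw [(hsf e he p hp).2.2.2.2.2.2]
    have h := hT e he p hp
    rw [hTD e he p hp] at h
    exact pow_ne_zero _ (right_ne_zero_of_mul h)
  · rw [normalS3, norm_mul, hψ1, norm_toQuat, norm_invStereo, one_mul]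
  · exact (hsf e he p hp).2.2.2.2.2.1
  · obtain ⟨a, b, c, d, -, -, f⟩ := hsf e he p hp
    change secondDet e ψ (fun q => ψ q * toQuat (normalR3 g q)) p = _
    rw [secondDet, a, b, c, d, f]
    linear_combination -(orientS3 e ψ g p ^ 2) * hk2 p

/-- From Euclidean 3-space to the 3-sphere. -/
theorem exists_spherical_of_euclidean [IsManifold (𝓡 2) ∞ S] [SimplyConnectedSpace S]
    {g : S → OnePoint ℂ} (h𝒜 : IsCovering 𝒜) {ψ' : S → E3} {K' K : S → ℝ} {ε : ℝ}
    (hε : ε = 1 ∨ ε = -1) (hψ' : IsSmoothImmersion ψ') (hg : IsGaussMapR3 ψ' g)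
    (hK' : HasExtrinsicCurvature ψ' (normalR3 g) K') (hK'neg : ∀ p, K' p < 0)
    (hnull : ∀ e ∈ 𝒜, IsNull e ψ' (normalR3 g) ∧ ∀ p ∈ e.source,
      0 < secondFF e ψ' (normalR3 g) 0 1 p ∧ 0 < ε * orientR3 e ψ' g p)
    (hKs : ContMDiff (𝓡 2) 𝓘(ℝ, ℝ) ∞ K) (hK : ∀ p, K p < 0 ∧ K p ≠ -1)
    (hsys : ∀ e ∈ 𝒜, CurvatureSystem e K K') :
    ∃ ψ : S → ℍ[ℝ],
      IsImmersionS3 ψ ∧ IsGaussMapS3 ψ g ∧ HasExtrinsicCurvature ψ (normalS3 ψ g) K ∧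
      ∀ e ∈ 𝒜, IsNull e ψ (normalS3 ψ g) ∧ ∀ p ∈ e.source,
        0 < -(ε * (1 + K p)) * secondFF e ψ (normalS3 ψ g) 0 1 p ∧
        0 < -(ε * (1 + K p)) * orientS3 e ψ g p := by
  obtain ⟨hNs, hN1, horth⟩ := hg
  have hKneg : ∀ q, K q < 0 := fun q => (hK q).1
  have hK1 : ∀ q, K q ≠ -1 := fun q => (hK q).2
  have sψ' : ∀ e ∈ 𝒜, SmoothIn e ψ' := fun e he => smoothIn_of_contMDiff hψ'.1 (h𝒜.1 he)
  have sN : ∀ e ∈ 𝒜, SmoothIn e (normalR3 g) := fun e he => smoothIn_of_contMDiff hNs (h𝒜.1 he)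
  have sK : ∀ e ∈ 𝒜, SmoothIn e K := fun e he => smoothIn_of_contMDiff hKs (h𝒜.1 he)
  have ho : ∀ e ∈ 𝒜, ∀ p ∈ e.source, ∀ i, ⟪normalR3 g p, pd e i ψ' p⟫ = 0 :=
    fun e he => horth e (h𝒜.1 he)
  have hεε : ε * ε = 1 := by rcases hε with rfl | rfl <;> norm_num
  have hεne : ε ≠ 0 := left_ne_zero_of_mul_eq_one hεε
  -- The factor in ψ'_u = r N × N_u and ψ'_v = -r N × N_v; its sign is the orientation sign.
  set r : S → ℝ := fun q => ε * (√(-K' q))⁻¹ with hrdef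
  have hr : ∀ q, r q ≠ 0 := fun q => mul_ne_zero hεne (inv_ne_zero (sqrt_neg_pos hK'neg q).ne')
  have hK'r : ∀ q, K' q = -(r q ^ 2)⁻¹ := by
    intro q
    rw [hrdef]
    simp only
    rw [mul_pow, sq ε, hεε, one_mul, inv_pow, inv_inv, sqrt_neg_sq hK'neg, neg_neg]
  have hβ := fun e he p hp => pd_of_isNull (h𝒜.1 he) (sψ' e he) (sN e he) hN1 (ho e he) hK' hK'neg
    (hnull e he).1 hε (p := p) hp ((hnull e he).2 p hp).1 ((hnull e he).2 p hp).2
  have hD0 : ∀ e ∈ 𝒜, ∀ p ∈ e.source,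
      triple (pd e 0 ψ' p) (pd e 1 ψ' p) (normalR3 g p) ≠ 0 :=
    fun e he p hp => right_ne_zero_of_mul ((hnull e he).2 p hp).2.ne'
  have hff := fun e he p hp => euclidean_fundamental_forms (r := r) hN1 (hβ e he p hp).1
    (hβ e he p hp).2
  have sK' : ∀ e ∈ 𝒜, SmoothIn e K' := fun e he =>
    smoothIn_curvature (h𝒜.1 he) (sψ' e he) (sN e he) hK' fun p hp => by
      have h := gram_eq_triple_sq (inner_self_of_norm_one (hN1 p)) (ho e he p hp 0) (ho e he p hp 1)
      rw [gramDet]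
      simp only [firstFF]
      rw [h]
      exact pow_ne_zero _ (hD0 e he p hp)
  have sr : ∀ e ∈ 𝒜, SmoothIn e r := fun e he =>
    (SmoothIn.const ε).mul (((sK' e he).sqrt_neg hK'neg).comp_real (φ := fun t => t⁻¹)
      fun q _ => contDiffAt_inv ℝ (sqrt_neg_pos hK'neg q).ne')
  have hdiag : IsDiagonal 𝒜 := isDiagonal_of_isNull h𝒜 sψ' sN ho (fun e he => (hnull e he).1)
    (fun e he p hp => ((hnull e he).2 p hp).1) (fun e p => ε * orientR3 e ψ' g p)
    (fun e he p hp => ((hnull e he).2 p hp).2)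
    (fun e he e' he' p hp hp' => by
      rw [orientR3_change (h𝒜.1 he) (h𝒜.1 he') hp hp' (sψ' e he)]; ring)
  have hk0 := sqrt_neg_pos hKneg
  have hkm : ∀ q, √(-K q) - 1 ≠ 0 := fun q => sub_ne_zero.mpr (sqrt_neg_ne_one hKneg hK1 q)
  have hc0 := one_add_sqrt_ne_zero hKneg
  have hc1 := neg_one_add_sqrt_ne_zero hKneg hK1
  have sk : ∀ e ∈ 𝒜, SmoothIn e (fun q => √(-K q)) := fun e he => (sK e he).sqrt_neg hKneg
  have hflat : ∀ e ∈ 𝒜, ∀ p ∈ e.source,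
      pd e 0 (fun q => -((√(-K q) - (-1))⁻¹ • rotPd e (normalR3 g) 1 q)) p -
        pd e 1 (fun q => (√(-K q) - 1)⁻¹ • rotPd e (normalR3 g) 0 q) p +
        (2 : ℝ) • cr ((√(-K p) - 1)⁻¹ • rotPd e (normalR3 g) 0 p)
          (-((√(-K p) - (-1))⁻¹ • rotPd e (normalR3 g) 1 p)) = 0 := by
    intro e he p hp
    have hlog := fun i => pd_log_neg (sr e he) (fun q _ => hr q) (fun q _ => hK'r q) hp i
    have hs := hsys e he p hp
    have hs0 : pd e 0 (logK 1 K) p = -2 * (pd e 0 r p / r p) := hs.1.trans (hlog 0)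
    have hs1 : pd e 1 (logK (-1) K) p = -2 * (pd e 1 r p / r p) := hs.2.trans (hlog 1)
    rw [pd_logK (sK e he) hKneg hc0 hp] at hs0
    rw [pd_logK (sK e he) hKneg hc1 hp] at hs1
    have a := hc0 p
    have a' : √(-K p) + 1 ≠ 0 := by rwa [add_comm]
    have b := hc1 p
    have b' := hkm p
    have d := (hk0 p).ne'
    have hrp := hr p
    have h := closed_eq_smul_flat (k := fun q => √(-K q)) (sN e he) hN1 (sk e he) (sr e he)
      (fun q _ => hk0 q) (fun q _ => sqrt_neg_ne_one hKneg hK1 q) hp (by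
        have : pd e 0 r p = -(r p / 2) * (-2 * (pd e 0 r p / r p)) := by field_simp
        rw [this, ← hs0]
        field_simp
        ring) (by
        have : pd e 1 r p = -(r p / 2) * (-2 * (pd e 1 r p / r p)) := by field_simp
        rw [this, ← hs1]
        field_simp
        ring)
    -- Closedness holds because the form is dψ'. As r ≠ 0 and k² ≠ 1, the factor of proportionality
    -- can be divided out, which leaves Maurer-Cartan.
    rw [← pd_congr hp (fun q hq => (hβ e he q hq).2), ← pd_congr hp (fun q hq => (hβ e he q hq).1),
      pd_comm (sψ' e he) hp, sub_self] at h
    refine (smul_eq_zero.mp h.symm).resolve_left (neg_ne_zero.mpr (div_ne_zero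
      (mul_ne_zero hrp ?_) d))
    rw [show √(-K p) ^ 2 - 1 = (√(-K p) - 1) * (√(-K p) + 1) by ring]
    exact mul_ne_zero b' a'
  obtain ⟨ψ, hψ1, hψ⟩ := exists_unit_quaternion_solution h𝒜
    (fun e => ![fun q => (√(-K q) - 1)⁻¹ • rotPd e (normalR3 g) 0 q,
      fun q => -((√(-K q) - (-1))⁻¹ • rotPd e (normalR3 g) 1 q)])
    (fun e he i => by
      fin_cases i
      · exact ((sk e he).comp_real (φ := fun t => (t - 1)⁻¹) fun q _ =>
          contDiffAt_inv_sub_const (hkm q)).smul ((sN e he).rotPd 0)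
      · exact (((sk e he).comp_real (φ := fun t => (t - (-1))⁻¹) fun q _ =>
          contDiffAt_inv_sub_const (by linarith [hk0 q])).smul ((sN e he).rotPd 1)).neg)
    hflat
    (fun e he e' he' p hp hp' i => hdiag.compat he he' hp hp' (i := i)
      (a := fun i => (![fun q => (√(-K q) - 1)⁻¹ • rotPd e (normalR3 g) 0 q,
        fun q => -((√(-K q) - (-1))⁻¹ • rotPd e (normalR3 g) 1 q)] : Fin 2 → S → E3) i p)
      (a' := fun i => (![fun q => (√(-K q) - 1)⁻¹ • rotPd e' (normalR3 g) 0 q,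
        fun q => -((√(-K q) - (-1))⁻¹ • rotPd e' (normalR3 g) 1 q)] : Fin 2 → S → E3) i p) (by
        fin_cases i
        · change (√(-K p) - 1)⁻¹ • rotPd e' (normalR3 g) 0 p =
            jac e e' 0 0 p • ((√(-K p) - 1)⁻¹ • rotPd e (normalR3 g) 0 p)
          rw [hdiag.rotPd_eq h𝒜 he he' hp hp' (sN e he), smul_comm]
        · change -((√(-K p) - (-1))⁻¹ • rotPd e' (normalR3 g) 1 p) =
            jac e e' 1 1 p • (-((√(-K p) - (-1))⁻¹ • rotPd e (normalR3 g) 1 p))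
          rw [hdiag.rotPd_eq h𝒜 he he' hp hp' (sN e he), smul_comm, smul_neg]))
  have hDT : ∀ e ∈ 𝒜, ∀ p ∈ e.source, orientR3 e ψ' g p =
      -(r p ^ 2 * triple (normalR3 g p) (pd e 0 (normalR3 g) p) (pd e 1 (normalR3 g) p)) :=
    fun e he p hp => (hff e he p hp).2.2.2.2.1
  have hT0 : ∀ e ∈ 𝒜, ∀ p ∈ e.source, triple (normalR3 g p) (pd e 0 (normalR3 g) p)
      (pd e 1 (normalR3 g) p) ≠ 0 := by
    intro e he p hp h
    have := ((hnull e he).2 p hp).2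
    rw [hDT e he p hp, h] at this
    simp at this
  obtain ⟨c1, c2, c3, c4⟩ := spherical_surface h𝒜 hKneg hK1 sN (fun e he => (hψ e he).1) hψ1 hT0
    (fun e he p hp => (hψ e he).2 p hp 0) (fun e he p hp => (hψ e he).2 p hp 1)
  refine ⟨ψ, c1, c2, c3, fun e he => ⟨(c4 e he).1, fun p hp => ?_⟩⟩
  obtain ⟨hII, hTD⟩ := (c4 e he).2 p hp
  have hD' := ((hnull e he).2 p hp).2
  rw [hDT e he p hp, hTD] at hD'
  -- `hD'` is this product multiplied by the positive number r².
  have hpos : 0 < -(ε * (1 + K p)) * orientS3 e ψ g p := by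
    have hr2 : 0 < r p ^ 2 := by have := hr p; positivity
    refine (mul_pos_iff_of_pos_left hr2).mp ?_
    linarith
  refine ⟨?_, hpos⟩
  rw [hII]
  have := mul_pos (hk0 p) hpos
  linarith

end

end NegCurv

end

theorem proposition4p6 {S : Type*} [TopologicalSpace S] [T2Space S] [SecondCountableTopology S]
    [ChartedSpace NegCurv.E2 S] [IsManifold (𝓡 2) ∞ S] [SimplyConnectedSpace S]
    (g : S → OnePoint ℂ) (𝒜 : Set (OpenPartialHomeomorph S NegCurv.E2))
    (h𝒜 : NegCurv.IsCovering 𝒜) :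
    -- from the 3-sphere to Euclidean 3-space
    (∀ (ψ : S → ℍ[ℝ]) (K : S → ℝ),
      NegCurv.IsImmersionS3 ψ → NegCurv.IsGaussMapS3 ψ g →
      NegCurv.HasExtrinsicCurvature ψ (NegCurv.normalS3 ψ g) K →
      (∀ p, K p < 0 ∧ K p ≠ -1) →
      (∀ e ∈ 𝒜, NegCurv.IsNull e ψ (NegCurv.normalS3 ψ g) ∧ ∀ p ∈ e.source,
        0 < NegCurv.secondFF e ψ (NegCurv.normalS3 ψ g) 0 1 p ∧ 0 < NegCurv.orientS3 e ψ g p) →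
      (∀ e ∈ 𝒜, NegCurv.CurvatureCondition e K) →
      ∃ (ψ' : S → NegCurv.E3) (K' : S → ℝ),
        NegCurv.IsSmoothImmersion ψ' ∧ NegCurv.IsGaussMapR3 ψ' g ∧
        NegCurv.HasExtrinsicCurvature ψ' (NegCurv.normalR3 g) K' ∧
        ContMDiff (𝓡 2) 𝓘(ℝ, ℝ) ∞ K' ∧ (∀ p, K' p < 0) ∧
        (∀ e ∈ 𝒜, NegCurv.IsNull e ψ' (NegCurv.normalR3 g) ∧ ∀ p ∈ e.source,
          0 < NegCurv.secondFF e ψ' (NegCurv.normalR3 g) 0 1 p ∧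
          0 < -(1 + K p) * NegCurv.orientR3 e ψ' g p) ∧
        ∀ e ∈ 𝒜, NegCurv.CurvatureSystem e K K') ∧
    -- from Euclidean 3-space to the 3-sphere
    (∀ (ψ' : S → NegCurv.E3) (K' K : S → ℝ) (ε : ℝ), (ε = 1 ∨ ε = -1) →
      NegCurv.IsSmoothImmersion ψ' → NegCurv.IsGaussMapR3 ψ' g →
      NegCurv.HasExtrinsicCurvature ψ' (NegCurv.normalR3 g) K' →
      (∀ p, K' p < 0) →
      (∀ e ∈ 𝒜, NegCurv.IsNull e ψ' (NegCurv.normalR3 g) ∧ ∀ p ∈ e.source,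
        0 < NegCurv.secondFF e ψ' (NegCurv.normalR3 g) 0 1 p ∧
        0 < ε * NegCurv.orientR3 e ψ' g p) →
      ContMDiff (𝓡 2) 𝓘(ℝ, ℝ) ∞ K → (∀ p, K p < 0 ∧ K p ≠ -1) →
      (∀ e ∈ 𝒜, NegCurv.CurvatureSystem e K K') →
      ∃ ψ : S → ℍ[ℝ],
        NegCurv.IsImmersionS3 ψ ∧ NegCurv.IsGaussMapS3 ψ g ∧
        NegCurv.HasExtrinsicCurvature ψ (NegCurv.normalS3 ψ g) K ∧
        ∀ e ∈ 𝒜, NegCurv.IsNull e ψ (NegCurv.normalS3 ψ g) ∧ ∀ p ∈ e.source,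
          0 < -(ε * (1 + K p)) * NegCurv.secondFF e ψ (NegCurv.normalS3 ψ g) 0 1 p ∧
          0 < -(ε * (1 + K p)) * NegCurv.orientS3 e ψ g p) :=
  ⟨fun _ _ hψ hg hK hK' hnull hcond =>
    NegCurv.exists_euclidean_of_spherical h𝒜 hψ hg hK hK' hnull hcond,
  fun _ _ _ _ hε hψ' hg hK' hneg hnull hKs hK hsys =>
    NegCurv.exists_spherical_of_euclidean h𝒜 hε hψ' hg hK' hneg hnull hKs hK hsys⟩
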